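/- Conventions. A dyadic interval is an interval $I=[2^k m,2^k(m+1)]$ with $k,m\in\mathbb Z$; its length is $|I|=2^k$. For $n\in\mathbb Z$ let $I_n:=[2^k(m-n),2^k(m+1-n)]$. Given $A\in\mathbb N$ and constants $C=(C_{\alpha,N})_{\alpha,N\in\mathbb N}$, a smooth function $\varphi:\mathbb R\to\mathbb C$ is a *bump adapted to $I$* if $$|\partial^\alpha\varphi(x)|\le C_{\alpha,N}\,\frac1{|I|^{\alpha}}\,\frac1{\left(1+\frac{\operatorname{dist}(x,I)}{|I|}\right)^{N}}\qquad\text{for all } x\in\mathbb R,\ 0\le\alpha\le A,\ N\in\mathbb N,$$ and then $|I|^{-1/2}\varphi$ is called an $L^2$-normalized bump adapted to $I$. Given also $c>0$, a family $(\Phi_I)_I$, indexed by all dyadic intervals, of $L^2$-normalized bumps $\Phi_I$ adapted to $I$ (all with the constants $C$) is of *$\psi$ type* if for every $I$ there is a compact interval $\omega_I$, depending only on $|I|$, with $\widehat{\Phi_I}=0$ outside $\omega_I$ and $$c^{-1}|I|^{-1}\le|\omega_I|\le c\,|I|^{-1},\qquad c^{-1}|I|^{-1}\le\operatorname{dist}(0,\omega_I)\le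 c\,|I|^{-1}.$$ For such a family put $$S^n g(x):=\Big(\sum_I\frac{|\langle g,\Phi_{I_n}\rangle|^2}{|I|}\,1_I(x)\Big)^{1/2},\qquad \langle g,\Phi\rangle=\int_{\mathbb R}g\,\overline{\Phi},$$ where the sum runs over all dyadic intervals $I$. Theorem. There is $A\in\mathbb N$ (sufficiently many derivatives) such that for every $1<p<\infty$, all constants $C=(C_{\alpha,N})$ and every $c>0$ there is $K\ge 0$, depending only on $p$, $C$ and $c$, such that for every $\psi$-type family $(\Phi_I)_I$ with the constants $A,C,c$, every $n\in\mathbb Z$ and every $g\in L^p(\mathbb R)$ one has $S^n g\in L^p(\mathbb R)$ and $$\|S^n g\|_{L^p(\mathbb R)}\le K\,\log(2+|n|)\,\|g\|_{L^p(\mathbb R)}.$$ -/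

import Mathlib

open MeasureTheory
open scoped ENNReal FourierTransform ContDiff

namespace ShiftedSquare

/-- The dyadic interval `[2^k m, 2^k (m+1)]`, recorded by its scale `k` and its position `m`
(the interval determines both). -/
@[ext]
structure DyadicInterval where
  /-- the scale `k` -/
  scale : ℤ
  /-- the position `m` -/
  pos : ℤ

namespace DyadicInterval

/-- The length `|I| = 2^k`. -/
noncomputable def length (I : DyadicInterval) : ℝ := (2 : ℝ) ^ I.scale

/-- The interval as a subset of the real line. -/
noncomputable def toSet (I : DyadicInterval) : Set ℝ :=
  Set.Icc ((2 : ℝ) ^ I.scale * I.pos) ((2 : ℝ) ^ I.scale * (I.pos + 1))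

/-- The interval `I_n = [2^k (m - n), 2^k (m + 1 - n)]`, which sits `n` units of length `|I|`
away from `I = [2^k m, 2^k (m + 1)]`. -/
def shift (n : ℤ) (I : DyadicInterval) : DyadicInterval := ⟨I.scale, I.pos - n⟩

end DyadicInterval

/-- `φ` is a bump adapted to `I`: it is smooth and, for all derivatives of order `α ≤ A` and
all `N`, `|∂^α φ(x)| ≤ C_{α,N} |I|^{-α} (1 + dist(x,I)/|I|)^{-N}`. -/
def IsBumpAdapted (A : ℕ) (C : ℕ → ℕ → ℝ) (I : DyadicInterval) (φ : ℝ → ℂ) : Prop :=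
  ContDiff ℝ ∞ φ ∧
    ∀ α ≤ A, ∀ N : ℕ, ∀ x : ℝ,
      ‖iteratedDeriv α φ x‖ ≤
        C α N * (1 / I.length ^ α) * (1 / (1 + Metric.infDist x I.toSet / I.length) ^ N)

/-- `Φ` is an `L²`-normalized bump adapted to `I`, that is `Φ = |I|^{-1/2} φ` with `φ` a bump
adapted to `I`. -/
def IsL2BumpAdapted (A : ℕ) (C : ℕ → ℕ → ℝ) (I : DyadicInterval) (Φ : ℝ → ℂ) : Prop :=
  ∃ φ : ℝ → ℂ, IsBumpAdapted A C I φ ∧ ∀ x, Φ x = ((Real.sqrt I.length)⁻¹ : ℝ) * φ x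

/-- `(Φ_I)_I` is a family of `ψ` type of `L²`-normalized bumps adapted to the dyadic intervals
`I`, with bump constants `C_{α,N}` (for `α ≤ A`) and comparability constant `c`: each `Φ_I` is
such a bump, and there are intervals `ω_{|I|} = [a_k, b_k]`, depending on the length
`|I| = 2^k` only, such that the Fourier transform of `Φ_I` is supported in `ω_{|I|}` and
`|ω_{|I|}| ∼ |I|⁻¹ ∼ dist(0, ω_{|I|})`, where `∼` means comparable up to the factor `c`. -/
def IsPsiType (A : ℕ) (C : ℕ → ℕ → ℝ) (c : ℝ) (Φ : DyadicInterval → ℝ → ℂ) : Prop :=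
  (∀ I, IsL2BumpAdapted A C I (Φ I)) ∧
    ∃ a b : ℤ → ℝ, ∀ I : DyadicInterval,
      Function.support (𝓕 (Φ I)) ⊆ Set.Icc (a I.scale) (b I.scale) ∧
      c⁻¹ * I.length⁻¹ ≤ b I.scale - a I.scale ∧
      b I.scale - a I.scale ≤ c * I.length⁻¹ ∧
      c⁻¹ * I.length⁻¹ ≤ Metric.infDist 0 (Set.Icc (a I.scale) (b I.scale)) ∧
      Metric.infDist 0 (Set.Icc (a I.scale) (b I.scale)) ≤ c * I.length⁻¹

/-- The pairing `⟨g, Φ⟩ = ∫ g(y) conj(Φ(y)) dy`. -/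
noncomputable def pairing (g Φ : ℝ → ℂ) : ℂ := ∫ y, g y * starRingEnd ℂ (Φ y)

/-- The shifted square function
`S^n g(x) = (∑_I |⟨g, Φ_{I_n}⟩|² / |I| · 1_I(x))^{1/2}`, with values in `[0, ∞]`, where the
sum runs over all dyadic intervals `I`. -/
noncomputable def shiftedSquare (Φ : DyadicInterval → ℝ → ℂ) (n : ℤ) (g : ℝ → ℂ) (x : ℝ) :
    ℝ≥0∞ :=
  (∑' I : DyadicInterval,
    I.toSet.indicator
      (fun _ => ‖pairing g (Φ (I.shift n))‖ₑ ^ 2 / ENNReal.ofReal I.length) x) ^ (1 / 2 : ℝ)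

end ShiftedSquare

/-! Three features of a ψ-type family are used: decay, a Lipschitz bound, and mean zero, which holds
because the Fourier support avoids 0 (`exists_isWavelet`). They make the family almost orthogonal,
and Schur's test yields the L² bound without any dependence on n, since shifting only permutes the
coefficients (`exists_tsum_pairing_le`, `tsum_coeff`).

The logarithm comes from one geometric fact. If I_n lies in J and |I| = 2^(-d)|J|, then I lies near
the translate of J by n 2^(-d)|J|. As d varies, only about log(2+|n|) of these translates are far
from J, so their union, the `shadow` of J, has measure at most a constant times log(2+|n|)|J|
(`volume_shadow_le`). Covering by shadows of maximal intervals gives the shifted dyadic maximal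
function a weak (1,1) constant of order log(2+|n|).

For p > 2 the square of S^n g has the form ∑ α_I |I|⁻¹ 1_I, and its L^(p/2) norm is controlled, by a
Carleson embedding, through the local masses |Q|⁻¹ ∑_{I ⊆ Q} α_I. In these the roughly log(2+|n|)
scales where |n|2^(-d) may exceed 1 are estimated without cancellation, each by shifted maximal
functions of |g|²; at the finer scales the shift is harmless, and the L² bound near Q together with
decay away from Q suffices (`exists_massBelow_coeff_le`). A logarithmic number of terms with a
logarithmic constant each gives log², and the square root restores log.

For p < 2, decompose g at height a in the manner of Calderón and Zygmund. The good part is treated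
in L². The coefficients of the mean-zero bad part are absolutely summable off the shadows of the
stopping intervals, and the shadows cost log(2+|n|) times the measure of the stopping set
(`exists_mul_volume_dyadicSum_le`). Integrating in a bounds ∫ (S^n g)^p by a multiple of log(2+|n|)
∫ |g|^p, which is enough because the logarithm is bounded below. -/

namespace ShiftedSquare

open scoped NNReal

/-! ### Dyadic intervals -/

namespace DyadicInterval

/-- The left endpoint of a dyadic interval. -/
noncomputable def left (I : DyadicInterval) : ℝ := (2 : ℝ) ^ I.scale * I.pos

/-- The half-open version of a dyadic interval. -/
def ico (I : DyadicInterval) : Set ℝ := Set.Ico I.left (I.left + I.length)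

/-- The length of a dyadic interval, as an extended nonnegative real. -/
noncomputable def elen (I : DyadicInterval) : ℝ≥0∞ := ENNReal.ofReal I.length

/-- Dyadic intervals are pairs of integers. -/
def equivProd : DyadicInterval ≃ ℤ × ℤ where
  toFun I := (I.scale, I.pos)
  invFun q := ⟨q.1, q.2⟩
  left_inv _ := rfl
  right_inv _ := rfl

instance : Countable DyadicInterval := equivProd.injective.countable

lemma length_pos (I : DyadicInterval) : 0 < I.length := by
  unfold length; positivity

lemma elen_ne_zero (I : DyadicInterval) : I.elen ≠ 0 := by
  simp [elen, I.length_pos]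

lemma elen_ne_top (I : DyadicInterval) : I.elen ≠ ⊤ := ENNReal.ofReal_ne_top

lemma shift_length (n : ℤ) (I : DyadicInterval) : (I.shift n).length = I.length := rfl

lemma shift_elen (n : ℤ) (I : DyadicInterval) : (I.shift n).elen = I.elen := rfl

lemma shift_left (n : ℤ) (I : DyadicInterval) : (I.shift n).left = I.left - n * I.length := by
  simp only [left, shift, length, Int.cast_sub]; ring

lemma shift_zero (I : DyadicInterval) : I.shift 0 = I := by
  ext <;> simp [shift]

/-- Shifting by `n` is a bijection of the dyadic intervals. -/
def shiftEquiv (n : ℤ) : DyadicInterval ≃ DyadicInterval where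
  toFun := shift n
  invFun := shift (-n)
  left_inv I := by ext <;> simp [shift]
  right_inv I := by ext <;> simp [shift]

lemma measurableSet_ico (I : DyadicInterval) : MeasurableSet I.ico := measurableSet_Ico

lemma volume_ico (I : DyadicInterval) : volume I.ico = I.elen := by
  simp [ico, elen]

lemma left_mem_ico (I : DyadicInterval) : I.left ∈ I.ico := by
  simp [ico, I.length_pos]

lemma mem_ico_iff (I : DyadicInterval) (x : ℝ) :
    x ∈ I.ico ↔ ⌊x / (2 : ℝ) ^ I.scale⌋ = I.pos := by
  have h : (0 : ℝ) < 2 ^ I.scale := by positivity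
  rw [Int.floor_eq_iff, le_div_iff₀ h, div_lt_iff₀ h, ico, Set.mem_Ico, left, length]
  constructor <;> rintro ⟨h1, h2⟩ <;> constructor <;> linarith

lemma mem_ico_shift (n : ℤ) (I : DyadicInterval) (x : ℝ) :
    x ∈ (I.shift n).ico ↔ x + n * I.length ∈ I.ico := by
  simp only [ico, Set.mem_Ico, shift_left, shift_length]
  constructor <;> rintro ⟨h1, h2⟩ <;> constructor <;> linarith

lemma eq_of_mem_of_scale_eq {I J : DyadicInterval} {x : ℝ} (hI : x ∈ I.ico) (hJ : x ∈ J.ico)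
    (h : I.scale = J.scale) : I = J := by
  rw [mem_ico_iff] at hI hJ
  ext
  · exact h
  · rw [← hI, ← hJ, h]

lemma length_eq_mul (J : DyadicInterval) (k : ℤ) (h : k ≤ J.scale) :
    J.length = 2 ^ (J.scale - k).toNat * (2 : ℝ) ^ k := by
  rw [length, ← zpow_natCast, ← zpow_add₀ two_ne_zero, Int.toNat_of_nonneg (by omega)]
  congr 1; omega

/-- The endpoints of the longer interval lie on the grid of the shorter one, so the strict
inequalities through the common point x become inequalities between integers. -/
lemma ico_subset_of_scale_le {I J : DyadicInterval} {x : ℝ} (hI : x ∈ I.ico) (hJ : x ∈ J.ico)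
    (h : I.scale ≤ J.scale) : I.ico ⊆ J.ico := by
  set d := (J.scale - I.scale).toNat
  have hl : J.length = 2 ^ d * (2 : ℝ) ^ I.scale := J.length_eq_mul _ h
  have hleft : J.left = (2 : ℝ) ^ I.scale * ((2 ^ d * J.pos : ℤ) : ℝ) := by
    have : J.left = J.length * J.pos := rfl
    rw [this, hl]; push_cast; ring
  have hpos : (0 : ℝ) < 2 ^ I.scale := by positivity
  obtain ⟨h1, h2⟩ := hI
  obtain ⟨h3, h4⟩ := hJ
  have hI1 : I.left = (2 : ℝ) ^ I.scale * I.pos := rfl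
  have hI2 : I.length = (2 : ℝ) ^ I.scale := rfl
  have a1 : (2 ^ d * J.pos : ℤ) ≤ I.pos := by
    have : (2 : ℝ) ^ I.scale * ((2 ^ d * J.pos : ℤ) : ℝ) < (2 : ℝ) ^ I.scale * ((I.pos + 1 : ℤ) : ℝ) := by
      rw [← hleft]; push_cast; linarith
    have := (mul_lt_mul_iff_right₀ hpos).1 this
    have := Int.cast_lt.1 this
    omega
  have a2 : I.pos + 1 ≤ (2 ^ d * J.pos + 2 ^ d : ℤ) := by
    have : (2 : ℝ) ^ I.scale * ((I.pos : ℤ) : ℝ)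
        < (2 : ℝ) ^ I.scale * ((2 ^ d * J.pos + 2 ^ d : ℤ) : ℝ) := by
      have e : (2 : ℝ) ^ I.scale * ((2 ^ d * J.pos + 2 ^ d : ℤ) : ℝ) = J.left + J.length := by
        rw [hleft, hl]; push_cast; ring
      rw [e]; linarith
    have := (mul_lt_mul_iff_right₀ hpos).1 this
    have := Int.cast_lt.1 this
    omega
  have b1 : J.left ≤ I.left := by
    rw [hleft, hI1]
    exact mul_le_mul_of_nonneg_left (by exact_mod_cast a1) hpos.le
  have b2 : I.left + I.length ≤ J.left + J.length := by
    have e : J.left + J.length = (2 : ℝ) ^ I.scale * ((2 ^ d * J.pos + 2 ^ d : ℤ) : ℝ) := by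
      rw [hleft, hl]; push_cast; ring
    have e' : I.left + I.length = (2 : ℝ) ^ I.scale * ((I.pos + 1 : ℤ) : ℝ) := by
      rw [hI1, hI2]; push_cast; ring
    rw [e, e']
    exact mul_le_mul_of_nonneg_left (by exact_mod_cast a2) hpos.le
  exact Set.Ico_subset_Ico b1 b2

lemma length_le_of_subset {I J : DyadicInterval} (h : I.ico ⊆ J.ico) : I.length ≤ J.length := by
  have := measure_mono (μ := volume) h
  rw [volume_ico, volume_ico, elen, elen] at this
  exact (ENNReal.ofReal_le_ofReal_iff J.length_pos.le).1 this

lemma length_le_iff {I J : DyadicInterval} : I.length ≤ J.length ↔ I.scale ≤ J.scale := by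
  unfold length
  exact zpow_le_zpow_iff_right₀ (by norm_num)

lemma scale_le_of_subset {I J : DyadicInterval} (h : I.ico ⊆ J.ico) : I.scale ≤ J.scale :=
  length_le_iff.1 (length_le_of_subset h)

/-- The dyadic interval containing the given one, of twice its length. -/
def parent (I : DyadicInterval) : DyadicInterval := ⟨I.scale + 1, I.pos / 2⟩

lemma parent_length (I : DyadicInterval) : I.parent.length = 2 * I.length := by
  simp only [length, parent]
  rw [zpow_add₀ two_ne_zero]; simp [mul_comm]

lemma left_mem_parent (I : DyadicInterval) : I.left ∈ I.parent.ico := by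
  have e : I.parent.left = I.length * ((2 * (I.pos / 2) : ℤ) : ℝ) := by
    have : I.parent.left = I.parent.length * ((I.pos / 2 : ℤ) : ℝ) := rfl
    rw [this, parent_length]; push_cast; ring
  have e' : I.left = I.length * I.pos := rfl
  rw [ico, Set.mem_Ico, parent_length, e, e']
  have h1 : 2 * (I.pos / 2) ≤ I.pos := by omega
  have h2 : I.pos < 2 * (I.pos / 2) + 2 := by omega
  have h1' : ((2 * (I.pos / 2) : ℤ) : ℝ) ≤ I.pos := by exact_mod_cast h1
  have h2' : (I.pos : ℝ) < ((2 * (I.pos / 2) : ℤ) : ℝ) + 2 := by exact_mod_cast h2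
  have := I.length_pos
  constructor <;> nlinarith

lemma subset_parent (I : DyadicInterval) : I.ico ⊆ I.parent.ico :=
  ico_subset_of_scale_le I.left_mem_ico I.left_mem_parent (by simp [parent])

lemma parent_ne (I : DyadicInterval) : I.parent ≠ I := by
  intro h
  have := congrArg scale h
  simp [parent] at this

/-- `J` is a maximal dyadic interval with the property `P`. -/
def IsMaximal (P : DyadicInterval → Prop) (J : DyadicInterval) : Prop :=
  P J ∧ ∀ K, P K → J.ico ⊆ K.ico → K = J

/-- Bounded scales give a largest scale among the intervals with `P` that contain I; an interval
containing the chosen one then has the same scale and equals it. -/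
lemma exists_isMaximal {P : DyadicInterval → Prop} (hP : ∃ s, ∀ K, P K → K.scale ≤ s)
    {I : DyadicInterval} (hI : P I) : ∃ J, IsMaximal P J ∧ I.ico ⊆ J.ico := by
  obtain ⟨s, hs⟩ := hP
  obtain ⟨k, ⟨K, hK, hIK, rfl⟩, hmax⟩ := Int.exists_greatest_of_bdd
    (P := fun k => ∃ K, P K ∧ I.ico ⊆ K.ico ∧ K.scale = k)
    ⟨s, by rintro _ ⟨K, hK, -, rfl⟩; exact hs K hK⟩ ⟨_, I, hI, subset_rfl, rfl⟩
  refine ⟨K, ⟨hK, fun L hL hKL => ?_⟩, hIK⟩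
  have h1 := hmax _ ⟨L, hL, hIK.trans hKL, rfl⟩
  exact eq_of_mem_of_scale_eq (hKL K.left_mem_ico) K.left_mem_ico
    (le_antisymm h1 (scale_le_of_subset hKL))

lemma IsMaximal.eq_of_mem {P : DyadicInterval → Prop} {J K : DyadicInterval}
    (hJ : IsMaximal P J) (hK : IsMaximal P K) {x : ℝ} (hxJ : x ∈ J.ico) (hxK : x ∈ K.ico) :
    J = K := by
  rcases le_total J.scale K.scale with h | h
  · exact (hJ.2 K hK.1 (ico_subset_of_scale_le hxJ hxK h)).symm
  · exact hK.2 J hJ.1 (ico_subset_of_scale_le hxK hxJ h)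

lemma IsMaximal.pairwise_disjoint (P : DyadicInterval → Prop) :
    Pairwise (Function.onFun Disjoint fun J : {J // IsMaximal P J} => J.1.ico) := by
  intro J K hJK
  refine Set.disjoint_left.2 fun x hx hx' => hJK ?_
  exact Subtype.ext (J.2.eq_of_mem K.2 hx hx')

lemma exists_scale_le_of_length_lt (R : ℝ) :
    ∃ s : ℤ, ∀ K : DyadicInterval, K.length < R → K.scale ≤ s := by
  obtain ⟨n, hn⟩ := pow_unbounded_of_one_lt R (one_lt_two (α := ℝ))
  refine ⟨n, fun K hK => ?_⟩
  have : (2 : ℝ) ^ K.scale < 2 ^ (n : ℤ) := by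
    rw [zpow_natCast]; exact lt_trans hK hn
  exact ((zpow_lt_zpow_iff_right₀ (by norm_num)).1 this).le

/-! ### Sums over dyadic intervals -/

/-- The scale k occurs in both sums, with d = 0, so this is an inequality and not an equality. -/
lemma tsum_le_tsum_scales (G : DyadicInterval → ℝ≥0∞) (k : ℤ) :
    ∑' I, G I ≤ (∑' d : ℕ, ∑' m : ℤ, G ⟨k + d, m⟩) + ∑' d : ℕ, ∑' m : ℤ, G ⟨k - d, m⟩ := by
  have h1 : ∑' I, G I = ∑' j : ℤ, ∑' m : ℤ, G ⟨j, m⟩ := by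
    rw [← equivProd.symm.tsum_eq G, ENNReal.tsum_prod']; rfl
  let e : ℕ ⊕ ℕ → ℤ := Sum.elim (fun d => k + d) (fun d => k - d)
  have he : Function.Surjective e := by
    intro j
    rcases le_total k j with h | h
    · exact ⟨Sum.inl (j - k).toNat, by simp only [e, Sum.elim_inl]; omega⟩
    · exact ⟨Sum.inr (k - j).toNat, by simp only [e, Sum.elim_inr]; omega⟩
  rw [h1]
  refine (ENNReal.tsum_le_tsum_comp_of_surjective he _).trans ?_
  rw [Summable.tsum_sum ENNReal.summable ENNReal.summable]
  rfl

lemma tsum_subset_le (G : DyadicInterval → ℝ≥0∞) (Q : DyadicInterval) :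
    ∑' I : {I : DyadicInterval // I.ico ⊆ Q.ico}, G I ≤
      ∑' d : ℕ, ∑' m : {m : ℤ // (⟨Q.scale - d, m⟩ : DyadicInterval).ico ⊆ Q.ico},
        G ⟨Q.scale - d, m⟩ := by
  let e : (Σ d : ℕ, {m : ℤ // (⟨Q.scale - d, m⟩ : DyadicInterval).ico ⊆ Q.ico}) →
    {I : DyadicInterval // I.ico ⊆ Q.ico} := fun q => ⟨⟨Q.scale - q.1, q.2.1⟩, q.2.2⟩
  have he : Function.Surjective e := by
    rintro ⟨⟨k, m⟩, hI⟩
    have hk : k ≤ Q.scale := scale_le_of_subset hI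
    have hk' : Q.scale - ((Q.scale - k).toNat : ℤ) = k := by omega
    refine ⟨⟨(Q.scale - k).toNat, ⟨m, by rw [hk']; exact hI⟩⟩, ?_⟩
    apply Subtype.ext
    simp only [e]
    ext
    · exact hk'
    · rfl
  refine (ENNReal.tsum_le_tsum_comp_of_surjective he (fun I => G I.1)).trans (le_of_eq ?_)
  rw [ENNReal.tsum_sigma']

lemma lintegral_eq_tsum_ico (f : ℝ → ℝ≥0∞) (k : ℤ) :
    ∫⁻ y, f y = ∑' m : ℤ, ∫⁻ y in (⟨k, m⟩ : DyadicInterval).ico, f y := by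
  rw [← lintegral_iUnion (fun _ => measurableSet_ico _)]
  · have : (⋃ m : ℤ, (⟨k, m⟩ : DyadicInterval).ico) = Set.univ := by
      refine Set.eq_univ_of_forall fun x => Set.mem_iUnion.2 ⟨⌊x / (2 : ℝ) ^ k⌋, ?_⟩
      rw [mem_ico_iff]
    rw [this, Measure.restrict_univ]
  · intro m m' hm
    refine Set.disjoint_left.2 fun x hx hx' => hm ?_
    exact congrArg pos (eq_of_mem_of_scale_eq hx hx' rfl)

lemma lintegral_eq_tsum_shift (f : ℝ → ℝ≥0∞) (Q : DyadicInterval) :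
    ∫⁻ y, f y = ∑' r : ℤ, ∫⁻ y in (Q.shift r).ico, f y := by
  rw [lintegral_eq_tsum_ico f Q.scale, ← (Equiv.subLeft Q.pos).tsum_eq]
  rfl

/-! ### Decaying weights -/

/-- The decay factor `(1 + |y - left I| / |I|)⁻¹`. -/
noncomputable def decay (I : DyadicInterval) (y : ℝ) : ℝ≥0∞ :=
  ENNReal.ofReal ((1 + |y - I.left| / I.length)⁻¹)

lemma one_le_weight (I : DyadicInterval) (y : ℝ) : 1 ≤ 1 + |y - I.left| / I.length := by
  have := I.length_pos
  have : 0 ≤ |y - I.left| / I.length := by positivity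
  linarith

lemma decay_le_one (I : DyadicInterval) (y : ℝ) : I.decay y ≤ 1 := by
  rw [decay, ENNReal.ofReal_le_one]
  exact inv_le_one_of_one_le₀ (I.one_le_weight y)

lemma continuous_decay (I : DyadicInterval) : Continuous I.decay := by
  unfold decay
  refine ENNReal.continuous_ofReal.comp (Continuous.inv₀ (by fun_prop) fun y => ?_)
  have := I.one_le_weight y
  linarith

@[fun_prop]
lemma measurable_decay (I : DyadicInterval) : Measurable I.decay := I.continuous_decay.measurable

/-- Comparison of decay factors from a comparison of weights. -/
lemma decay_le_mul {I J : DyadicInterval} {x y : ℝ} {c : ℝ} (hc : 0 < c)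
    (h : 1 + |y - J.left| / J.length ≤ c * (1 + |x - I.left| / I.length)) :
    I.decay x ≤ ENNReal.ofReal c * J.decay y := by
  have h1 := I.one_le_weight x
  have h2 := J.one_le_weight y
  rw [decay, decay, ← ENNReal.ofReal_mul hc.le]
  refine ENNReal.ofReal_le_ofReal ?_
  rw [inv_le_iff_one_le_mul₀ (by linarith), mul_assoc, mul_left_comm, ← div_eq_inv_mul,
    le_div_iff₀ (by linarith)]
  linarith

lemma decay_le_of_le {I : DyadicInterval} {y : ℝ} {c : ℝ} (hc : 0 < c)
    (h : c ≤ 1 + |y - I.left| / I.length) : I.decay y ≤ (ENNReal.ofReal c)⁻¹ := by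
  rw [decay, ← ENNReal.ofReal_inv_of_pos hc]
  exact ENNReal.ofReal_le_ofReal (inv_anti₀ hc h)

end DyadicInterval

/-- The sequence `(1 + |r|)⁻¹`. -/
noncomputable def rho (r : ℤ) : ℝ≥0∞ := ENNReal.ofReal ((1 + |(r : ℝ)|)⁻¹)

lemma rho_ne_top (r : ℤ) : rho r ≠ ⊤ := ENNReal.ofReal_ne_top

lemma rho_mul (r : ℤ) : rho r * ENNReal.ofReal (1 + |(r : ℝ)|) = 1 := by
  have h : 0 < 1 + |(r : ℝ)| := by positivity
  rw [rho, ← ENNReal.ofReal_mul (by positivity), inv_mul_cancel₀ h.ne', ENNReal.ofReal_one]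

/-- The sum of the squares `(1 + |r|)⁻²`. -/
noncomputable def rhoSum : ℝ≥0∞ := ∑' r : ℤ, rho r ^ 2

lemma rhoSum_ne_top : rhoSum ≠ ⊤ := by
  have h : Summable fun r : ℤ => ((1 + |(r : ℝ)|)⁻¹) ^ 2 := by
    refine Summable.of_nonneg_of_le (fun _ => by positivity) (fun r => ?_)
      (((Real.summable_one_div_int_pow (p := 2)).2 (by norm_num)).add
        (summable_of_ne_finset_zero (s := {0}) (f := fun r : ℤ => if r = 0 then (1 : ℝ) else 0)
          (by intro b hb; simp at hb; simp [hb])))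
    by_cases hr : r = 0
    · subst hr; simp
    · simp only [hr, if_false, add_zero, one_div]
      have hr' : (0 : ℝ) < |(r : ℝ)| := by simpa using hr
      rw [inv_pow, ← sq_abs (r : ℝ)]
      exact inv_anti₀ (by positivity) (pow_le_pow_left₀ hr'.le (by linarith) 2)
  have e : rhoSum = ∑' r : ℤ, ENNReal.ofReal (((1 + |(r : ℝ)|)⁻¹) ^ 2) := by
    unfold rhoSum rho
    exact tsum_congr fun r => (ENNReal.ofReal_pow (by positivity) 2).symm
  rw [e]
  exact h.tsum_ofReal_ne_top

/-- Recentring at ⌊t⌋ moves t by less than one, so each weight changes by at most a factor 2, which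
the square turns into 4. -/
lemma tsum_lattice_le (t : ℝ) :
    ∑' m : ℤ, ENNReal.ofReal ((1 + |t - m|)⁻¹) ^ 2 ≤ 4 * rhoSum := by
  rw [← (Equiv.subLeft ⌊t⌋).tsum_eq, rhoSum, ← ENNReal.tsum_mul_left]
  refine ENNReal.tsum_le_tsum fun r => ?_
  have h4 : (4 : ℝ≥0∞) = ENNReal.ofReal 2 ^ 2 := by
    rw [← ENNReal.ofReal_pow (by norm_num)]; norm_num
  rw [h4, ← mul_pow, rho, ← ENNReal.ofReal_mul (by norm_num)]
  refine pow_le_pow_left' (ENNReal.ofReal_le_ofReal ?_) 2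
  simp only [Equiv.subLeft_apply, Int.cast_sub]
  rw [← div_eq_mul_inv, inv_eq_one_div, div_le_div_iff₀ (by positivity) (by positivity)]
  have h1 := Int.floor_le t
  have h2 := (Int.lt_floor_add_one t).le
  have h3 : |(r : ℝ)| ≤ |t - (⌊t⌋ - r)| + 1 := by
    have : (r : ℝ) = (t - (⌊t⌋ - r)) - (t - ⌊t⌋) := by ring
    calc |(r : ℝ)| = |(t - (⌊t⌋ - r)) - (t - ⌊t⌋)| := by rw [← this]
      _ ≤ |t - (⌊t⌋ - r)| + |t - ⌊t⌋| := abs_sub _ _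
      _ ≤ _ := by
        gcongr; rw [abs_le]; constructor <;> linarith
  have := abs_nonneg (t - (⌊t⌋ - r))
  linarith

namespace DyadicInterval

lemma tsum_decay_sq_le (k : ℤ) (y : ℝ) :
    ∑' m : ℤ, (⟨k, m⟩ : DyadicInterval).decay y ^ 2 ≤ 4 * rhoSum := by
  refine le_trans (le_of_eq (tsum_congr fun m => ?_)) (tsum_lattice_le (y / 2 ^ k))
  have h : (0 : ℝ) < 2 ^ k := by positivity
  simp only [decay, left, length]
  congr 3
  rw [← abs_of_pos h, ← abs_div, abs_of_pos h]
  congr 2; field_simp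

/-- Summing the decay away from `I` over the left endpoints of the intervals of length
`2⁻ᵈ |I|`. -/
lemma tsum_decay_left_sq_le (I : DyadicInterval) (d : ℕ) :
    ∑' m : ℤ, I.decay (⟨I.scale - d, m⟩ : DyadicInterval).left ^ 2 ≤ 2 ^ d * (4 * rhoSum) := by
  -- In one residue class modulo 2^d the left endpoints are spaced by |I|, so `tsum_lattice_le`
  -- applies to each of the 2^d classes.
  rw [← (Int.divModEquiv (2 ^ d)).symm.tsum_eq, ENNReal.tsum_prod', ENNReal.tsum_comm]
  have key : ∀ r : Fin (2 ^ d), ∑' q : ℤ,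
      I.decay (⟨I.scale - d, (Int.divModEquiv (2 ^ d)).symm (q, r)⟩ : DyadicInterval).left ^ 2
      ≤ 4 * rhoSum := by
    intro r
    refine le_trans (le_of_eq (tsum_congr fun q => ?_))
      (tsum_lattice_le (I.pos - (r : ℕ) / 2 ^ d))
    have h : (0 : ℝ) < 2 ^ I.scale := by positivity
    simp only [decay, left, length, Int.divModEquiv_symm_apply]
    congr 3
    rw [← abs_of_pos h, ← abs_div, abs_of_pos h, abs_sub_comm]
    congr 2
    rw [zpow_sub₀ two_ne_zero, zpow_natCast]
    push_cast
    field_simp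
    ring
  refine (ENNReal.tsum_le_tsum key).trans ?_
  simp

lemma decay_le_rho {Q : DyadicInterval} {r : ℤ} {y : ℝ} (hy : y ∈ (Q.shift r).ico) :
    Q.decay y ≤ 2 * rho r := by
  have h : 0 < Q.length := Q.length_pos
  rw [ico, Set.mem_Ico, shift_left, shift_length] at hy
  have h2 : (2 : ℝ≥0∞) = ENNReal.ofReal 2 := by norm_num
  rw [h2, rho, decay, ← ENNReal.ofReal_mul (by norm_num)]
  refine ENNReal.ofReal_le_ofReal ?_
  rw [← div_eq_mul_inv, inv_eq_one_div, div_le_div_iff₀ (by positivity) (by positivity)]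
  have h3 : |(r : ℝ)| * Q.length ≤ |y - Q.left| + Q.length := by
    rw [← abs_of_pos h, ← abs_mul, abs_of_pos h]
    have : (r : ℝ) * Q.length = -(y - Q.left) + (y - (Q.left - r * Q.length)) := by ring
    rw [this]
    refine (abs_add_le _ _).trans ?_
    rw [abs_neg]
    gcongr
    rw [abs_le]; constructor <;> linarith [hy.1, hy.2]
  have h4 : |(r : ℝ)| ≤ |y - Q.left| / Q.length + 1 := by
    rw [div_add_one h.ne', le_div_iff₀ h]; exact h3
  have : 0 ≤ |y - Q.left| / Q.length := by positivity
  linarith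

lemma lintegral_mul_decay_le (f : ℝ → ℝ≥0∞) (Q : DyadicInterval) (e : ℕ) :
    ∫⁻ y, f y * Q.decay y ^ e ≤ 2 ^ e * ∑' r : ℤ, rho r ^ e * ∫⁻ y in (Q.shift r).ico, f y := by
  rw [lintegral_eq_tsum_shift _ Q, ← ENNReal.tsum_mul_left]
  refine ENNReal.tsum_le_tsum fun r => ?_
  rw [← mul_assoc, ← mul_pow, mul_comm, ← lintegral_mul_const' _ _
    (ENNReal.pow_ne_top (ENNReal.mul_ne_top (by norm_num) (rho_ne_top r)))]
  refine setLIntegral_mono' (measurableSet_ico _) fun y hy => ?_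
  gcongr
  exact decay_le_rho hy

lemma lintegral_decay_sq_le (Q : DyadicInterval) :
    ∫⁻ y, Q.decay y ^ 2 ≤ 4 * rhoSum * Q.elen := by
  have := lintegral_mul_decay_le (fun _ => 1) Q 2
  simp only [one_mul, lintegral_const, MeasurableSet.univ, Measure.restrict_apply, Set.univ_inter,
    volume_ico, shift_elen, ENNReal.tsum_mul_right] at this
  refine this.trans (le_of_eq ?_)
  rw [rhoSum, mul_assoc]; norm_num

end DyadicInterval

open DyadicInterval

/-! ### Wavelet families -/

/-- A family of continuous functions of mean zero, with decay and Lipschitz bounds adapted to the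
dyadic intervals (normalized in `L^∞`). -/
structure IsWavelet (D : ℝ≥0) (φ : DyadicInterval → ℝ → ℂ) : Prop where
  continuous : ∀ I, Continuous (φ I)
  enorm_le : ∀ I y, ‖φ I y‖ₑ ≤ D * I.decay y ^ 6
  -- The quadratic factor pays for moving the decay of the derivative from the points between y and
  -- z to z itself.
  enorm_sub_le : ∀ I y z, ‖φ I y - φ I z‖ₑ ≤
    D * (ENNReal.ofReal (|y - z| / I.length) * ENNReal.ofReal (1 + |y - z| / I.length) ^ 2) *
      I.decay z ^ 2
  integral_eq_zero : ∀ I, ∫ y, φ I y = 0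

lemma weight_le_infDist (I : DyadicInterval) (x : ℝ) :
    1 + |x - I.left| / I.length ≤ 2 * (1 + Metric.infDist x I.toSet / I.length) := by
  have h := I.length_pos
  have e : I.toSet = Set.Icc I.left (I.left + I.length) := by
    simp only [toSet, left, length]; congr 1; ring
  have h1 : |x - I.left| - I.length ≤ Metric.infDist x I.toSet := by
    rw [e]
    refine (Metric.le_infDist (Set.nonempty_Icc.2 (by linarith))).2 fun {y} hy => ?_
    rw [Real.dist_eq]
    have h2 : |x - I.left| ≤ |x - y| + |y - I.left| := abs_sub_le _ _ _
    have h3 : |y - I.left| ≤ I.length := by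
      rw [abs_le]; constructor <;> linarith [hy.1, hy.2]
    linarith
  have h4 : |x - I.left| / I.length ≤ 1 + Metric.infDist x I.toSet / I.length := by
    rw [← div_self h.ne', ← add_div]; gcongr; linarith
  have h5 : 0 ≤ Metric.infDist x I.toSet / I.length := by
    have := Metric.infDist_nonneg (x := x) (s := I.toSet)
    positivity
  linarith

lemma bump_bound_le (I : DyadicInterval) (x K : ℝ) (hK : 0 ≤ K) :
    K * (1 / (1 + Metric.infDist x I.toSet / I.length) ^ 6) ≤
      2 ^ 6 * K * ((1 + |x - I.left| / I.length)⁻¹) ^ 6 := by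
  have h1 := weight_le_infDist I x
  have h2 := I.one_le_weight x
  have h5 : 0 < 1 + Metric.infDist x I.toSet / I.length := by linarith
  rw [mul_comm (2 ^ 6) K, mul_assoc]
  refine mul_le_mul_of_nonneg_left ?_ hK
  rw [← mul_pow, one_div, ← inv_pow]
  refine pow_le_pow_left₀ (by positivity) ?_ 6
  rw [inv_eq_one_div, ← div_eq_mul_inv, div_le_div_iff₀ h5 (by linarith)]
  linarith

/-- Submultiplicativity of the weight: it transfers decay from one point to another at a polynomial
cost in their distance. -/
lemma weight_le_mul (I : DyadicInterval) (u z : ℝ) :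
    1 + |z - I.left| / I.length ≤ (1 + |z - u| / I.length) * (1 + |u - I.left| / I.length) := by
  have h := I.length_pos
  have h1 : |z - I.left| / I.length ≤ |z - u| / I.length + |u - I.left| / I.length := by
    rw [← add_div]; gcongr; exact abs_sub_le _ _ _
  have : 0 ≤ |z - u| / I.length * (|u - I.left| / I.length) := by positivity
  linarith

lemma ofReal_inv_pow (I : DyadicInterval) (x : ℝ) (e : ℕ) :
    ENNReal.ofReal (((1 + |x - I.left| / I.length)⁻¹) ^ e) = I.decay x ^ e := by
  rw [decay, ENNReal.ofReal_pow]
  have := I.one_le_weight x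
  positivity

/-- The interval ω_I has positive distance from 0, so the Fourier transform vanishes at 0, where its
value is the integral. -/
lemma integral_eq_zero_of_psiType {A : ℕ} {C : ℕ → ℕ → ℝ} {c : ℝ} (hc : 0 < c)
    {Φ : DyadicInterval → ℝ → ℂ} (h : IsPsiType A C c Φ) (I : DyadicInterval) :
    ∫ y, Φ I y = 0 := by
  obtain ⟨-, a, b, hab⟩ := h
  obtain ⟨hs, -, -, hd, -⟩ := hab I
  have h0 : (0 : ℝ) ∉ Set.Icc (a I.scale) (b I.scale) := by
    intro h0
    rw [Metric.infDist_zero_of_mem h0] at hd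
    have := I.length_pos
    have : 0 < c⁻¹ * I.length⁻¹ := by positivity
    linarith
  have h1 : 𝓕 (Φ I) 0 = 0 := Function.notMem_support.1 fun h => h0 (hs h)
  rw [Real.fourier_real_eq] at h1
  simpa using h1

/-- Up to the normalization, `ψ` type families are wavelet families. -/
lemma exists_isWavelet (C : ℕ → ℕ → ℝ) {c : ℝ} (hc : 0 < c) :
    ∃ D : ℝ≥0, ∀ Φ : DyadicInterval → ℝ → ℂ, IsPsiType 1 C c Φ →
      ∃ φ, IsWavelet D φ ∧ ∀ I x, Φ I x = ((Real.sqrt I.length)⁻¹ : ℝ) * φ I x := by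
  -- Only N = 6 and the orders 0 and 1 are needed; 2^6 is the price of measuring distance from the
  -- left endpoint instead of from the interval.
  set K : ℝ := 2 ^ 6 * max |C 0 6| |C 1 6| with hK
  have hK0 : 0 ≤ max |C 0 6| |C 1 6| := le_max_of_le_left (abs_nonneg _)
  have hK1 : 0 ≤ K := by positivity
  refine ⟨K.toNNReal, fun Φ hΦ => ?_⟩
  choose φ hφ using fun I => hΦ.1 I
  have hb0 : ∀ I x, ‖φ I x‖ ≤ K * ((1 + |x - I.left| / I.length)⁻¹) ^ 6 := by
    intro I x
    have := (hφ I).1.2 0 (by norm_num) 6 x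
    simp only [iteratedDeriv_zero, pow_zero, div_one, mul_one] at this
    refine this.trans (le_trans ?_ (bump_bound_le I x _ hK0))
    have : 0 ≤ Metric.infDist x I.toSet / I.length :=
      div_nonneg Metric.infDist_nonneg I.length_pos.le
    gcongr
    exact (le_abs_self _).trans (le_max_left _ _)
  have hb1 : ∀ I x, ‖deriv (φ I) x‖ ≤
      K * I.length⁻¹ * ((1 + |x - I.left| / I.length)⁻¹) ^ 6 := by
    intro I x
    have := (hφ I).1.2 1 le_rfl 6 x
    simp only [iteratedDeriv_one, pow_one] at this
    have hl := I.length_pos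
    have h2 : 0 ≤ Metric.infDist x I.toSet / I.length :=
      div_nonneg Metric.infDist_nonneg I.length_pos.le
    calc _ ≤ _ := this
      _ ≤ max |C 0 6| |C 1 6| * (1 / I.length) *
          (1 / (1 + Metric.infDist x I.toSet / I.length) ^ 6) := by
        gcongr
        exact (le_abs_self _).trans (le_max_right _ _)
      _ = (max |C 0 6| |C 1 6| * (1 / (1 + Metric.infDist x I.toSet / I.length) ^ 6)) *
          I.length⁻¹ := by ring
      _ ≤ (K * ((1 + |x - I.left| / I.length)⁻¹) ^ 6) * I.length⁻¹ := by
        exact mul_le_mul_of_nonneg_right (bump_bound_le I x _ hK0) (by positivity)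
      _ = _ := by ring
  have hKe : ((K.toNNReal : ℝ≥0) : ℝ≥0∞) = ENNReal.ofReal K := rfl
  refine ⟨φ, ⟨fun I => (hφ I).1.1.continuous, fun I y => ?_, fun I y z => ?_, fun I => ?_⟩,
    fun I => (hφ I).2⟩
  · rw [hKe, ← ofReal_inv_pow, ← ENNReal.ofReal_mul hK1, ← ofReal_norm]
    exact ENNReal.ofReal_le_ofReal (hb0 I y)
  · have hl := I.length_pos
    have hw := I.one_le_weight z
    rw [hKe, ← ofReal_inv_pow, ← ENNReal.ofReal_pow (by positivity),
      ← ENNReal.ofReal_mul (by positivity), ← ENNReal.ofReal_mul hK1,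
      ← ENNReal.ofReal_mul (by positivity), ← ofReal_norm]
    refine ENNReal.ofReal_le_ofReal ?_
    have := (convex_uIcc z y).norm_image_sub_le_of_norm_deriv_le (f := φ I)
      (C := K * I.length⁻¹ *
        ((1 + |y - z| / I.length) ^ 2 * ((1 + |z - I.left| / I.length)⁻¹) ^ 2))
      (fun u _ => ((hφ I).1.1.differentiable (by simp)).differentiableAt) (fun u hu => ?_)
      Set.left_mem_uIcc Set.right_mem_uIcc
    · refine this.trans (le_of_eq ?_)
      rw [Real.norm_eq_abs]; field_simp
    · refine (hb1 I u).trans (mul_le_mul_of_nonneg_left ?_ (by positivity))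
      have hu1 := I.one_le_weight u
      -- Two powers of the decay at u are kept; `weight_le_mul` moves them to z at the cost of the
      -- quadratic factor.
      have h1 : ((1 + |u - I.left| / I.length)⁻¹) ^ 6 ≤ ((1 + |u - I.left| / I.length)⁻¹) ^ 2 :=
        pow_le_pow_of_le_one (by positivity) (inv_le_one_of_one_le₀ hu1) (by norm_num)
      refine h1.trans ?_
      rw [← mul_pow]
      refine pow_le_pow_left₀ (by positivity) ?_ 2
      rw [inv_eq_one_div, ← div_eq_mul_inv, div_le_div_iff₀ (by linarith) (by linarith), one_mul]
      refine (weight_le_mul I u z).trans ?_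
      have h3 := Set.abs_sub_left_of_mem_uIcc hu
      rw [abs_sub_comm] at h3
      gcongr ?_ * _
      gcongr 1 + ?_ / _
  · have h1 := integral_eq_zero_of_psiType hc hΦ I
    simp only [(hφ I).2] at h1
    rw [integral_const_mul] at h1
    have hl := Real.sqrt_pos.2 I.length_pos
    rcases mul_eq_zero.1 h1 with h2 | h2
    · exact absurd h2 (by exact_mod_cast (inv_pos.2 hl).ne')
    · exact h2

lemma tsum_inv_two_pow : ∑' d : ℕ, ((2 : ℝ≥0∞) ^ d)⁻¹ = 2 := by
  simp_rw [ENNReal.inv_pow]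
  rw [ENNReal.tsum_geometric, ENNReal.one_sub_inv_two, inv_inv]

namespace IsWavelet

variable {D : ℝ≥0} {φ : DyadicInterval → ℝ → ℂ}

lemma enorm_le_one (h : IsWavelet D φ) (I : DyadicInterval) (y : ℝ) : ‖φ I y‖ₑ ≤ D := by
  refine (h.enorm_le I y).trans ?_
  exact mul_le_of_le_one_right' (pow_le_one' (I.decay_le_one y) 6)

lemma enorm_le_of_le (h : IsWavelet D φ) (I : DyadicInterval) (y : ℝ) {e : ℕ} (he : e ≤ 6) :
    ‖φ I y‖ₑ ≤ D * I.decay y ^ e := by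
  refine (h.enorm_le I y).trans ?_
  exact mul_le_mul_right (pow_le_pow_right_of_le_one' (I.decay_le_one y) he) _

lemma lintegral_enorm_le (h : IsWavelet D φ) (I : DyadicInterval) :
    ∫⁻ y, ‖φ I y‖ₑ ≤ D * (4 * rhoSum * I.elen) := by
  refine (lintegral_mono fun y => h.enorm_le_of_le I y (e := 2) (by norm_num)).trans ?_
  rw [lintegral_const_mul' _ _ ENNReal.coe_ne_top]
  gcongr
  exact lintegral_decay_sq_le I

lemma integrable (h : IsWavelet D φ) (I : DyadicInterval) : Integrable (φ I) := by
  refine ⟨(h.continuous I).aestronglyMeasurable, ?_⟩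
  refine lt_of_le_of_lt (h.lintegral_enorm_le I) ?_
  exact ENNReal.mul_lt_top ENNReal.coe_lt_top (ENNReal.mul_lt_top
    (ENNReal.mul_lt_top (by norm_num) rhoSum_ne_top.lt_top) I.elen_ne_top.lt_top)

lemma memLp_top (h : IsWavelet D φ) (I : DyadicInterval) : MemLp (φ I) ⊤ := by
  refine memLp_top_of_bound (h.continuous I).aestronglyMeasurable D (ae_of_all _ fun y => ?_)
  have := h.enorm_le_one I y
  rw [enorm_le_coe] at this
  exact_mod_cast this

lemma memLp (h : IsWavelet D φ) (I : DyadicInterval) {r : ℝ≥0∞} (hr : 1 ≤ r) :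
    MemLp (φ I) r := by
  rcases eq_or_ne r ⊤ with rfl | hr'
  · exact h.memLp_top I
  have hr0 : r ≠ 0 := (lt_of_lt_of_le one_pos hr).ne'
  have hr1 : 1 ≤ r.toReal := by
    rw [← ENNReal.toReal_one]; exact ENNReal.toReal_mono hr' hr
  refine ⟨(h.continuous I).aestronglyMeasurable, ?_⟩
  rw [eLpNorm_lt_top_iff_lintegral_rpow_enorm_lt_top hr0 hr']
  have hb : ∀ y, ‖φ I y‖ₑ ^ r.toReal ≤ (D : ℝ≥0∞) ^ r.toReal * I.decay y ^ 2 := by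
    intro y
    refine (ENNReal.rpow_le_rpow (h.enorm_le_of_le I y (e := 2) (by norm_num))
      (by positivity)).trans ?_
    rw [ENNReal.mul_rpow_of_nonneg _ _ (by positivity)]
    refine mul_le_mul_right ?_ _
    refine (ENNReal.rpow_le_rpow_of_exponent_ge (pow_le_one' (I.decay_le_one y) 2) hr1).trans ?_
    rw [ENNReal.rpow_one]
  refine lt_of_le_of_lt (lintegral_mono hb) ?_
  have hD : (D : ℝ≥0∞) ^ r.toReal ≠ ⊤ := ENNReal.rpow_ne_top_of_nonneg (by positivity) (by simp)
  rw [lintegral_const_mul' _ _ hD]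
  refine ENNReal.mul_lt_top hD.lt_top (lt_of_le_of_lt (lintegral_decay_sq_le I) ?_)
  exact ENNReal.mul_lt_top (ENNReal.mul_lt_top (by norm_num) rhoSum_ne_top.lt_top)
    I.elen_ne_top.lt_top

lemma memLp_conj (h : IsWavelet D φ) (I : DyadicInterval) {r : ℝ≥0∞} (hr : 1 ≤ r) :
    MemLp (fun y => starRingEnd ℂ (φ I y)) r := (h.memLp I hr).star

lemma integrable_mul (h : IsWavelet D φ) (I : DyadicInterval) {p : ℝ≥0∞} (hp : 1 ≤ p)
    {g : ℝ → ℂ} (hg : MemLp g p) : Integrable fun y => g y * starRingEnd ℂ (φ I y) := by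
  have := ENNReal.HolderConjugate.conjExponent hp
  exact hg.integrable_mul (h.memLp_conj I (r := p.conjExponent)
    (ENNReal.HolderConjugate.one_le p.conjExponent p))

/-! ### Almost orthogonality -/

/-- Since φ_J has mean zero, the constant φ_I(left J) may be subtracted from φ_I; over the length of
J the Lipschitz bound at scale |I| then gains |J|/|I|. -/
lemma enorm_gram_le (h : IsWavelet D φ) (I : DyadicInterval) (J : DyadicInterval)
    (hJI : J.length ≤ I.length) :
    ‖∫ y, φ I y * starRingEnd ℂ (φ J y)‖ₑ ≤
      D ^ 2 * (ENNReal.ofReal (J.length / I.length) * (4 * rhoSum * J.elen)) *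
        I.decay J.left ^ 2 := by
  have hI := I.length_pos
  have hJ := J.length_pos
  have e : ∫ y, φ I y * starRingEnd ℂ (φ J y) =
      ∫ y, (φ I y - φ I J.left) * starRingEnd ℂ (φ J y) := by
    simp_rw [sub_mul]
    rw [integral_sub (h.integrable_mul J le_rfl (memLp_one_iff_integrable.2 (h.integrable I))),
      integral_const_mul, integral_conj, h.integral_eq_zero]
    · simp
    · exact (memLp_one_iff_integrable.1 (h.memLp_conj J le_rfl)).const_mul _
  rw [e]
  refine (enorm_integral_le_lintegral_enorm _).trans ?_
  have hb : ∀ y, ‖(φ I y - φ I J.left) * starRingEnd ℂ (φ J y)‖ₑ ≤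
      (D ^ 2 * ENNReal.ofReal (J.length / I.length) * I.decay J.left ^ 2) * J.decay y ^ 2 := by
    intro y
    have hw := J.one_le_weight y
    rw [enorm_mul, RCLike.enorm_conj]
    refine (mul_le_mul' (h.enorm_sub_le I y J.left) (h.enorm_le J y)).trans ?_
    set w := ENNReal.ofReal (1 + |y - J.left| / J.length) with hwdef
    have h1 : ENNReal.ofReal (|y - J.left| / I.length) ≤
        ENNReal.ofReal (J.length / I.length) * w := by
      rw [hwdef, ← ENNReal.ofReal_mul (by positivity)]
      refine ENNReal.ofReal_le_ofReal ?_
      have : |y - J.left| / I.length = J.length / I.length * (|y - J.left| / J.length) := by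
        field_simp
      rw [this]
      gcongr
      linarith
    have h2 : ENNReal.ofReal (1 + |y - J.left| / I.length) ≤ w := by
      refine ENNReal.ofReal_le_ofReal ?_
      gcongr
    -- Three of the six powers of the decay cancel w · w² from the Lipschitz bound; two of the
    -- remaining three are kept for integrability.
    have h3 : w * J.decay y = 1 := by
      rw [hwdef, decay, ← ENNReal.ofReal_mul (by positivity), mul_inv_cancel₀ (by positivity),
        ENNReal.ofReal_one]
    calc _ ≤ D * ((ENNReal.ofReal (J.length / I.length) * w) * w ^ 2) * I.decay J.left ^ 2 *
          (D * J.decay y ^ 6) := by gcongr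
      _ = (D ^ 2 * ENNReal.ofReal (J.length / I.length) * I.decay J.left ^ 2) *
          ((w * J.decay y) ^ 3 * J.decay y ^ 3) := by ring
      _ ≤ _ := by
        rw [h3, one_pow, one_mul]
        exact mul_le_mul_right
          (pow_le_pow_right_of_le_one' (J.decay_le_one y) (by norm_num)) _
  refine (lintegral_mono hb).trans ?_
  rw [lintegral_const_mul _ (by fun_prop)]
  calc _ ≤ (D ^ 2 * ENNReal.ofReal (J.length / I.length) * I.decay J.left ^ 2) *
        (4 * rhoSum * J.elen) := by gcongr; exact lintegral_decay_sq_le J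
    _ = _ := by ring

lemma enorm_gram_comm (I J : DyadicInterval) :
    ‖∫ y, φ I y * starRingEnd ℂ (φ J y)‖ₑ = ‖∫ y, φ J y * starRingEnd ℂ (φ I y)‖ₑ := by
  rw [← RCLike.enorm_conj, ← integral_conj]
  congr 2
  ext y
  simp [mul_comm]

/-- These are the row sums for Schur's test. For |J| = 2^d |I| the gain 2^(-d) is summable over d.
For |J| = 2^(-d) |I| the gain is 2^(-2d), because |J| is itself small, and it meets 2^d intervals J
per interval of length |I|; a factor 2^(-d) is left. -/
lemma tsum_enorm_gram_le (h : IsWavelet D φ) (I : DyadicInterval) :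
    ∑' J, ‖∫ y, φ I y * starRingEnd ℂ (φ J y)‖ₑ ≤
      (D ^ 2 * (4 * rhoSum) ^ 2 * 4) * I.elen := by
  have hI := I.length_pos
  have hl1 : ∀ d : ℕ, ∀ m, (⟨I.scale + d, m⟩ : DyadicInterval).length = 2 ^ d * I.length := by
    intro d m
    simp only [length]; rw [zpow_add₀ two_ne_zero, zpow_natCast, mul_comm]
  have hl2 : ∀ d : ℕ, ∀ m, (⟨I.scale - d, m⟩ : DyadicInterval).length = (2 ^ d)⁻¹ * I.length := by
    intro d m
    simp only [length]; rw [zpow_sub₀ two_ne_zero, zpow_natCast, div_eq_mul_inv, mul_comm]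
  have h2 : ∀ d : ℕ, ENNReal.ofReal ((2 ^ d)⁻¹) = (2 ^ d)⁻¹ := by
    intro d
    rw [ENNReal.ofReal_inv_of_pos (by positivity), ENNReal.ofReal_pow (by norm_num)]; norm_num
  refine (tsum_le_tsum_scales _ I.scale).trans ?_
  have A : ∀ d : ℕ, ∑' m : ℤ, ‖∫ y, φ I y * starRingEnd ℂ (φ ⟨I.scale + d, m⟩ y)‖ₑ ≤
      (D ^ 2 * (4 * rhoSum) ^ 2 * I.elen) * (2 ^ d)⁻¹ := by
    intro d
    have : ∀ m : ℤ, ‖∫ y, φ I y * starRingEnd ℂ (φ ⟨I.scale + d, m⟩ y)‖ₑ ≤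
        D ^ 2 * ((2 ^ d)⁻¹ * (4 * rhoSum * I.elen)) *
          (⟨I.scale + d, m⟩ : DyadicInterval).decay I.left ^ 2 := by
      intro m
      rw [enorm_gram_comm]
      refine (h.enorm_gram_le _ I ?_).trans (le_of_eq ?_)
      · rw [hl1]
        exact le_mul_of_one_le_left hI.le (one_le_pow₀ (by norm_num))
      · rw [hl1, ← h2]
        congr 5
        field_simp
    refine (ENNReal.tsum_le_tsum this).trans ?_
    rw [ENNReal.tsum_mul_left]
    calc _ ≤ D ^ 2 * ((2 ^ d)⁻¹ * (4 * rhoSum * I.elen)) * (4 * rhoSum) := by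
          gcongr; exact tsum_decay_sq_le _ _
      _ = _ := by ring
  have B : ∀ d : ℕ, ∑' m : ℤ, ‖∫ y, φ I y * starRingEnd ℂ (φ ⟨I.scale - d, m⟩ y)‖ₑ ≤
      (D ^ 2 * (4 * rhoSum) ^ 2 * I.elen) * (2 ^ d)⁻¹ := by
    intro d
    have : ∀ m : ℤ, ‖∫ y, φ I y * starRingEnd ℂ (φ ⟨I.scale - d, m⟩ y)‖ₑ ≤
        D ^ 2 * ((2 ^ d)⁻¹ * (4 * rhoSum * ((2 ^ d)⁻¹ * I.elen))) *
          I.decay (⟨I.scale - d, m⟩ : DyadicInterval).left ^ 2 := by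
      intro m
      refine (h.enorm_gram_le I _ ?_).trans (le_of_eq ?_)
      · rw [hl2]
        exact mul_le_of_le_one_left hI.le (inv_le_one_of_one_le₀ (one_le_pow₀ (by norm_num)))
      · rw [elen, hl2, ENNReal.ofReal_mul (by positivity), mul_div_assoc, div_self hI.ne', mul_one,
          h2]
        rfl
    refine (ENNReal.tsum_le_tsum this).trans ?_
    rw [ENNReal.tsum_mul_left]
    have h3 : ((2 : ℝ≥0∞) ^ d)⁻¹ * 2 ^ d = 1 := ENNReal.inv_mul_cancel (by simp) (by simp)
    calc _ ≤ D ^ 2 * ((2 ^ d)⁻¹ * (4 * rhoSum * ((2 ^ d)⁻¹ * I.elen))) *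
          (2 ^ d * (4 * rhoSum)) := by
          gcongr; exact tsum_decay_left_sq_le _ _
      _ = (D ^ 2 * (4 * rhoSum) ^ 2 * I.elen) * (2 ^ d)⁻¹ * ((2 ^ d)⁻¹ * 2 ^ d) := by ring
      _ = _ := by rw [h3, mul_one]
  refine (add_le_add (ENNReal.tsum_le_tsum A) (ENNReal.tsum_le_tsum B)).trans (le_of_eq ?_)
  rw [ENNReal.tsum_mul_left, tsum_inv_two_pow]
  ring

end IsWavelet

/-- A weighted Bessel inequality for almost orthogonal vectors. -/
lemma sum_norm_inner_sq_div_le {ι H : Type*} [NormedAddCommGroup H] [InnerProductSpace ℂ H]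
    (s : Finset ι) (v : ι → H) (l : ι → ℝ) (hl : ∀ i, 0 < l i) {B : ℝ} (hB : 0 ≤ B)
    (h : ∀ i ∈ s, ∑ j ∈ s, ‖inner ℂ (v i) (v j)‖ ≤ B * l i) (g : H) :
    ∑ i ∈ s, ‖inner ℂ (v i) g‖ ^ 2 / l i ≤ B * ‖g‖ ^ 2 := by
  -- These coefficients make ⟨u, g⟩ equal to X, the sum to be bounded. Then X ≤ ‖u‖‖g‖, Schur's test
  -- gives ‖u‖² ≤ B X, and a factor X is cancelled.
  set c : ι → ℂ := fun i => inner ℂ (v i) g / l i with hc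
  set u : H := ∑ i ∈ s, c i • v i with hu
  set X : ℝ := ∑ i ∈ s, ‖inner ℂ (v i) g‖ ^ 2 / l i with hX
  have hX0 : 0 ≤ X := Finset.sum_nonneg fun i _ => div_nonneg (by positivity) (hl i).le
  have hcn : ∀ i, ‖c i‖ ^ 2 * l i = ‖inner ℂ (v i) g‖ ^ 2 / l i := by
    intro i
    have := (hl i).ne'
    simp only [hc, norm_div, Complex.norm_real, Real.norm_eq_abs, abs_of_pos (hl i)]
    field_simp
  have h1 : inner ℂ u g = (X : ℂ) := by
    rw [hu, sum_inner, hX, Complex.ofReal_sum]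
    refine Finset.sum_congr rfl fun i _ => ?_
    rw [inner_smul_left]
    have : (l i : ℂ) ≠ 0 := by exact_mod_cast (hl i).ne'
    simp only [hc, map_div₀, Complex.conj_ofReal]
    push_cast
    rw [← Complex.conj_mul']
    ring
  have h2 : X ≤ ‖u‖ * ‖g‖ := by
    have := norm_inner_le_norm (𝕜 := ℂ) u g
    rwa [h1, Complex.norm_real, Real.norm_eq_abs, abs_of_nonneg hX0] at this
  have h3 : ‖u‖ ^ 2 ≤ B * X := by
    have e : ‖u‖ ^ 2 = ‖inner ℂ u u‖ := by
      rw [inner_self_eq_norm_sq_to_K]; simp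
    rw [e]
    have e2 : inner ℂ u u = ∑ i ∈ s, ∑ j ∈ s,
        starRingEnd ℂ (c i) * c j * inner ℂ (v i) (v j) := by
      rw [hu, sum_inner]
      refine Finset.sum_congr rfl fun i _ => ?_
      rw [inner_sum]
      refine Finset.sum_congr rfl fun j _ => ?_
      rw [inner_smul_left, inner_smul_right]; ring
    rw [e2]
    -- Splitting the product ‖c i‖‖c j‖ into half the sum of the squares leaves two copies of the
    -- same row sum after interchanging i and j.
    have e3 : ∀ i j, ‖starRingEnd ℂ (c i) * c j * inner ℂ (v i) (v j)‖ ≤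
        ‖c i‖ ^ 2 / 2 * ‖inner ℂ (v i) (v j)‖ + ‖c j‖ ^ 2 / 2 * ‖inner ℂ (v j) (v i)‖ := by
      intro i j
      rw [norm_inner_symm (v j) (v i), norm_mul, norm_mul, RCLike.norm_conj, ← add_mul]
      refine mul_le_mul_of_nonneg_right ?_ (norm_nonneg _)
      nlinarith [sq_nonneg (‖c i‖ - ‖c j‖)]
    calc _ ≤ ∑ i ∈ s, ∑ j ∈ s, (‖c i‖ ^ 2 / 2 * ‖inner ℂ (v i) (v j)‖ +
          ‖c j‖ ^ 2 / 2 * ‖inner ℂ (v j) (v i)‖) :=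
          norm_sum_le_of_le _ fun i _ => norm_sum_le_of_le _ fun j _ => e3 i j
      _ = ∑ i ∈ s, ‖c i‖ ^ 2 * ∑ j ∈ s, ‖inner ℂ (v i) (v j)‖ := by
          simp_rw [Finset.sum_add_distrib]
          rw [Finset.sum_comm (f := fun i j => ‖c j‖ ^ 2 / 2 * ‖inner ℂ (v j) (v i)‖),
            ← Finset.sum_add_distrib]
          refine Finset.sum_congr rfl fun i _ => ?_
          rw [← Finset.mul_sum]; ring
      _ ≤ ∑ i ∈ s, ‖c i‖ ^ 2 * (B * l i) :=
          Finset.sum_le_sum fun i hi => mul_le_mul_of_nonneg_left (h i hi) (by positivity)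
      _ = B * X := by
          rw [hX, Finset.mul_sum]
          refine Finset.sum_congr rfl fun i _ => ?_
          rw [← hcn]; ring
  rcases hX0.eq_or_lt with h0 | h0
  · rw [← h0]; positivity
  · have : X * X ≤ X * (B * ‖g‖ ^ 2) := by
      calc X * X ≤ (‖u‖ * ‖g‖) * (‖u‖ * ‖g‖) := by gcongr
        _ = ‖u‖ ^ 2 * ‖g‖ ^ 2 := by ring
        _ ≤ (B * X) * ‖g‖ ^ 2 := by gcongr
        _ = _ := by ring
    exact le_of_mul_le_mul_left this h0

/-- The square function estimate in `L²`. -/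
lemma exists_tsum_pairing_le (D : ℝ≥0) : ∃ B : ℝ≥0, 1 ≤ B ∧ ∀ φ, IsWavelet D φ →
    ∀ g : ℝ → ℂ, AEStronglyMeasurable g volume →
      ∑' I, ‖pairing g (φ I)‖ₑ ^ 2 / I.elen ≤ B * ∫⁻ y, ‖g y‖ₑ ^ 2 := by
  have hfin : (D : ℝ≥0∞) ^ 2 * (4 * rhoSum) ^ 2 * 4 ≠ ⊤ :=
    ENNReal.mul_ne_top (ENNReal.mul_ne_top (by simp) (ENNReal.pow_ne_top
      (ENNReal.mul_ne_top (by norm_num) rhoSum_ne_top))) (by norm_num)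
  -- The maximum with 1 makes B · ⊤ = ⊤, so the case of infinite L² norm is trivial.
  set B : ℝ≥0 := max 1 ((D : ℝ≥0∞) ^ 2 * (4 * rhoSum) ^ 2 * 4).toNNReal with hB
  have hBle : (D : ℝ≥0∞) ^ 2 * (4 * rhoSum) ^ 2 * 4 ≤ B := by
    rw [← ENNReal.coe_toNNReal hfin]
    exact_mod_cast le_max_right _ _
  refine ⟨B, le_max_left _ _, fun φ h g hg => ?_⟩
  have hB0 : (B : ℝ≥0∞) ≠ 0 := by
    have : (1 : ℝ≥0) ≤ B := le_max_left _ _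
    exact_mod_cast (lt_of_lt_of_le one_pos this).ne'
  by_cases hint : ∫⁻ y, ‖g y‖ₑ ^ 2 = ⊤
  · rw [hint, ENNReal.mul_top hB0]; exact le_top
  have hg2 : MemLp g 2 := by
    refine ⟨hg, ?_⟩
    rw [eLpNorm_lt_top_iff_lintegral_rpow_enorm_lt_top (by norm_num) (by norm_num)]
    simpa using lt_top_iff_ne_top.2 hint
  have hv : ∀ I, MemLp (φ I) 2 := fun I => h.memLp I (by norm_num)
  set v : DyadicInterval → Lp ℂ 2 (volume : Measure ℝ) := fun I => (hv I).toLp (φ I) with hvdef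
  have hin : ∀ I, ∀ {f : ℝ → ℂ} (hf : MemLp f 2), inner ℂ (v I) (hf.toLp f) =
      ∫ y, f y * starRingEnd ℂ (φ I y) := by
    intro I f hf
    rw [L2.inner_def]
    refine integral_congr_ae ?_
    filter_upwards [(hv I).coeFn_toLp, hf.coeFn_toLp] with y h1 h2
    rw [hvdef, h1, h2, RCLike.inner_apply]
  have hnorm : ENNReal.ofReal (‖hg2.toLp g‖ ^ 2) = ∫⁻ y, ‖g y‖ₑ ^ 2 := by
    rw [ENNReal.ofReal_pow (norm_nonneg _), Lp.norm_toLp, ENNReal.ofReal_toReal hg2.2.ne,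
      eLpNorm_eq_lintegral_rpow_enorm_toReal (by norm_num) (by norm_num), ← ENNReal.rpow_natCast,
      ← ENNReal.rpow_mul]
    simp
  rw [ENNReal.tsum_eq_iSup_sum]
  refine iSup_le fun s => ?_
  have key := sum_norm_inner_sq_div_le s v (fun I => I.length) (fun I => I.length_pos)
    (B := B) (by positivity) (fun I _ => ?_) (hg2.toLp g)
  · have := ENNReal.ofReal_le_ofReal key
    rw [ENNReal.ofReal_mul (by positivity), hnorm, ENNReal.ofReal_coe_nnreal,
      ENNReal.ofReal_sum_of_nonneg
        (fun I _ => div_nonneg (by positivity) I.length_pos.le)] at this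
    refine le_trans (le_of_eq (Finset.sum_congr rfl fun I _ => ?_)) this
    rw [ENNReal.ofReal_div_of_pos I.length_pos, ENNReal.ofReal_pow (norm_nonneg _),
      ofReal_norm, hin I hg2]
    rfl
  · have h1 := (ENNReal.sum_le_tsum s).trans (h.tsum_enorm_gram_le I)
    have h2 : ∑ J ∈ s, ENNReal.ofReal ‖inner ℂ (v I) (v J)‖ ≤ B * ENNReal.ofReal I.length := by
      refine le_trans (le_of_eq (Finset.sum_congr rfl fun J _ => ?_))
        (h1.trans (mul_le_mul_left hBle _))
      rw [ofReal_norm, hin I (hv J), IsWavelet.enorm_gram_comm]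
    rw [← ENNReal.ofReal_sum_of_nonneg (fun _ _ => norm_nonneg _), ← ENNReal.ofReal_coe_nnreal,
      ← ENNReal.ofReal_mul (by positivity)] at h2
    exact (ENNReal.ofReal_le_ofReal_iff (by have := I.length_pos; positivity)).1 h2

/-! ### Layer cake formulas -/

lemma lintegral_Ioi_rpow_lt {q : ℝ} (hq : 0 < q) (u : ℝ≥0∞) :
    ∫⁻ t in Set.Ioi (0 : ℝ), (if ENNReal.ofReal t < u then ENNReal.ofReal (t ^ (q - 1)) else 0) =
      u ^ q / ENNReal.ofReal q := by
  have fin : ∀ a : ℝ≥0, ∫⁻ t in Set.Ioi (0 : ℝ),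
      (if ENNReal.ofReal t < a then ENNReal.ofReal (t ^ (q - 1)) else 0) =
      (a : ℝ≥0∞) ^ q / ENNReal.ofReal q := by
    intro a
    have e : ∀ t ∈ Set.Ioi (0 : ℝ),
        (if ENNReal.ofReal t < a then ENNReal.ofReal (t ^ (q - 1)) else 0) =
        (Set.Iio (a : ℝ)).indicator (fun t => ENNReal.ofReal (t ^ (q - 1))) t := by
      intro t ht
      have : ENNReal.ofReal t < a ↔ t < a := by
        rw [← ENNReal.ofReal_coe_nnreal, ENNReal.ofReal_lt_ofReal_iff']
        exact ⟨fun h => h.1, fun h => ⟨h, lt_trans ht h⟩⟩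
      by_cases h : t < a
      · rw [if_pos (this.2 h), Set.indicator_of_mem (by exact h)]
      · rw [if_neg (fun h' => h (this.1 h')), Set.indicator_of_notMem (by exact h)]
    rw [setLIntegral_congr_fun measurableSet_Ioi e, setLIntegral_indicator measurableSet_Iio,
      Set.inter_comm, Set.Ioi_inter_Iio, restrict_Ioo_eq_restrict_Ioc,
      ← ofReal_integral_eq_lintegral_ofReal]
    · rw [← intervalIntegral.integral_of_le a.coe_nonneg, integral_rpow (Or.inl (by linarith)),
        sub_add_cancel, Real.zero_rpow hq.ne', sub_zero, ENNReal.ofReal_div_of_pos hq,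
        ← ENNReal.ofReal_rpow_of_nonneg a.coe_nonneg hq.le, ENNReal.ofReal_coe_nnreal]
    · exact (intervalIntegrable_iff_integrableOn_Ioc_of_le a.coe_nonneg).1
        (intervalIntegral.intervalIntegrable_rpow' (by linarith))
    · filter_upwards [self_mem_ae_restrict measurableSet_Ioc] with t ht
      exact Real.rpow_nonneg ht.1.le _
  induction u using ENNReal.recTopCoe with
  | coe a => exact fin a
  | top =>
    rw [ENNReal.top_rpow_of_pos hq, ENNReal.top_div_of_ne_top ENNReal.ofReal_ne_top]
    refine ENNReal.eq_top_of_forall_nnreal_le fun r => ?_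
    have h0 : ENNReal.ofReal q ≠ 0 := by simpa using hq
    -- Chosen so that a^q / q = r; the integral up to ⊤ dominates the one up to a, for every r.
    set a : ℝ≥0 := (r * q.toNNReal) ^ (1 / q) with ha
    have h1 : (r : ℝ≥0∞) = (a : ℝ≥0∞) ^ q / ENNReal.ofReal q := by
      rw [← ENNReal.coe_rpow_of_nonneg _ hq.le, ha, ← NNReal.rpow_mul, one_div,
        inv_mul_cancel₀ hq.ne', NNReal.rpow_one, ENNReal.coe_mul]
      exact (ENNReal.mul_div_cancel_right h0 ENNReal.ofReal_ne_top).symm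
    rw [h1, ← fin a]
    refine lintegral_mono fun t => ?_
    split_ifs with h2 h3
    · exact le_rfl
    · exact absurd ENNReal.ofReal_lt_top h3
    · exact zero_le
    · exact le_rfl

/-- The complementary layer formula, for negative powers: it sums over the levels above u, and
serves the part of g below the stopping height when the exponent is less than two. -/
lemma lintegral_Ioi_rpow_ge {q : ℝ} (hq : 0 < q) {u : ℝ≥0∞} (hu : u ≠ 0) :
    ∫⁻ t in Set.Ioi (0 : ℝ), (if u ≤ ENNReal.ofReal t then ENNReal.ofReal (t ^ (-q - 1)) else 0) ≤
      u ^ (-q) / ENNReal.ofReal q := by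
  induction u using ENNReal.recTopCoe with
  | top => simp
  | coe a =>
    have ha : 0 < (a : ℝ) := by
      have : a ≠ 0 := by exact_mod_cast hu
      exact_mod_cast pos_iff_ne_zero.2 this
    have e : ∀ t ∈ Set.Ioi (0 : ℝ),
        (if (a : ℝ≥0∞) ≤ ENNReal.ofReal t then ENNReal.ofReal (t ^ (-q - 1)) else 0) =
        (Set.Ici (a : ℝ)).indicator (fun t => ENNReal.ofReal (t ^ (-q - 1))) t := by
      intro t ht
      have : (a : ℝ≥0∞) ≤ ENNReal.ofReal t ↔ (a : ℝ) ≤ t := by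
        rw [← ENNReal.ofReal_coe_nnreal, ENNReal.ofReal_le_ofReal_iff (le_of_lt ht)]
      by_cases h : (a : ℝ) ≤ t
      · rw [if_pos (this.2 h), Set.indicator_of_mem (by exact h)]
      · rw [if_neg (fun h' => h (this.1 h')), Set.indicator_of_notMem (by exact h)]
    rw [setLIntegral_congr_fun measurableSet_Ioi e, setLIntegral_indicator measurableSet_Ici,
      Set.inter_eq_left.2 (Set.Ici_subset_Ioi.2 ha), ← restrict_Ioi_eq_restrict_Ici,
      ← ofReal_integral_eq_lintegral_ofReal]
    · rw [integral_Ioi_rpow_of_lt (by linarith) ha, sub_add_cancel, neg_div_neg_eq,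
        ENNReal.ofReal_div_of_pos hq, ← ENNReal.ofReal_rpow_of_pos ha, ENNReal.ofReal_coe_nnreal]
    · exact integrableOn_Ioi_rpow_of_lt (by linarith) ha
    · filter_upwards [self_mem_ae_restrict measurableSet_Ioi] with t ht
      exact Real.rpow_nonneg (lt_trans ha ht).le _

lemma lintegral_rpow_eq_layer {u : ℝ → ℝ≥0∞} (hu : Measurable u) {q : ℝ} (hq : 0 < q) :
    ∫⁻ x, u x ^ q = ENNReal.ofReal q *
      ∫⁻ t in Set.Ioi (0 : ℝ), ENNReal.ofReal (t ^ (q - 1)) *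
        volume {x | ENNReal.ofReal t < u x} := by
  have h0 : ENNReal.ofReal q ≠ 0 := by simpa using hq
  have e : ∀ x, u x ^ q = ENNReal.ofReal q * ∫⁻ t in Set.Ioi (0 : ℝ),
      (if ENNReal.ofReal t < u x then ENNReal.ofReal (t ^ (q - 1)) else 0) := by
    intro x
    rw [lintegral_Ioi_rpow_lt hq, ENNReal.mul_div_cancel h0 ENNReal.ofReal_ne_top]
  have hm : Measurable fun z : ℝ × ℝ =>
      if ENNReal.ofReal z.2 < u z.1 then ENNReal.ofReal (z.2 ^ (q - 1)) else 0 :=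
    Measurable.ite (measurableSet_lt (by fun_prop) (by fun_prop)) (by fun_prop) measurable_const
  simp_rw [e]
  rw [lintegral_const_mul' _ _ ENNReal.ofReal_ne_top, lintegral_lintegral_swap hm.aemeasurable]
  congr 1
  refine lintegral_congr fun t => ?_
  have : ∀ x, (if ENNReal.ofReal t < u x then ENNReal.ofReal (t ^ (q - 1)) else 0) =
      {x | ENNReal.ofReal t < u x}.indicator (fun _ => ENNReal.ofReal (t ^ (q - 1))) x := by
    intro x; simp [Set.indicator_apply]
  simp_rw [this]
  rw [lintegral_indicator_const (measurableSet_lt measurable_const hu)]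

/-- A restricted weak type `(1,1)` bound implies strong type bounds. -/
lemma lintegral_rpow_le_of_weak {T f : ℝ → ℝ≥0∞} (hT : Measurable T) (hf : Measurable f)
    {q : ℝ} (hq : 1 < q) {B : ℝ≥0∞} (hB : B ≠ ⊤)
    (h : ∀ t : ℝ, 0 < t → ENNReal.ofReal t * volume {x | 2 * ENNReal.ofReal t < T x} ≤
      B * ∫⁻ x, {x | ENNReal.ofReal t < f x}.indicator f x) :
    ∫⁻ x, T x ^ q ≤ 2 ^ q * (ENNReal.ofReal q / ENNReal.ofReal (q - 1)) * B * ∫⁻ x, f x ^ q := by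
  have hq0 : 0 < q := by linarith
  have e1 : ∀ x, T x ^ q = 2 ^ q * (T x / 2) ^ q := by
    intro x
    rw [← ENNReal.mul_rpow_of_nonneg _ _ hq0.le, ENNReal.mul_div_cancel (by norm_num) (by norm_num)]
  have h2 : (2 : ℝ≥0∞) ^ q ≠ ⊤ := ENNReal.rpow_ne_top_of_nonneg hq0.le (by norm_num)
  have e2 : ∀ t x, ENNReal.ofReal t < T x / 2 ↔ 2 * ENNReal.ofReal t < T x := by
    intro t x
    rw [ENNReal.lt_div_iff_mul_lt (by simp) (by simp), mul_comm]
  have hm : Measurable fun z : ℝ × ℝ =>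
      f z.2 * (if ENNReal.ofReal z.1 < f z.2 then ENNReal.ofReal (z.1 ^ (q - 1 - 1)) else 0) :=
    Measurable.mul (by fun_prop)
      (Measurable.ite (measurableSet_lt (by fun_prop) (by fun_prop)) (by fun_prop)
        measurable_const)
  calc ∫⁻ x, T x ^ q = 2 ^ q * ∫⁻ x, (T x / 2) ^ q := by
        simp_rw [e1]; rw [lintegral_const_mul' _ _ h2]
    _ = 2 ^ q * (ENNReal.ofReal q * ∫⁻ t in Set.Ioi (0 : ℝ), ENNReal.ofReal (t ^ (q - 1)) *
        volume {x | 2 * ENNReal.ofReal t < T x}) := by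
        rw [lintegral_rpow_eq_layer (hT.div_const 2) hq0]
        simp_rw [e2]
    _ ≤ 2 ^ q * (ENNReal.ofReal q * ∫⁻ t in Set.Ioi (0 : ℝ), B * ∫⁻ x, f x *
        (if ENNReal.ofReal t < f x then ENNReal.ofReal (t ^ (q - 1 - 1)) else 0)) := by
        gcongr 2 ^ q * (_ * ?_)
        refine setLIntegral_mono' measurableSet_Ioi fun t (ht : 0 < t) => ?_
        have e3 : ENNReal.ofReal (t ^ (q - 1)) =
            ENNReal.ofReal (t ^ (q - 1 - 1)) * ENNReal.ofReal t := by
          rw [← ENNReal.ofReal_mul (by positivity)]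
          congr 1
          nth_rewrite 3 [← Real.rpow_one t]
          rw [← Real.rpow_add ht]; congr 1; ring
        rw [e3, mul_assoc]
        refine (mul_le_mul_right (h t ht) _).trans (le_of_eq ?_)
        rw [mul_left_comm, ← lintegral_const_mul' _ _ ENNReal.ofReal_ne_top]
        congr 1
        refine lintegral_congr fun x => ?_
        simp only [Set.indicator_apply, Set.mem_ofPred_eq]
        split_ifs <;> ring
    _ = 2 ^ q * (ENNReal.ofReal q * (B * ∫⁻ x, f x * (f x ^ (q - 1) /
          ENNReal.ofReal (q - 1)))) := by
        rw [lintegral_const_mul' _ _ hB, lintegral_lintegral_swap hm.aemeasurable]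
        congr 4
        ext x
        have hm2 : Measurable fun t : ℝ =>
          (if ENNReal.ofReal t < f x then ENNReal.ofReal (t ^ (q - 1 - 1)) else 0) :=
          Measurable.ite (measurableSet_lt (by fun_prop) (by fun_prop)) (by fun_prop)
            measurable_const
        rw [lintegral_const_mul _ hm2, lintegral_Ioi_rpow_lt (by linarith)]
    _ = _ := by
        have e4 : ∀ x, f x * (f x ^ (q - 1) / ENNReal.ofReal (q - 1)) =
            (ENNReal.ofReal (q - 1))⁻¹ * f x ^ q := by
          intro x
          have : f x * f x ^ (q - 1) = f x ^ q := by
            nth_rewrite 1 [← ENNReal.rpow_one (f x)]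
            rw [← ENNReal.rpow_add_of_nonneg _ _ zero_le_one (by linarith)]
            congr 1; ring
          rw [← mul_div_assoc, this, div_eq_mul_inv, mul_comm]
        simp_rw [e4]
        rw [lintegral_const_mul' _ _
          (ENNReal.inv_ne_top.2 (by simpa using hq)), div_eq_mul_inv]
        ring

/-! ### The logarithm -/

/-- `log (2 + |n|)` as an extended nonnegative real. -/
noncomputable def ell (n : ℤ) : ℝ≥0∞ := ENNReal.ofReal (Real.log (2 + |(n : ℝ)|))

lemma ell_ne_top (n : ℤ) : ell n ≠ ⊤ := ENNReal.ofReal_ne_top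

lemma half_le_log (n : ℤ) : 1 / 2 ≤ Real.log (2 + |(n : ℝ)|) := by
  have h1 := Real.log_two_gt_d9
  have h2 : Real.log 2 ≤ Real.log (2 + |(n : ℝ)|) :=
    Real.log_le_log (by norm_num) (by linarith [abs_nonneg (n : ℝ)])
  linarith

lemma ell_ne_zero (n : ℤ) : ell n ≠ 0 := by
  have := half_le_log n
  simp only [ell, ne_eq, ENNReal.ofReal_eq_zero, not_le]; linarith

lemma one_le_two_mul_ell (n : ℤ) : 1 ≤ 2 * ell n := by
  have := half_le_log n
  rw [ell, show (2 : ℝ≥0∞) = ENNReal.ofReal 2 by norm_num, ← ENNReal.ofReal_mul (by norm_num),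
    ENNReal.one_le_ofReal]
  linarith

/-- This counts the scales d at which |n|/2^d may exceed 1. The count N satisfies 2^N ≤ (2+|n|)²,
and log 2 > 1/2 yields the 4. -/
lemma natLog_add_one_le (n : ℤ) :
    ((Nat.log 2 n.natAbs + 1 : ℕ) : ℝ≥0∞) ≤ 4 * ell n := by
  have h1 := Real.log_two_gt_d9
  have h2 : (2 : ℝ) ^ (Nat.log 2 n.natAbs + 1) ≤ (2 + |(n : ℝ)|) ^ 2 := by
    have h3 : 2 ^ (Nat.log 2 n.natAbs) ≤ 1 + n.natAbs := by
      rcases eq_or_ne n.natAbs 0 with h | h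
      · simp [h]
      · exact (Nat.pow_log_le_self 2 h).trans (by omega)
    have h4 : (2 : ℝ) ^ (Nat.log 2 n.natAbs) ≤ 1 + |(n : ℝ)| := by
      have h5 : ((n.natAbs : ℕ) : ℝ) = |(n : ℝ)| := by
        rw [Nat.cast_natAbs, Int.cast_abs]
      rw [← h5]; exact_mod_cast h3
    rw [pow_succ]
    nlinarith [abs_nonneg (n : ℝ)]
  have h6 := Real.log_le_log (by positivity) h2
  rw [Real.log_pow, Real.log_pow] at h6
  rw [ell, show (4 : ℝ≥0∞) = ENNReal.ofReal 4 by norm_num, ← ENNReal.ofReal_mul (by norm_num),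
    ← ENNReal.ofReal_natCast]
  refine ENNReal.ofReal_le_ofReal ?_
  have h7 : (0 : ℝ) ≤ ((Nat.log 2 n.natAbs + 1 : ℕ) : ℝ) := by positivity
  push_cast at h6 h7 ⊢
  nlinarith

lemma abs_div_two_pow_le_one (n : ℤ) {d : ℕ} (hd : Nat.log 2 n.natAbs < d) :
    |(n : ℝ)| / 2 ^ d ≤ 1 := by
  have h1 : n.natAbs < 2 ^ d := Nat.lt_pow_of_log_lt (by norm_num) hd
  have h5 : ((n.natAbs : ℕ) : ℝ) = |(n : ℝ)| := by
    rw [Nat.cast_natAbs, Int.cast_abs]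
  rw [div_le_one (by positivity), ← h5]
  exact_mod_cast h1.le

/-! ### Shifted maximal functions -/

/-- The neighbourhoods of the translates of `J` by `n 2⁻ᵈ |J|`, for `d ≥ 0`. -/
def shadow (n : ℤ) (J : DyadicInterval) : Set ℝ :=
  ⋃ d : ℕ, Metric.closedBall (J.left + n / 2 ^ d * J.length) (4 * J.length)

/-- Once 2^d > |n| the centre moves by at most |J|, so all these balls lie in one ball of radius
5|J|; the other balls number about log(2+|n|). -/
lemma volume_shadow_le (n : ℤ) (J : DyadicInterval) :
    volume (shadow n J) ≤ 72 * ell n * J.elen := by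
  have hJ := J.length_pos
  set N := Nat.log 2 n.natAbs + 1 with hN
  have hsub : shadow n J ⊆
      (⋃ d ∈ Finset.range N, Metric.closedBall (J.left + n / 2 ^ d * J.length) (4 * J.length)) ∪
        Metric.closedBall J.left (5 * J.length) := by
    refine Set.iUnion_subset fun d => ?_
    by_cases hd : d < N
    · exact Set.subset_union_of_subset_left
        (Set.subset_biUnion_of_mem (u := fun d : ℕ =>
          Metric.closedBall (J.left + n / 2 ^ d * J.length) (4 * J.length))
          (Finset.mem_coe.2 (Finset.mem_range.2 hd))) _
    · refine Set.subset_union_of_subset_right (Metric.closedBall_subset_closedBall' ?_) _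
      have h1 := abs_div_two_pow_le_one n (d := d) (by omega)
      rw [Real.dist_eq, add_sub_cancel_left, abs_mul, abs_of_pos hJ, abs_div,
        abs_of_pos (show (0 : ℝ) < 2 ^ d by positivity)]
      nlinarith
  have hN1 : (1 : ℝ≥0∞) ≤ N := by
    have : 1 ≤ N := by omega
    exact_mod_cast this
  calc volume (shadow n J) ≤ _ := measure_mono hsub
    _ ≤ (∑ d ∈ Finset.range N,
          volume (Metric.closedBall (J.left + n / 2 ^ d * J.length) (4 * J.length))) +
        volume (Metric.closedBall J.left (5 * J.length)) :=
        (measure_union_le _ _).trans (add_le_add (measure_biUnion_finset_le _ _) le_rfl)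
    _ = N * (8 * J.elen) + 10 * J.elen := by
        simp only [Real.volume_closedBall, Finset.sum_const, Finset.card_range, nsmul_eq_mul]
        congr 2
        · rw [← mul_assoc, ENNReal.ofReal_mul (by norm_num), elen]; norm_num
        · rw [← mul_assoc, ENNReal.ofReal_mul (by norm_num), elen]; norm_num
    _ ≤ N * (8 * J.elen) + N * (10 * J.elen) := by
        exact add_le_add le_rfl (le_mul_of_one_le_left' hN1)
    _ = N * (18 * J.elen) := by ring
    _ ≤ (4 * ell n) * (18 * J.elen) := by gcongr; exact natLog_add_one_le n
    _ = _ := by ring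

/-- The average of `f` over `J`. -/
noncomputable def avg (J : DyadicInterval) (f : ℝ → ℝ≥0∞) : ℝ≥0∞ :=
  (∫⁻ y in J.ico, f y) / J.elen

/-- The shifted dyadic maximal function. -/
noncomputable def shiftMax (m : ℤ) (f : ℝ → ℝ≥0∞) (x : ℝ) : ℝ≥0∞ :=
  ⨆ I : DyadicInterval, I.ico.indicator (fun _ => avg (I.shift m) f) x

@[fun_prop]
lemma measurable_shiftMax (m : ℤ) (f : ℝ → ℝ≥0∞) : Measurable (shiftMax m f) :=
  Measurable.iSup fun I => measurable_const.indicator I.measurableSet_ico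

lemma avg_le_shiftMax (m : ℤ) (f : ℝ → ℝ≥0∞) {I : DyadicInterval} {x : ℝ} (hx : x ∈ I.ico) :
    avg (I.shift m) f ≤ shiftMax m f x := by
  refine le_trans (le_of_eq ?_) (le_iSup _ I)
  rw [Set.indicator_of_mem hx]

lemma avg_le_shiftMax_zero (f : ℝ → ℝ≥0∞) {I : DyadicInterval} {x : ℝ} (hx : x ∈ I.ico) :
    avg I f ≤ shiftMax 0 f x := by
  have := avg_le_shiftMax 0 f hx
  rwa [shift_zero] at this

lemma exists_of_lt_shiftMax {m : ℤ} {f : ℝ → ℝ≥0∞} {x : ℝ} {a : ℝ≥0∞} (h : a < shiftMax m f x) :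
    ∃ I : DyadicInterval, x ∈ I.ico ∧ a < avg (I.shift m) f := by
  obtain ⟨I, hI⟩ := lt_iSup_iff.1 h
  by_cases hx : x ∈ I.ico
  · exact ⟨I, hx, by rwa [Set.indicator_of_mem hx] at hI⟩
  · rw [Set.indicator_of_notMem hx] at hI
    exact absurd hI (by simp)

lemma mul_elen_lt_of_lt_avg {f : ℝ → ℝ≥0∞} {a : ℝ≥0∞} {J : DyadicInterval} (h : a < avg J f) :
    a * J.elen < ∫⁻ y in J.ico, f y :=
  (ENNReal.lt_div_iff_mul_lt (Or.inl J.elen_ne_zero) (Or.inl J.elen_ne_top)).1 h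

lemma exists_length_eq {I J : DyadicInterval} (h : I.scale ≤ J.scale) :
    ∃ d : ℕ, I.length = J.length / 2 ^ d := by
  refine ⟨(J.scale - I.scale).toNat, ?_⟩
  rw [J.length_eq_mul _ h, mul_div_cancel_left₀ _ (by positivity)]
  rfl

/-- I is the translate of I_m by m|I| = m 2^(-d)|J|, and I_m lies in J. One unit of the radius 4|J|
suffices here; the larger radius is used in `IsWavelet.tsum_atom_le`. -/
lemma ico_subset_shadow {m : ℤ} {I J : DyadicInterval} (h : (I.shift m).ico ⊆ J.ico) :
    I.ico ⊆ shadow m J := by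
  intro x hx
  have hJ := J.length_pos
  obtain ⟨d, hd⟩ := exists_length_eq (I := I.shift m) (scale_le_of_subset h)
  rw [shift_length] at hd
  have h1 : x - m * I.length ∈ J.ico := h ((mem_ico_shift m I _).2 (by simpa using hx))
  refine Set.mem_iUnion.2 ⟨d, ?_⟩
  rw [Metric.mem_closedBall, Real.dist_eq]
  have e : x - (J.left + m / 2 ^ d * J.length) = (x - m * I.length) - J.left := by
    rw [hd]; ring
  rw [e, abs_le]
  constructor <;> linarith [h1.1, h1.2]

/-- The maximal intervals J on which the average exceeds a are disjoint and satisfy a|J| < ∫_J f,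
and their shadows cover the superlevel set. The logarithm is the size of a shadow relative to J. -/
lemma mul_volume_shiftMax_le (m : ℤ) (f : ℝ → ℝ≥0∞) {a : ℝ≥0∞} (ha0 : a ≠ 0) :
    a * volume {x | a < shiftMax m f x} ≤ 72 * ell m * ∫⁻ x, f x := by
  have hell := ell_ne_zero m
  by_cases hf : ∫⁻ x, f x = ⊤
  · rw [hf, ENNReal.mul_top (by simp [hell])]; exact le_top
  set P : DyadicInterval → Prop := fun K => a < avg K f with hP
  have hlen : ∀ K, P K → a * K.elen < ∫⁻ x, f x := fun K hK =>
    (mul_elen_lt_of_lt_avg hK).trans_le (setLIntegral_le_lintegral _ _)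
  have hscale : ∃ s, ∀ K, P K → K.scale ≤ s := by
    obtain ⟨s, hs⟩ := exists_scale_le_of_length_lt ((∫⁻ x, f x) / a).toReal
    refine ⟨s, fun K hK => hs K ?_⟩
    have h1 : K.elen < (∫⁻ x, f x) / a := by
      rw [ENNReal.lt_div_iff_mul_lt (Or.inl ha0) (Or.inr K.elen_ne_zero), mul_comm]
      exact hlen K hK
    exact (ENNReal.ofReal_lt_iff_lt_toReal K.length_pos.le
      (ENNReal.div_ne_top hf ha0)).1 h1
  have hcover : {x | a < shiftMax m f x} ⊆ ⋃ J : {J // IsMaximal P J}, shadow m J.1 := by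
    intro x hx
    obtain ⟨I, hxI, hI⟩ := exists_of_lt_shiftMax hx
    obtain ⟨J, hJ, hIJ⟩ := exists_isMaximal hscale (I := I.shift m) hI
    exact Set.mem_iUnion.2 ⟨⟨J, hJ⟩, ico_subset_shadow hIJ hxI⟩
  calc a * volume {x | a < shiftMax m f x}
      ≤ a * ∑' J : {J // IsMaximal P J}, 72 * ell m * J.1.elen := by
        gcongr
        refine (measure_mono hcover).trans ((measure_iUnion_le _).trans ?_)
        exact ENNReal.tsum_le_tsum fun J => volume_shadow_le m J.1
    _ = 72 * ell m * ∑' J : {J // IsMaximal P J}, a * J.1.elen := by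
        rw [ENNReal.tsum_mul_left, ENNReal.tsum_mul_left]; ring
    _ ≤ 72 * ell m * ∑' J : {J // IsMaximal P J}, ∫⁻ x in J.1.ico, f x := by
        gcongr with J
        exact (mul_elen_lt_of_lt_avg J.2.1).le
    _ = 72 * ell m * ∫⁻ x in ⋃ J : {J // IsMaximal P J}, J.1.ico, f x := by
        rw [lintegral_iUnion (fun J => J.1.measurableSet_ico) (IsMaximal.pairwise_disjoint P)]
    _ ≤ _ := mul_le_mul_right (setLIntegral_le_lintegral _ _) _

/-- Values of f up to a contribute at most a to an average. This truncation turns the weak bound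
into the restricted form that `lintegral_rpow_le_of_weak` asks for. -/
lemma avg_le_avg_indicator_add (J : DyadicInterval) {f : ℝ → ℝ≥0∞} (a : ℝ≥0∞) :
    avg J f ≤ avg J ({x | a < f x}.indicator f) + a := by
  have h : ∀ x, f x ≤ {x | a < f x}.indicator f x + a := by
    intro x
    by_cases hx : a < f x
    · rw [Set.indicator_of_mem (by exact hx)]; exact le_self_add
    · exact (not_lt.1 hx).trans le_add_self
  calc avg J f ≤ (∫⁻ y in J.ico, ({x | a < f x}.indicator f y + a)) / J.elen := by
        unfold avg; gcongr; exact h _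
    _ = avg J ({x | a < f x}.indicator f) + a := by
        rw [lintegral_add_right _ measurable_const, ENNReal.add_div, setLIntegral_const,
          volume_ico, ENNReal.mul_div_cancel_right J.elen_ne_zero J.elen_ne_top]
        rfl

/-- The `L^q` bound for the shifted maximal functions. -/
lemma exists_lintegral_shiftMax_rpow_le {q : ℝ} (hq : 1 < q) :
    ∃ C : ℝ≥0, ∀ (m : ℤ) (f : ℝ → ℝ≥0∞), Measurable f →
      ∫⁻ x, shiftMax m f x ^ q ≤ C * ell m * ∫⁻ x, f x ^ q := by
  have hfin : (2 : ℝ≥0∞) ^ q * (ENNReal.ofReal q / ENNReal.ofReal (q - 1)) * 72 ≠ ⊤ := by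
    refine ENNReal.mul_ne_top (ENNReal.mul_ne_top
      (ENNReal.rpow_ne_top_of_nonneg (by linarith) (by norm_num)) ?_) (by norm_num)
    exact ENNReal.div_ne_top ENNReal.ofReal_ne_top (by simpa using hq)
  refine ⟨((2 : ℝ≥0∞) ^ q * (ENNReal.ofReal q / ENNReal.ofReal (q - 1)) * 72).toNNReal,
    fun m f hf => ?_⟩
  rw [ENNReal.coe_toNNReal hfin, mul_assoc _ 72 (ell m)]
  refine lintegral_rpow_le_of_weak (measurable_shiftMax m f) hf hq
    (ENNReal.mul_ne_top (by norm_num) (ell_ne_top m)) fun t ht => ?_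
  have ht0 : ENNReal.ofReal t ≠ 0 := by simpa using ht
  refine le_trans ?_ (mul_volume_shiftMax_le m _ ht0)
  refine mul_le_mul_right (measure_mono fun x (hx : 2 * ENNReal.ofReal t < shiftMax m f x) => ?_) _
  obtain ⟨I, hxI, hI⟩ := exists_of_lt_shiftMax hx
  have h1 := hI.trans_le (avg_le_avg_indicator_add _ (ENNReal.ofReal t))
  rw [two_mul] at h1
  exact (lt_of_add_lt_add_right h1).trans_le (avg_le_shiftMax m _ hxI)

/-! ### The Carleson embedding -/

/-- The sum of `α` over the dyadic intervals contained in `Q`. -/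
noncomputable def massBelow (α : DyadicInterval → ℝ≥0∞) (Q : DyadicInterval) : ℝ≥0∞ :=
  ∑' I : {I : DyadicInterval // I.ico ⊆ Q.ico}, α I

/-- The Carleson maximal function of a sequence indexed by the dyadic intervals. -/
noncomputable def carleson (α : DyadicInterval → ℝ≥0∞) (x : ℝ) : ℝ≥0∞ :=
  ⨆ Q : DyadicInterval, Q.ico.indicator (fun _ => massBelow α Q / Q.elen) x

lemma measurable_carleson (α : DyadicInterval → ℝ≥0∞) : Measurable (carleson α) :=
  Measurable.iSup fun I => measurable_const.indicator I.measurableSet_ico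

lemma massBelow_le_lintegral_carleson (α : DyadicInterval → ℝ≥0∞) (Q : DyadicInterval) :
    massBelow α Q ≤ ∫⁻ x in Q.ico, carleson α x := by
  calc massBelow α Q = ∫⁻ _ in Q.ico, massBelow α Q / Q.elen := by
        rw [setLIntegral_const, volume_ico, ENNReal.div_mul_cancel Q.elen_ne_zero Q.elen_ne_top]
    _ ≤ _ := by
        refine setLIntegral_mono' Q.measurableSet_ico fun x hx => ?_
        refine le_trans (le_of_eq ?_) (le_iSup _ Q)
        rw [Set.indicator_of_mem hx]

/-- Each I that counts lies below a maximal K with average above a; the mass below K is at most the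
integral of `carleson α` over K, and the K are disjoint subsets of the superlevel set. Finiteness of
s bounds the scales, so that no integrability of w is needed. -/
lemma sum_ite_le_lintegral_carleson (α : DyadicInterval → ℝ≥0∞) (s : Finset DyadicInterval)
    (w : ℝ → ℝ≥0∞) (a : ℝ≥0∞) :
    ∑ I ∈ s, (if a < avg I w then α I else 0) ≤
      ∫⁻ x in {x | a < shiftMax 0 w x}, carleson α x := by
  classical
  set P : DyadicInterval → Prop := fun K => K ∈ s ∧ a < avg K w with hP
  have hscale : ∃ b, ∀ K, P K → K.scale ≤ b := by
    obtain ⟨b, hb⟩ := (s.image scale).bddAbove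
    exact ⟨b, fun K hK => hb (Finset.mem_coe.2 (Finset.mem_image_of_mem _ hK.1))⟩
  choose! J hJ hIJ using fun I (hI : P I) => exists_isMaximal hscale hI
  have e1 : ∑ I ∈ s, (if a < avg I w then α I else 0) = ∑' I : {I // P I}, α I := by
    rw [← Finset.sum_filter, ← Finset.tsum_subtype (s.filter _) α]
    have hmem : ∀ I, I ∈ s.filter (fun I => a < avg I w) ↔ P I := fun I => Finset.mem_filter
    exact (Equiv.subtypeEquivRight hmem).tsum_eq fun I : {I // P I} => α I.1
  rw [e1]
  let F : {I // P I} → (Σ K : {K // IsMaximal P K}, {I : DyadicInterval // I.ico ⊆ K.1.ico}) :=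
    fun I => ⟨⟨J I.1, hJ I.1 I.2⟩, ⟨I.1, hIJ I.1 I.2⟩⟩
  have hF : Function.Injective F := by
    intro I I' h
    have : (F I).2.1 = (F I').2.1 := by rw [h]
    exact Subtype.ext this
  calc ∑' I : {I // P I}, α I = ∑' I : {I // P I}, α (F I).2.1 := rfl
    _ ≤ ∑' z : (Σ K : {K // IsMaximal P K}, {I : DyadicInterval // I.ico ⊆ K.1.ico}), α z.2.1 :=
        ENNReal.tsum_comp_le_tsum_of_injective hF fun z => α z.2.1
    _ = ∑' K : {K // IsMaximal P K}, massBelow α K.1 := by rw [ENNReal.tsum_sigma']; rfl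
    _ ≤ ∑' K : {K // IsMaximal P K}, ∫⁻ x in K.1.ico, carleson α x :=
        ENNReal.tsum_le_tsum fun K => massBelow_le_lintegral_carleson α K.1
    _ = ∫⁻ x in ⋃ K : {K // IsMaximal P K}, K.1.ico, carleson α x := by
        rw [lintegral_iUnion (fun J => J.1.measurableSet_ico) (IsMaximal.pairwise_disjoint P)]
    _ ≤ _ := by
        refine lintegral_mono_set (Set.iUnion_subset fun K x hx => ?_)
        exact K.2.1.2.trans_le (avg_le_shiftMax_zero w hx)

/-- The Carleson embedding: integrate `sum_ite_le_lintegral_carleson` over all heights of the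
averages. -/
lemma sum_mul_avg_le (α : DyadicInterval → ℝ≥0∞) (s : Finset DyadicInterval) (w : ℝ → ℝ≥0∞) :
    ∑ I ∈ s, α I * avg I w ≤ ∫⁻ x, carleson α x * shiftMax 0 w x := by
  have hcar := measurable_carleson α
  have e : ∀ u : ℝ≥0∞, u = ∫⁻ t in Set.Ioi (0 : ℝ),
      (if ENNReal.ofReal t < u then ENNReal.ofReal (t ^ ((1 : ℝ) - 1)) else 0) := by
    intro u
    rw [lintegral_Ioi_rpow_lt one_pos]; simp
  have hm : ∀ u : ℝ≥0∞, Measurable fun t : ℝ =>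
      (if ENNReal.ofReal t < u then ENNReal.ofReal (t ^ ((1 : ℝ) - 1)) else 0) := fun u =>
    Measurable.ite (measurableSet_lt (by fun_prop) (by fun_prop)) (by fun_prop) measurable_const
  have hm2 : Measurable fun z : ℝ × ℝ => carleson α z.1 *
      (if ENNReal.ofReal z.2 < shiftMax 0 w z.1 then ENNReal.ofReal (z.2 ^ ((1 : ℝ) - 1))
        else 0) :=
    Measurable.mul (by fun_prop)
      (Measurable.ite (measurableSet_lt (by fun_prop) (by fun_prop)) (by fun_prop)
        measurable_const)
  calc ∑ I ∈ s, α I * avg I w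
      = ∫⁻ t in Set.Ioi (0 : ℝ), ENNReal.ofReal (t ^ ((1 : ℝ) - 1)) *
          ∑ I ∈ s, (if ENNReal.ofReal t < avg I w then α I else 0) := by
        simp_rw [Finset.mul_sum]
        rw [lintegral_finsetSum _ fun I _ => ?_]
        · refine Finset.sum_congr rfl fun I _ => ?_
          conv_lhs => rw [e (avg I w)]
          rw [← lintegral_const_mul _ (hm _)]
          refine lintegral_congr fun t => ?_
          split_ifs <;> ring
        · exact Measurable.mul (by fun_prop)
            (Measurable.ite (measurableSet_lt (by fun_prop) (by fun_prop)) measurable_const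
              measurable_const)
    _ ≤ ∫⁻ t in Set.Ioi (0 : ℝ), ENNReal.ofReal (t ^ ((1 : ℝ) - 1)) *
          ∫⁻ x in {x | ENNReal.ofReal t < shiftMax 0 w x}, carleson α x := by
        gcongr; exact sum_ite_le_lintegral_carleson α s w _
    _ = ∫⁻ t in Set.Ioi (0 : ℝ), ∫⁻ x, carleson α x *
          (if ENNReal.ofReal t < shiftMax 0 w x then ENNReal.ofReal (t ^ ((1 : ℝ) - 1))
            else 0) := by
        refine lintegral_congr fun t => ?_
        rw [← lintegral_indicator (measurableSet_lt measurable_const (measurable_shiftMax 0 w)),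
          ← lintegral_const_mul' _ _ ENNReal.ofReal_ne_top]
        refine lintegral_congr fun x => ?_
        simp only [Set.indicator_apply, Set.mem_ofPred_eq]
        split_ifs <;> ring
    _ = ∫⁻ x, carleson α x * shiftMax 0 w x := by
        rw [← lintegral_lintegral_swap hm2.aemeasurable]
        refine lintegral_congr fun x => ?_
        rw [lintegral_const_mul _ (hm _), ← e]

/-! ### Dyadic sums in `L^q` -/

/-- The function `∑_I α_I |I|⁻¹ 1_I`. -/
noncomputable def dyadicSum (α : DyadicInterval → ℝ≥0∞) (x : ℝ) : ℝ≥0∞ :=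
  ∑' I : DyadicInterval, I.ico.indicator (fun _ => α I / I.elen) x

lemma measurable_dyadicSum (α : DyadicInterval → ℝ≥0∞) : Measurable (dyadicSum α) :=
  Measurable.tsum fun I => measurable_const.indicator I.measurableSet_ico

lemma lintegral_dyadicSum (α : DyadicInterval → ℝ≥0∞) :
    ∫⁻ x, dyadicSum α x = ∑' I, α I := by
  unfold dyadicSum
  rw [lintegral_tsum fun I => (measurable_const.indicator I.measurableSet_ico).aemeasurable]
  refine tsum_congr fun I => ?_
  rw [lintegral_indicator_const I.measurableSet_ico, volume_ico,
    ENNReal.div_mul_cancel I.elen_ne_zero I.elen_ne_top]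

/-- Write F^q = F · F^(q-1), so that X = ∫ F^q equals ∑ α_I avg_I(F^(q-1)). The embedding, `hY` and
the maximal bound on L^r, with (q-1)r = q, give X ≤ Y C^(1/r) X^(1/r). Cancelling X^(1/r) needs X <
∞, hence the finite sum. -/
lemma finset_sum_lintegral_rpow_le (α : DyadicInterval → ℝ≥0∞) (hα : ∀ I, α I ≠ ⊤)
    (s : Finset DyadicInterval) {q r : ℝ} (hqr : q.HolderConjugate r) {Y C : ℝ≥0∞}
    (hC : ∀ w : ℝ → ℝ≥0∞, Measurable w → ∫⁻ x, shiftMax 0 w x ^ r ≤ C * ∫⁻ x, w x ^ r)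
    (hY : ∀ V : ℝ → ℝ≥0∞, Measurable V →
      ∫⁻ x, carleson α x * V x ≤ Y * (∫⁻ x, V x ^ r) ^ (1 / r)) :
    ∫⁻ x, (∑ I ∈ s, I.ico.indicator (fun _ => α I / I.elen) x) ^ q ≤
      (Y * C ^ (1 / r)) ^ q := by
  have hq := hqr.pos
  have hr := hqr.symm.pos
  have hq1 := hqr.lt
  set F : ℝ → ℝ≥0∞ := fun x => ∑ I ∈ s, I.ico.indicator (fun _ => α I / I.elen) x with hF
  have hFm : Measurable F := Finset.measurable_fun_sum _ fun I _ =>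
    measurable_const.indicator I.measurableSet_ico
  have hFle : ∀ x, F x ≤ ∑ I ∈ s, α I / I.elen := fun x =>
    Finset.sum_le_sum fun I _ => Set.indicator_le_self _ _ x
  have hFtop : ∑ I ∈ s, α I / I.elen ≠ ⊤ :=
    ENNReal.sum_ne_top.2 fun I _ => ENNReal.div_ne_top (hα I) I.elen_ne_zero
  have hw : Measurable fun x => F x ^ (q - 1) := hFm.pow_const _
  have e1 : ∫⁻ x, F x ^ q = ∑ I ∈ s, α I * avg I (fun x => F x ^ (q - 1)) := by
    have : ∀ x, F x ^ q = ∑ I ∈ s, I.ico.indicator (fun _ => α I / I.elen) x * F x ^ (q - 1) := by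
      intro x
      rw [← Finset.sum_mul]
      change F x ^ q = F x * F x ^ (q - 1)
      nth_rewrite 2 [← ENNReal.rpow_one (F x)]
      rw [← ENNReal.rpow_add_of_nonneg _ _ zero_le_one (by linarith)]
      congr 1; ring
    have hm : ∀ I : DyadicInterval, Measurable fun x =>
        I.ico.indicator (fun _ => α I / I.elen) x * F x ^ (q - 1) := fun I =>
      (measurable_const.indicator I.measurableSet_ico).mul hw
    simp_rw [this]
    rw [lintegral_finsetSum _ fun I _ => hm I]
    refine Finset.sum_congr rfl fun I _ => ?_
    have : ∀ x, I.ico.indicator (fun _ => α I / I.elen) x * F x ^ (q - 1) =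
        I.ico.indicator (fun x => α I / I.elen * F x ^ (q - 1)) x := by
      intro x; by_cases hx : x ∈ I.ico <;> simp [hx]
    rw [lintegral_congr this, lintegral_indicator I.measurableSet_ico, lintegral_const_mul _ hw,
      avg]
    simp only [div_eq_mul_inv]; ring
  set X := ∫⁻ x, F x ^ q with hX
  have hXtop : X ≠ ⊤ := by
    have h1 : ∀ x, F x ^ q ≤ (∑ I ∈ s, α I / I.elen) ^ (q - 1) * F x := by
      intro x
      have : F x ^ q = F x ^ (q - 1) * F x := by
        nth_rewrite 3 [← ENNReal.rpow_one (F x)]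
        rw [← ENNReal.rpow_add_of_nonneg _ _ (by linarith) zero_le_one]
        congr 1; ring
      rw [this]
      exact mul_le_mul' (ENNReal.rpow_le_rpow (hFle x) (by linarith)) le_rfl
    refine ne_top_of_le_ne_top ?_ (lintegral_mono h1)
    have h2 := ENNReal.rpow_ne_top_of_nonneg (y := q - 1) (by linarith) hFtop
    rw [lintegral_const_mul' _ _ h2]
    refine ENNReal.mul_ne_top h2 ?_
    rw [lintegral_finsetSum _ fun I _ => measurable_const.indicator I.measurableSet_ico]
    refine ENNReal.sum_ne_top.2 fun I _ => ?_
    rw [lintegral_indicator_const I.measurableSet_ico, volume_ico,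
      ENNReal.div_mul_cancel I.elen_ne_zero I.elen_ne_top]
    exact hα I
  have h3 : X ≤ (Y * C ^ (1 / r)) * X ^ (1 / r) := by
    calc X ≤ ∫⁻ x, carleson α x * shiftMax 0 (fun x => F x ^ (q - 1)) x :=
          e1.le.trans (sum_mul_avg_le α s _)
      _ ≤ Y * (∫⁻ x, shiftMax 0 (fun x => F x ^ (q - 1)) x ^ r) ^ (1 / r) :=
          hY _ (measurable_shiftMax _ _)
      _ ≤ Y * (C * ∫⁻ x, (F x ^ (q - 1)) ^ r) ^ (1 / r) := by
          gcongr; exact hC _ hw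
      _ = Y * (C * X) ^ (1 / r) := by
          congr 3
          refine lintegral_congr fun x => ?_
          rw [← ENNReal.rpow_mul, hqr.sub_one_mul_conj]
      _ = _ := by
          rw [ENNReal.mul_rpow_of_nonneg _ _ (by positivity), mul_assoc]
  rcases eq_or_ne X 0 with h0 | h0
  · rw [h0]; exact zero_le
  have h4 : X ^ (1 / q) ≤ Y * C ^ (1 / r) := by
    have h5 : X ^ (1 / r) ≠ 0 := by simp [ENNReal.rpow_eq_zero_iff, h0, hXtop]
    have h6 : X ^ (1 / r) ≠ ⊤ := ENNReal.rpow_ne_top_of_nonneg (by positivity) hXtop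
    have h7 : X = X ^ (1 / q) * X ^ (1 / r) := by
      rw [← ENNReal.rpow_add _ _ h0 hXtop, one_div, one_div, hqr.inv_add_inv_eq_one,
        ENNReal.rpow_one]
    nth_rewrite 1 [h7] at h3
    exact (ENNReal.mul_le_mul_iff_left h5 h6).1 h3
  calc X = (X ^ (1 / q)) ^ q := by
        rw [← ENNReal.rpow_mul, one_div, inv_mul_cancel₀ hq.ne', ENNReal.rpow_one]
    _ ≤ _ := ENNReal.rpow_le_rpow h4 hq.le

lemma lintegral_dyadicSum_rpow_le (α : DyadicInterval → ℝ≥0∞) (hα : ∀ I, α I ≠ ⊤)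
    {q r : ℝ} (hqr : q.HolderConjugate r) {Y C : ℝ≥0∞}
    (hC : ∀ w : ℝ → ℝ≥0∞, Measurable w → ∫⁻ x, shiftMax 0 w x ^ r ≤ C * ∫⁻ x, w x ^ r)
    (hY : ∀ V : ℝ → ℝ≥0∞, Measurable V →
      ∫⁻ x, carleson α x * V x ≤ Y * (∫⁻ x, V x ^ r) ^ (1 / r)) :
    ∫⁻ x, dyadicSum α x ^ q ≤ (Y * C ^ (1 / r)) ^ q := by
  have hq := hqr.pos
  have e : ∀ x, dyadicSum α x ^ q =
      ⨆ s : Finset DyadicInterval, (∑ I ∈ s, I.ico.indicator (fun _ => α I / I.elen) x) ^ q := by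
    intro x
    rw [dyadicSum, ENNReal.tsum_eq_iSup_sum]
    exact (ENNReal.orderIsoRpow q hq).map_iSup _
  simp_rw [e]
  rw [lintegral_iSup_directed]
  · exact iSup_le fun s => finset_sum_lintegral_rpow_le α hα s hqr hC hY
  · intro s
    exact ((Finset.measurable_fun_sum _ fun I _ =>
      measurable_const.indicator I.measurableSet_ico).pow_const q).aemeasurable
  · refine Monotone.directed_le fun s t hst x => ?_
    exact ENNReal.rpow_le_rpow (Finset.sum_le_sum_of_subset hst) hq.le

/-! ### Exponents at least two -/

/-- The normalized coefficients of `g` with respect to the shifted family. -/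
noncomputable def coeff (φ : DyadicInterval → ℝ → ℂ) (n : ℤ) (g : ℝ → ℂ) (I : DyadicInterval) :
    ℝ≥0∞ :=
  ‖pairing g (φ (I.shift n))‖ₑ ^ 2 / I.elen

lemma coeff_ne_top (φ : DyadicInterval → ℝ → ℂ) (n : ℤ) (g : ℝ → ℂ) (I : DyadicInterval) :
    coeff φ n g I ≠ ⊤ :=
  ENNReal.div_ne_top (by simp) I.elen_ne_zero

lemma tsum_coeff (φ : DyadicInterval → ℝ → ℂ) (n : ℤ) (g : ℝ → ℂ) :
    ∑' I, coeff φ n g I = ∑' I, ‖pairing g (φ I)‖ₑ ^ 2 / I.elen :=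
  (shiftEquiv n).tsum_eq fun I => ‖pairing g (φ I)‖ₑ ^ 2 / I.elen

lemma coeff_add_le {D : ℝ≥0} {φ : DyadicInterval → ℝ → ℂ} (h : IsWavelet D φ) (n : ℤ)
    {p₁ p₂ : ℝ≥0∞} (hp₁ : 1 ≤ p₁) (hp₂ : 1 ≤ p₂) {g₁ g₂ : ℝ → ℂ} (hg₁ : MemLp g₁ p₁)
    (hg₂ : MemLp g₂ p₂) (I : DyadicInterval) :
    coeff φ n (fun x => g₁ x + g₂ x) I ≤ 2 * coeff φ n g₁ I + 2 * coeff φ n g₂ I := by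
  have e : pairing (fun x => g₁ x + g₂ x) (φ (I.shift n)) =
      pairing g₁ (φ (I.shift n)) + pairing g₂ (φ (I.shift n)) := by
    unfold pairing
    simp_rw [add_mul]
    exact integral_add (h.integrable_mul _ hp₁ hg₁) (h.integrable_mul _ hp₂ hg₂)
  unfold coeff
  rw [e, ← mul_div_assoc, ← mul_div_assoc, ← ENNReal.add_div, ← mul_add]
  gcongr
  have h1 := ENNReal.rpow_add_le_mul_rpow_add_rpow ‖pairing g₁ (φ (I.shift n))‖ₑ
    ‖pairing g₂ (φ (I.shift n))‖ₑ (p := 2) (by norm_num)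
  have h2 : (2 : ℝ≥0∞) ^ ((2 : ℝ) - 1) = 2 := by norm_num
  rw [h2] at h1
  refine le_trans (pow_le_pow_left' (enorm_add_le _ _) 2) ?_
  exact_mod_cast h1

/-- The Cauchy–Schwarz inequality for the measure v dx. -/
lemma sq_lintegral_mul_le {f v : ℝ → ℝ≥0∞} (hf : Measurable f) (hv : Measurable v) :
    (∫⁻ x, f x * v x) ^ 2 ≤ (∫⁻ x, f x ^ 2 * v x) * ∫⁻ x, v x := by
  have key := ENNReal.lintegral_mul_le_Lp_mul_Lq volume Real.HolderConjugate.two_two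
    (f := fun x => f x * v x ^ (1 / 2 : ℝ)) (g := fun x => v x ^ (1 / 2 : ℝ))
    (by fun_prop) (by fun_prop)
  have e0 : ∀ x, v x ^ (1 / 2 : ℝ) * v x ^ (1 / 2 : ℝ) = v x := by
    intro x
    rw [← ENNReal.rpow_add_of_nonneg _ _ (by norm_num) (by norm_num)]; norm_num
  have e1 : ∀ x, ((fun x => f x * v x ^ (1 / 2 : ℝ)) * fun x => v x ^ (1 / 2 : ℝ)) x =
      f x * v x := by
    intro x
    simp only [Pi.mul_apply]
    rw [mul_assoc, e0]
  have e2 : ∀ x, (v x ^ (1 / 2 : ℝ)) ^ (2 : ℝ) = v x := by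
    intro x; rw [← ENNReal.rpow_mul]; norm_num
  have e3 : ∀ x, (f x * v x ^ (1 / 2 : ℝ)) ^ (2 : ℝ) = f x ^ 2 * v x := by
    intro x
    rw [ENNReal.mul_rpow_of_nonneg _ _ (by norm_num), e2]; norm_num
  simp_rw [e1, e2, e3] at key
  refine (pow_le_pow_left' key 2).trans (le_of_eq ?_)
  rw [mul_pow, ← ENNReal.rpow_natCast, ← ENNReal.rpow_mul, ← ENNReal.rpow_natCast,
    ← ENNReal.rpow_mul]
  norm_num

/-- An estimate without cancellation: Cauchy–Schwarz with respect to |φ| dx, whose total mass is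
O(|I|). -/
lemma coeff_le_lintegral {D : ℝ≥0} {φ : DyadicInterval → ℝ → ℂ} (h : IsWavelet D φ) (n : ℤ)
    {g : ℝ → ℂ} (hg : StronglyMeasurable g) (I : DyadicInterval) :
    coeff φ n g I ≤ D ^ 2 * (4 * rhoSum) * ∫⁻ y, ‖g y‖ₑ ^ 2 * (I.shift n).decay y ^ 6 := by
  have hgm : Measurable fun y => ‖g y‖ₑ := hg.enorm
  have hφm : Measurable fun y => ‖φ (I.shift n) y‖ₑ := (h.continuous _).enorm.measurable
  have h1 : ‖pairing g (φ (I.shift n))‖ₑ ≤ ∫⁻ y, ‖g y‖ₑ * ‖φ (I.shift n) y‖ₑ := by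
    refine (enorm_integral_le_lintegral_enorm _).trans (le_of_eq ?_)
    simp_rw [enorm_mul, RCLike.enorm_conj]
  unfold coeff
  rw [ENNReal.div_le_iff I.elen_ne_zero I.elen_ne_top]
  calc ‖pairing g (φ (I.shift n))‖ₑ ^ 2
      ≤ (∫⁻ y, ‖g y‖ₑ ^ 2 * ‖φ (I.shift n) y‖ₑ) * ∫⁻ y, ‖φ (I.shift n) y‖ₑ :=
        (pow_le_pow_left' h1 2).trans (sq_lintegral_mul_le hgm hφm)
    _ ≤ (∫⁻ y, D * (‖g y‖ₑ ^ 2 * (I.shift n).decay y ^ 6)) * (D * (4 * rhoSum * I.elen)) := by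
        refine mul_le_mul' (lintegral_mono fun y => ?_) (h.lintegral_enorm_le _)
        rw [mul_left_comm]
        exact mul_le_mul_right (h.enorm_le _ y) _
    _ = _ := by
        rw [lintegral_const_mul' _ _ ENNReal.coe_ne_top]; ring

/-- Comparison of the decay away from a shifted subinterval with the decay away from a shift of the
large interval. -/
lemma decay_shift_le {I Q : DyadicInterval} (hIQ : I.ico ⊆ Q.ico) {n c : ℤ} {d : ℕ}
    (hd : I.length = Q.length / 2 ^ d) (hc : |(n : ℝ) / 2 ^ d - c| ≤ 1) (y : ℝ) :
    (I.shift n).decay y ≤ 3 * (Q.shift c).decay y := by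
  have hI := I.length_pos
  have hQ := Q.length_pos
  have hle := length_le_of_subset hIQ
  have hm := hIQ I.left_mem_ico
  rw [show (3 : ℝ≥0∞) = ENNReal.ofReal 3 by norm_num]
  refine decay_le_mul (by norm_num) ?_
  rw [shift_left, shift_left, shift_length, shift_length]
  have h1 : |y - (Q.left - c * Q.length)| ≤ |y - (I.left - n * I.length)| + 2 * Q.length := by
    have e : y - (Q.left - c * Q.length) = (y - (I.left - n * I.length)) +
        ((I.left - Q.left) + -(((n : ℝ) / 2 ^ d - c) * Q.length)) := by
      rw [hd]; ring
    rw [e]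
    refine (abs_add_le _ _).trans ?_
    gcongr
    refine (abs_add_le _ _).trans ?_
    rw [abs_neg, abs_mul, abs_of_pos hQ, two_mul]
    gcongr
    · rw [abs_le]; constructor <;> linarith [hm.1, hm.2]
    · exact mul_le_of_le_one_left hQ.le hc
  have h2 : |y - (Q.left - c * Q.length)| / Q.length ≤
      |y - (I.left - n * I.length)| / Q.length + 2 := by
    rw [div_add' _ _ _ hQ.ne']; gcongr
  have h3 : |y - (I.left - n * I.length)| / Q.length ≤ |y - (I.left - n * I.length)| / I.length := by
    gcongr
  have h4 : 0 ≤ |y - (I.left - n * I.length)| / I.length := by positivity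
  linarith

/-- The six powers are divided up: three become decay away from the shift of Q, at the cost 3³ = 27,
two serve to sum over the positions, and one is held in reserve to give 2^(-d) far from Q. -/
lemma decay_shift_pow_le {I Q : DyadicInterval} (hIQ : I.ico ⊆ Q.ico) {n c : ℤ} {d : ℕ}
    (hd : I.length = Q.length / 2 ^ d) (hc : |(n : ℝ) / 2 ^ d - c| ≤ 1) (y : ℝ) :
    (I.shift n).decay y ^ 6 ≤
      27 * (I.shift n).decay y * ((I.shift n).decay y ^ 2 * (Q.shift c).decay y ^ 3) := by
  calc (I.shift n).decay y ^ 6 = (I.shift n).decay y ^ 3 *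
        ((I.shift n).decay y * (I.shift n).decay y ^ 2) := by ring
    _ ≤ (3 * (Q.shift c).decay y) ^ 3 * ((I.shift n).decay y * (I.shift n).decay y ^ 2) := by
        gcongr; exact decay_shift_le hIQ hd hc y
    _ = _ := by ring

/-- On points far from `Q`, the decay away from short shifted subintervals gains a power. -/
lemma decay_shift_far_le {I Q : DyadicInterval} (hIQ : I.ico ⊆ Q.ico) {n : ℤ} {d : ℕ}
    (hd : I.length = Q.length / 2 ^ d) (hc : |(n : ℝ)| / 2 ^ d ≤ 1) {y : ℝ}
    (hy : 3 * Q.length < |y - Q.left|) :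
    (I.shift n).decay y ≤ (2 ^ d)⁻¹ := by
  have hI := I.length_pos
  have hQ := Q.length_pos
  have hm := hIQ I.left_mem_ico
  have e : (2 : ℝ≥0∞) ^ d = ENNReal.ofReal (2 ^ d) := by
    rw [ENNReal.ofReal_pow (by norm_num)]; norm_num
  rw [e]
  refine decay_le_of_le (by positivity) ?_
  rw [shift_left, shift_length]
  have h1 : Q.length ≤ |y - (I.left - n * I.length)| := by
    have e : y - Q.left = (y - (I.left - n * I.length)) +
        ((I.left - Q.left) + -((n : ℝ) / 2 ^ d * Q.length)) := by
      rw [hd]; ring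
    have h2 : |y - Q.left| ≤ |y - (I.left - n * I.length)| + (Q.length + Q.length) := by
      rw [e]
      refine (abs_add_le _ _).trans ?_
      gcongr
      refine (abs_add_le _ _).trans ?_
      rw [abs_neg, abs_mul, abs_of_pos hQ]
      gcongr
      · rw [abs_le]; constructor <;> linarith [hm.1, hm.2]
      · refine mul_le_of_le_one_left hQ.le ?_
        rwa [abs_div, abs_of_pos (show (0 : ℝ) < 2 ^ d by positivity)]
    linarith
  have h3 : (2 : ℝ) ^ d ≤ |y - (I.left - n * I.length)| / I.length := by
    have h4 : (2 : ℝ) ^ d * I.length = Q.length := by rw [hd]; field_simp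
    rw [le_div_iff₀ hI, h4]
    exact h1
  linarith

lemma tsum_shift_decay_sq_le (Q : DyadicInterval) (n : ℤ) (d : ℕ) (y : ℝ) :
    ∑' m : {m : ℤ // (⟨Q.scale - d, m⟩ : DyadicInterval).ico ⊆ Q.ico},
      ((⟨Q.scale - d, m⟩ : DyadicInterval).shift n).decay y ^ 2 ≤ 4 * rhoSum := by
  refine le_trans ?_ (tsum_decay_sq_le (Q.scale - d) y)
  let F : {m : ℤ // (⟨Q.scale - d, m⟩ : DyadicInterval).ico ⊆ Q.ico} → ℤ := fun m => m.1 - n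
  have hF : Function.Injective F := by
    intro m m' h
    simp only [F, sub_left_inj] at h
    exact Subtype.ext h
  exact ENNReal.tsum_comp_le_tsum_of_injective hF
    fun m => (⟨Q.scale - d, m⟩ : DyadicInterval).decay y ^ 2

/-- Summing decaying integrals over the subintervals of `Q` of one scale. -/
lemma tsum_lintegral_decay_le (Q : DyadicInterval) (n c : ℤ) (d : ℕ) {h : ℝ → ℝ≥0∞}
    (hh : Measurable h) (hc : |(n : ℝ) / 2 ^ d - c| ≤ 1) {a : ℝ≥0∞} (ha : a ≠ ⊤)
    (hfar : ∀ I : DyadicInterval, I.ico ⊆ Q.ico → I.length = Q.length / 2 ^ d →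
      ∀ y, h y ≠ 0 → (I.shift n).decay y ≤ a) :
    ∑' m : {m : ℤ // (⟨Q.scale - d, m⟩ : DyadicInterval).ico ⊆ Q.ico},
      ∫⁻ y, h y * ((⟨Q.scale - d, m⟩ : DyadicInterval).shift n).decay y ^ 6 ≤
      27 * (4 * rhoSum) * a * ∫⁻ y, h y * (Q.shift c).decay y ^ 3 := by
  have hlen : ∀ m : ℤ, (⟨Q.scale - d, m⟩ : DyadicInterval).length = Q.length / 2 ^ d := by
    intro m
    simp only [length]; rw [zpow_sub₀ two_ne_zero, zpow_natCast]
  rw [← lintegral_tsum fun m => by fun_prop]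
  have hfin : 27 * (4 * rhoSum) * a ≠ ⊤ := ENNReal.mul_ne_top (ENNReal.mul_ne_top (by norm_num)
    (ENNReal.mul_ne_top (by norm_num) rhoSum_ne_top)) ha
  rw [← lintegral_const_mul' _ _ hfin]
  refine lintegral_mono fun y => ?_
  dsimp only
  rw [ENNReal.tsum_mul_left]
  by_cases hy : h y = 0
  · simp [hy]
  calc h y * ∑' m : {m : ℤ // (⟨Q.scale - d, m⟩ : DyadicInterval).ico ⊆ Q.ico},
        ((⟨Q.scale - d, m⟩ : DyadicInterval).shift n).decay y ^ 6
      ≤ h y * ∑' m : {m : ℤ // (⟨Q.scale - d, m⟩ : DyadicInterval).ico ⊆ Q.ico},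
        27 * a * (Q.shift c).decay y ^ 3 *
          ((⟨Q.scale - d, m⟩ : DyadicInterval).shift n).decay y ^ 2 := by
        gcongr with m
        refine (decay_shift_pow_le m.2 (hlen _) hc y).trans ?_
        calc _ ≤ 27 * a * (((⟨Q.scale - d, m⟩ : DyadicInterval).shift n).decay y ^ 2 *
              (Q.shift c).decay y ^ 3) := by
              gcongr; exact hfar _ m.2 (hlen _) y hy
          _ = _ := by ring
    _ ≤ h y * (27 * a * (Q.shift c).decay y ^ 3 * (4 * rhoSum)) := by
        rw [ENNReal.tsum_mul_left]
        gcongr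
        exact tsum_shift_decay_sq_le Q n d y
    _ = _ := by ring

lemma abs_div_sub_ediv_le (n : ℤ) (d : ℕ) : |(n : ℝ) / 2 ^ d - ((n / 2 ^ d : ℤ) : ℝ)| ≤ 1 := by
  have h1 : (n : ℤ) = 2 ^ d * (n / 2 ^ d) + n % 2 ^ d := (Int.mul_ediv_add_emod n (2 ^ d)).symm
  have hpos : (0 : ℤ) < 2 ^ d := by positivity
  have h2 := Int.emod_nonneg n hpos.ne'
  have h3 := Int.emod_lt_of_pos n hpos
  have hpos' : (0 : ℝ) < 2 ^ d := by positivity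
  have h1' : (n : ℝ) = 2 ^ d * ((n / 2 ^ d : ℤ) : ℝ) + ((n % 2 ^ d : ℤ) : ℝ) := by
    exact_mod_cast h1
  have h2' : (0 : ℝ) ≤ ((n % 2 ^ d : ℤ) : ℝ) := by exact_mod_cast h2
  have h3' : ((n % 2 ^ d : ℤ) : ℝ) < 2 ^ d := by exact_mod_cast h3
  have e : (n : ℝ) / 2 ^ d - ((n / 2 ^ d : ℤ) : ℝ) = ((n % 2 ^ d : ℤ) : ℝ) / 2 ^ d := by
    rw [eq_div_iff hpos'.ne', sub_mul, div_mul_cancel₀ _ hpos'.ne']; linarith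
  rw [e, abs_of_nonneg (by positivity), div_le_one hpos']
  exact h3'.le

/-- A subinterval I of Q of length 2^(-d)|Q| has I_n near the shift of Q by ⌊n/2^d⌋. At the first N
scales this is used with no cancellation, which costs one weighted integral per scale. At later
scales the shift moves I by at most |Q|, so g splits into a part near Q, handled by the global L²
bound, and a far part, which gains 2^(-d) from decay. -/
lemma exists_massBelow_coeff_le (D : ℝ≥0) :
    ∃ K : ℝ≥0∞, K ≠ ⊤ ∧ ∀ φ, IsWavelet D φ → ∀ p : ℝ≥0∞, 1 ≤ p → ∀ g : ℝ → ℂ,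
      StronglyMeasurable g → MemLp g p → ∀ (n : ℤ) (Q : DyadicInterval),
        massBelow (coeff φ n g) Q ≤ K *
          ((∑ d ∈ Finset.range (Nat.log 2 n.natAbs + 1),
            ∫⁻ y, ‖g y‖ₑ ^ 2 * (Q.shift (n / 2 ^ d)).decay y ^ 3) +
              ∫⁻ y, ‖g y‖ₑ ^ 2 * Q.decay y ^ 3) := by
  obtain ⟨B, -, hB⟩ := exists_tsum_pairing_le D
  set K₁ : ℝ≥0∞ := D ^ 2 * (4 * rhoSum) with hK₁
  set K₂ : ℝ≥0∞ := K₁ * (27 * (4 * rhoSum)) with hK₂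
  have hr : 4 * rhoSum ≠ ⊤ := ENNReal.mul_ne_top (by norm_num) rhoSum_ne_top
  have hK₁t : K₁ ≠ ⊤ := ENNReal.mul_ne_top (by simp) hr
  have hK₂t : K₂ ≠ ⊤ := ENNReal.mul_ne_top hK₁t (ENNReal.mul_ne_top (by norm_num) hr)
  refine ⟨K₂ * 4 + 2 * B * 64, ENNReal.add_ne_top.2 ⟨ENNReal.mul_ne_top hK₂t (by norm_num),
    ENNReal.mul_ne_top (ENNReal.mul_ne_top (by norm_num) (by simp)) (by norm_num)⟩, ?_⟩
  intro φ h p hp g hg hgp n Q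
  have hgm : Measurable fun y => ‖g y‖ₑ ^ 2 := hg.enorm.pow_const 2
  set N := Nat.log 2 n.natAbs + 1 with hN
  -- The radius 3|Q| leaves distance at least |Q| from far points to every shifted subinterval at
  -- the later scales.
  set near : Set ℝ := Metric.closedBall Q.left (3 * Q.length) with hnear
  have hnearm : MeasurableSet near := measurableSet_closedBall
  set g₁ := near.indicator g with hg₁
  set g₂ := nearᶜ.indicator g with hg₂
  have hg₂m : Measurable fun y => ‖g₂ y‖ₑ ^ 2 := (hg.indicator hnearm.compl).enorm.pow_const 2
  set X := ∫⁻ y, ‖g y‖ₑ ^ 2 * Q.decay y ^ 3 with hX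
  set E : DyadicInterval → ℝ≥0∞ := fun I =>
    if (Q.scale - I.scale).toNat < N then K₁ * ∫⁻ y, ‖g y‖ₑ ^ 2 * (I.shift n).decay y ^ 6
    else 2 * (K₁ * ∫⁻ y, ‖g₂ y‖ₑ ^ 2 * (I.shift n).decay y ^ 6) with hE
  have hsplit : ∀ I, coeff φ n g I ≤ 2 * coeff φ n g₁ I + E I := by
    intro I
    by_cases hd : (Q.scale - I.scale).toNat < N
    · simp only [hE, if_pos hd]
      exact (coeff_le_lintegral h n hg I).trans le_add_self
    · simp only [hE, if_neg hd]
      have e : g = fun x => g₁ x + g₂ x := by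
        ext x; rw [hg₁, hg₂, Set.indicator_self_add_compl_apply]
      have h1 := coeff_add_le h n hp hp (hgp.indicator hnearm) (hgp.indicator hnearm.compl) I
      rw [← hg₁, ← hg₂, ← e] at h1
      refine h1.trans ?_
      gcongr
      exact coeff_le_lintegral h n (hg.indicator hnearm.compl) I
  have hE_le : ∀ d : ℕ, ∑' m : {m : ℤ // (⟨Q.scale - d, m⟩ : DyadicInterval).ico ⊆ Q.ico},
      E ⟨Q.scale - d, m⟩ ≤
        (if d < N then K₂ * ∫⁻ y, ‖g y‖ₑ ^ 2 * (Q.shift (n / 2 ^ d)).decay y ^ 3 else 0) +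
          2 * K₂ * X * (2 ^ d)⁻¹ := by
    intro d
    have hd : (Q.scale - (Q.scale - (d : ℤ))).toNat = d := by simp
    simp only [hE, hd]
    by_cases hdN : d < N
    · simp only [if_pos hdN]
      rw [ENNReal.tsum_mul_left]
      refine le_trans ?_ le_self_add
      rw [hK₂, mul_assoc K₁]
      refine mul_le_mul_right ?_ _
      have := tsum_lintegral_decay_le Q n (n / 2 ^ d) d hgm (abs_div_sub_ediv_le n d)
        ENNReal.one_ne_top (fun I _ _ y _ => decay_le_one _ y)
      simpa using this
    · simp only [if_neg hdN, zero_add]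
      have hd1 := abs_div_two_pow_le_one n (d := d) (by omega)
      have hd2 : |(n : ℝ) / 2 ^ d - ((0 : ℤ) : ℝ)| ≤ 1 := by
        rw [Int.cast_zero, sub_zero, abs_div, abs_of_pos (show (0 : ℝ) < 2 ^ d by positivity)]
        exact hd1
      have := tsum_lintegral_decay_le Q n 0 d hg₂m hd2 (a := (2 ^ d)⁻¹) (by simp)
        (fun I hI hId y hy => by
          refine decay_shift_far_le hI hId hd1 ?_
          by_contra hcon
          refine hy ?_
          have : y ∈ near := by
            rw [hnear, Metric.mem_closedBall, Real.dist_eq]; exact not_lt.1 hcon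
          simp [hg₂, this])
      rw [shift_zero] at this
      rw [ENNReal.tsum_mul_left, ENNReal.tsum_mul_left]
      have h2 : ∫⁻ y, ‖g₂ y‖ₑ ^ 2 * Q.decay y ^ 3 ≤ X := by
        refine lintegral_mono fun y => ?_
        gcongr
        exact enorm_indicator_le_enorm_self _ _
      calc _ ≤ 2 * (K₁ * (27 * (4 * rhoSum) * (2 ^ d)⁻¹ * X)) := by
            gcongr; exact this.trans (mul_le_mul_right h2 _)
        _ = _ := by rw [hK₂]; ring
  have hnear_le : ∑' I, coeff φ n g₁ I ≤ B * 64 * X := by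
    rw [tsum_coeff, mul_assoc]
    refine (hB φ h g₁ (hg.indicator hnearm).aestronglyMeasurable).trans ?_
    refine mul_le_mul_right ?_ _
    rw [hX, ← lintegral_const_mul' _ _ (by norm_num)]
    refine lintegral_mono fun y => ?_
    by_cases hy : y ∈ near
    -- On the near set the weight is at most 4, so inserting three powers of the decay costs 4³ =
    -- 64.
    · have h1 : 1 ≤ 4 * Q.decay y := by
        have hQ := Q.length_pos
        rw [hnear, Metric.mem_closedBall, Real.dist_eq] at hy
        rw [decay, show (4 : ℝ≥0∞) = ENNReal.ofReal 4 by norm_num,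
          ← ENNReal.ofReal_mul (by norm_num), ENNReal.one_le_ofReal, ← div_eq_mul_inv,
          one_le_div (by linarith [Q.one_le_weight y])]
        have : |y - Q.left| / Q.length ≤ 3 := by rw [div_le_iff₀ hQ]; exact hy
        linarith
      rw [hg₁, Set.indicator_of_mem hy]
      calc ‖g y‖ₑ ^ 2 ≤ (4 * Q.decay y) ^ 3 * ‖g y‖ₑ ^ 2 :=
            le_mul_of_one_le_left' (one_le_pow_of_one_le' h1 3)
        _ = _ := by ring
    · simp [hg₁, hy]
  calc massBelow (coeff φ n g) Q
      ≤ ∑' I : {I : DyadicInterval // I.ico ⊆ Q.ico}, (2 * coeff φ n g₁ I + E I) :=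
        ENNReal.tsum_le_tsum fun I => hsplit I
    _ ≤ 2 * ∑' I, coeff φ n g₁ I + ∑' I : {I : DyadicInterval // I.ico ⊆ Q.ico}, E I := by
        rw [ENNReal.tsum_add, ENNReal.tsum_mul_left]
        gcongr
        exact ENNReal.tsum_comp_le_tsum_of_injective Subtype.val_injective _
    _ ≤ 2 * (B * 64 * X) + ∑' d : ℕ, ((if d < N then
          K₂ * ∫⁻ y, ‖g y‖ₑ ^ 2 * (Q.shift (n / 2 ^ d)).decay y ^ 3 else 0) +
          2 * K₂ * X * (2 ^ d)⁻¹) := by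
        gcongr
        exact (tsum_subset_le E Q).trans (ENNReal.tsum_le_tsum hE_le)
    _ = 2 * (B * 64 * X) + (K₂ * (∑ d ∈ Finset.range N,
          ∫⁻ y, ‖g y‖ₑ ^ 2 * (Q.shift (n / 2 ^ d)).decay y ^ 3) + 2 * K₂ * X * 2) := by
        rw [ENNReal.tsum_add, ENNReal.tsum_mul_left, tsum_inv_two_pow,
          tsum_eq_sum (s := Finset.range N) (fun d hd => if_neg (by simpa using hd)),
          Finset.mul_sum]
        congr 2
        refine Finset.sum_congr rfl fun d hd => if_pos (Finset.mem_range.1 hd)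
    _ = K₂ * (∑ d ∈ Finset.range N,
          ∫⁻ y, ‖g y‖ₑ ^ 2 * (Q.shift (n / 2 ^ d)).decay y ^ 3) +
          (K₂ * 4 + 2 * B * 64) * X := by ring
    _ ≤ (K₂ * 4 + 2 * B * 64) * (∑ d ∈ Finset.range N,
          ∫⁻ y, ‖g y‖ₑ ^ 2 * (Q.shift (n / 2 ^ d)).decay y ^ 3) +
          (K₂ * 4 + 2 * B * 64) * X := by
        gcongr
        exact (le_mul_of_one_le_right' (by norm_num)).trans le_self_add
    _ = _ := by rw [mul_add]

/-- The averages of the shifted maximal functions against `(1 + |r|)⁻³`. -/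
noncomputable def smoothMax (c : ℤ) (f : ℝ → ℝ≥0∞) (x : ℝ) : ℝ≥0∞ :=
  ∑' s : ℤ, rho s ^ 3 * shiftMax (c + s) f x

lemma measurable_smoothMax (c : ℤ) (f : ℝ → ℝ≥0∞) : Measurable (smoothMax c f) :=
  Measurable.tsum fun _ => (measurable_shiftMax _ f).const_mul _

lemma shift_shift (c r : ℤ) (Q : DyadicInterval) : (Q.shift c).shift r = Q.shift (c + r) := by
  ext
  · rfl
  · simp only [shift]; ring

/-- Cut the line into the translates Q_{c+r}. For x in Q the average over each is at most the
maximal function of shift c+r at x, and the decay there is at most 2(1+|r|)⁻¹; the 8 is 2³. -/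
lemma lintegral_decay_div_le (f : ℝ → ℝ≥0∞) (c : ℤ) {Q : DyadicInterval} {x : ℝ}
    (hx : x ∈ Q.ico) :
    (∫⁻ y, f y * (Q.shift c).decay y ^ 3) / Q.elen ≤ 8 * smoothMax c f x := by
  rw [ENNReal.div_le_iff Q.elen_ne_zero Q.elen_ne_top, smoothMax]
  refine (lintegral_mul_decay_le f (Q.shift c) 3).trans ?_
  rw [mul_assoc, ← ENNReal.tsum_mul_right]
  have h8 : (2 : ℝ≥0∞) ^ 3 = 8 := by norm_num
  rw [h8]
  refine mul_le_mul_right (ENNReal.tsum_le_tsum fun r => ?_) _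
  rw [mul_assoc, shift_shift]
  refine mul_le_mul_right ?_ _
  have := avg_le_shiftMax (c + r) f hx
  rwa [avg, ENNReal.div_le_iff (elen_ne_zero _) (elen_ne_top _), shift_elen] at this

/-- The logarithm of the shift c+r grows at most linearly in r, so one of the three powers of `rho`
in `smoothMax` pays for it. -/
lemma ell_add_le {c n r : ℤ} (hc : |c| ≤ |n|) :
    ell (c + r) ≤ 3 * ell n * ENNReal.ofReal (1 + |(r : ℝ)|) := by
  have hn := half_le_log n
  have h1 : Real.log (2 + |((c + r : ℤ) : ℝ)|) ≤
      Real.log (2 + |(n : ℝ)|) + Real.log (1 + |(r : ℝ)|) := by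
    rw [← Real.log_mul (by positivity) (by positivity)]
    refine Real.log_le_log (by positivity) ?_
    push_cast
    have h2 := abs_add_le (c : ℝ) (r : ℝ)
    have h3 : |(c : ℝ)| ≤ |(n : ℝ)| := by exact_mod_cast hc
    nlinarith [abs_nonneg (n : ℝ), abs_nonneg (r : ℝ)]
  have h4 : Real.log (1 + |(r : ℝ)|) ≤ |(r : ℝ)| := by
    have := Real.log_le_sub_one_of_pos (show 0 < 1 + |(r : ℝ)| by positivity)
    linarith
  rw [ell, ell, show (3 : ℝ≥0∞) = ENNReal.ofReal 3 by norm_num,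
    ← ENNReal.ofReal_mul (by norm_num), ← ENNReal.ofReal_mul (by linarith)]
  refine ENNReal.ofReal_le_ofReal ?_
  nlinarith [abs_nonneg (r : ℝ)]

/-- Pairing with V makes the infinite sum additive, which takes the place of the triangle inequality
in L^q. -/
lemma lintegral_smoothMax_mul_le {q r : ℝ} (hqr : q.HolderConjugate r) {C : ℝ≥0}
    (hC : ∀ (m : ℤ) (f : ℝ → ℝ≥0∞), Measurable f →
      ∫⁻ x, shiftMax m f x ^ q ≤ C * ell m * ∫⁻ x, f x ^ q)
    {c n : ℤ} (hc : |c| ≤ |n|) {f V : ℝ → ℝ≥0∞} (hf : Measurable f) (hV : Measurable V) :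
    ∫⁻ x, smoothMax c f x * V x ≤
      (C + 2) * (3 * rhoSum) * ell n * (∫⁻ x, f x ^ q) ^ (1 / q) *
        (∫⁻ x, V x ^ r) ^ (1 / r) := by
  have hq := hqr.pos
  have hq1 := hqr.lt
  set H := (∫⁻ x, f x ^ q) ^ (1 / q) with hH
  set W := (∫⁻ x, V x ^ r) ^ (1 / r) with hW
  have h1 : ∀ m : ℤ, ∫⁻ x, shiftMax m f x * V x ≤ (C + 2) * ell m * H * W := by
    intro m
    refine (ENNReal.lintegral_mul_le_Lp_mul_Lq volume hqr
      (measurable_shiftMax m f).aemeasurable hV.aemeasurable).trans ?_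
    refine mul_le_mul_left ?_ _
    refine (ENNReal.rpow_le_rpow (hC m f hf) (by positivity)).trans ?_
    rw [ENNReal.mul_rpow_of_nonneg _ _ (by positivity)]
    refine mul_le_mul_left ?_ _
    -- As `ell` may be less than 1, the summand 2 ensures a base of at least 1, so that its power
    -- 1/q is at most the base.
    have h2 : 1 ≤ (C + 2) * ell m :=
      (one_le_two_mul_ell m).trans (mul_le_mul_left le_add_self _)
    have h3 : C * ell m ≤ (C + 2) * ell m := mul_le_mul_left le_self_add _
    calc (C * ell m) ^ (1 / q) ≤ ((C + 2) * ell m) ^ (1 / q) :=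
          ENNReal.rpow_le_rpow h3 (by positivity)
      _ ≤ ((C + 2) * ell m) ^ (1 : ℝ) := ENNReal.rpow_le_rpow_of_exponent_le h2
          (by rw [div_le_one hq]; exact hq1.le)
      _ = _ := ENNReal.rpow_one _
  calc ∫⁻ x, smoothMax c f x * V x
      = ∑' s : ℤ, rho s ^ 3 * ∫⁻ x, shiftMax (c + s) f x * V x := by
        simp_rw [smoothMax, ← ENNReal.tsum_mul_right, mul_assoc]
        rw [lintegral_tsum fun s => by fun_prop]
        refine tsum_congr fun s => ?_
        rw [lintegral_const_mul _ (by fun_prop)]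
    _ ≤ ∑' s : ℤ, (C + 2) * 3 * ell n * H * W * rho s ^ 2 := by
        refine ENNReal.tsum_le_tsum fun s => ?_
        calc rho s ^ 3 * ∫⁻ x, shiftMax (c + s) f x * V x
            ≤ rho s ^ 3 * ((C + 2) * (3 * ell n * ENNReal.ofReal (1 + |(s : ℝ)|)) * H * W) := by
              gcongr
              refine (h1 _).trans ?_
              gcongr
              exact ell_add_le hc
          _ = (C + 2) * 3 * ell n * H * W * rho s ^ 2 *
              (rho s * ENNReal.ofReal (1 + |(s : ℝ)|)) := by ring
          _ = _ := by rw [rho_mul, mul_one]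
    _ = _ := by rw [ENNReal.tsum_mul_left, ← rhoSum]; ring

lemma carleson_coeff_le {α : DyadicInterval → ℝ≥0∞} {f : ℝ → ℝ≥0∞} {K : ℝ≥0∞} {n : ℤ} {N : ℕ}
    (h : ∀ Q : DyadicInterval, massBelow α Q ≤ K *
      ((∑ d ∈ Finset.range N, ∫⁻ y, f y * (Q.shift (n / 2 ^ d)).decay y ^ 3) +
        ∫⁻ y, f y * Q.decay y ^ 3)) (x : ℝ) :
    carleson α x ≤ 8 * K *
      ((∑ d ∈ Finset.range N, smoothMax (n / 2 ^ d) f x) + smoothMax 0 f x) := by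
  refine iSup_le fun Q => ?_
  by_cases hx : x ∈ Q.ico
  · rw [Set.indicator_of_mem hx]
    have h0 := lintegral_decay_div_le f 0 hx
    rw [shift_zero] at h0
    calc massBelow α Q / Q.elen ≤ _ / Q.elen := ENNReal.div_le_div_right (h Q) _
      _ = K * ((∑ d ∈ Finset.range N, (∫⁻ y, f y * (Q.shift (n / 2 ^ d)).decay y ^ 3) / Q.elen) +
          (∫⁻ y, f y * Q.decay y ^ 3) / Q.elen) := by
          simp only [div_eq_mul_inv, ← Finset.sum_mul]; ring
      _ ≤ K * ((∑ d ∈ Finset.range N, 8 * smoothMax (n / 2 ^ d) f x) + 8 * smoothMax 0 f x) := by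
          gcongr with d hd
          exact lintegral_decay_div_le f _ hx
      _ = _ := by rw [← Finset.mul_sum]; ring
  · rw [Set.indicator_of_notMem hx]; exact zero_le

lemma abs_ediv_two_pow_le (n : ℤ) (d : ℕ) : |n / 2 ^ d| ≤ |n| := by
  have := Int.natAbs_ediv_le_natAbs n (2 ^ d)
  rw [Int.abs_eq_natAbs, Int.abs_eq_natAbs]
  exact_mod_cast this

/-- The square function estimate for exponents larger than two. -/
lemma exists_lintegral_dyadicSum_rpow_le (D : ℝ≥0) {q : ℝ} (hq : 1 < q) :
    ∃ K : ℝ≥0∞, K ≠ ⊤ ∧ ∀ φ, IsWavelet D φ → ∀ p : ℝ≥0∞, 1 ≤ p → ∀ g : ℝ → ℂ,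
      StronglyMeasurable g → MemLp g p → ∀ n : ℤ,
        ∫⁻ x, dyadicSum (coeff φ n g) x ^ q ≤ (K * ell n ^ 2) ^ q * ∫⁻ x, (‖g x‖ₑ ^ 2) ^ q := by
  set r := q.conjExponent with hr
  have hqr : q.HolderConjugate r := Real.HolderConjugate.conjExponent hq
  obtain ⟨K, hK, hmass⟩ := exists_massBelow_coeff_le D
  obtain ⟨C, hC⟩ := exists_lintegral_shiftMax_rpow_le hq
  obtain ⟨C', hC'⟩ := exists_lintegral_shiftMax_rpow_le hqr.symm.lt
  set A : ℝ≥0∞ := (C + 2) * (3 * rhoSum) with hA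
  have hAt : A ≠ ⊤ := ENNReal.mul_ne_top (by simp) (ENNReal.mul_ne_top (by norm_num) rhoSum_ne_top)
  have hCt : ((C' : ℝ≥0∞) * ell 0) ^ (1 / r) ≠ ⊤ :=
    ENNReal.rpow_ne_top_of_nonneg (by have := hqr.symm.pos; positivity)
      (ENNReal.mul_ne_top (by simp) (ell_ne_top 0))
  refine ⟨8 * K * 6 * A * (C' * ell 0) ^ (1 / r),
    ENNReal.mul_ne_top (ENNReal.mul_ne_top (ENNReal.mul_ne_top (ENNReal.mul_ne_top (by norm_num) hK)
      (by norm_num)) hAt) hCt, ?_⟩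
  intro φ h p hp g hg hgp n
  set N := Nat.log 2 n.natAbs + 1 with hN
  set f : ℝ → ℝ≥0∞ := fun x => ‖g x‖ₑ ^ 2 with hf
  have hfm : Measurable f := hg.enorm.pow_const 2
  set H := ∫⁻ x, f x ^ q with hH
  have hY : ∀ V : ℝ → ℝ≥0∞, Measurable V → ∫⁻ x, carleson (coeff φ n g) x * V x ≤
      (8 * K * 6 * A * ell n ^ 2 * H ^ (1 / q)) * (∫⁻ x, V x ^ r) ^ (1 / r) := by
    intro V hV
    set W := (∫⁻ x, V x ^ r) ^ (1 / r)
    have hs : ∀ c : ℤ, |c| ≤ |n| → ∫⁻ x, smoothMax c f x * V x ≤ A * ell n * H ^ (1 / q) * W :=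
      fun c hc => lintegral_smoothMax_mul_le hqr hC hc hfm hV
    have hsm : ∀ c : ℤ, Measurable fun x => smoothMax c f x * V x :=
      fun c => (measurable_smoothMax c f).mul hV
    have h8K : 8 * K ≠ ⊤ := ENNReal.mul_ne_top (by norm_num) hK
    calc ∫⁻ x, carleson (coeff φ n g) x * V x
        ≤ ∫⁻ x, 8 * K * ((∑ d ∈ Finset.range N, smoothMax (n / 2 ^ d) f x * V x) +
            smoothMax 0 f x * V x) := by
          refine lintegral_mono fun x => ?_
          refine (mul_le_mul_left (carleson_coeff_le
            (fun Q => hmass φ h p hp g hg hgp n Q) x) _).trans (le_of_eq ?_)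
          rw [← Finset.sum_mul]; ring
      _ = 8 * K * ((∑ d ∈ Finset.range N, ∫⁻ x, smoothMax (n / 2 ^ d) f x * V x) +
            ∫⁻ x, smoothMax 0 f x * V x) := by
          rw [lintegral_const_mul' _ _ h8K, lintegral_add_right _ (hsm 0),
            lintegral_finsetSum _ fun d _ => hsm _]
      _ ≤ 8 * K * ((∑ _d ∈ Finset.range N, A * ell n * H ^ (1 / q) * W) +
            A * ell n * H ^ (1 / q) * W) := by
          gcongr with d hd
          · exact hs _ (abs_ediv_two_pow_le n d)
          · exact hs 0 (by simp)
      _ = 8 * K * ((N + 1) * (A * ell n * H ^ (1 / q) * W)) := by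
          rw [Finset.sum_const, Finset.card_range, nsmul_eq_mul, add_mul, one_mul]
      -- The number of terms supplies the second power of the logarithm.
      _ ≤ 8 * K * ((4 * ell n + 2 * ell n) * (A * ell n * H ^ (1 / q) * W)) := by
          gcongr
          · exact natLog_add_one_le n
          · exact one_le_two_mul_ell n
      _ = _ := by ring
  refine (lintegral_dyadicSum_rpow_le _ (coeff_ne_top φ n g) hqr (hC' 0) hY).trans (le_of_eq ?_)
  have e : H = (H ^ (1 / q)) ^ q := by
    rw [← ENNReal.rpow_mul, one_div, inv_mul_cancel₀ hqr.pos.ne', ENNReal.rpow_one]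
  conv_rhs => rw [e]
  rw [← ENNReal.mul_rpow_of_nonneg _ _ hqr.pos.le]
  congr 1
  ring

/-! ### The Calderón–Zygmund decomposition -/

lemma closedBall_center_eq_Icc (I : DyadicInterval) :
    Metric.closedBall (I.left + I.length / 2) (I.length / 2) =
      Set.Icc I.left (I.left + I.length) := by
  rw [Real.closedBall_eq_Icc]; congr 1 <;> ring

/-- A consequence of Lebesgue's differentiation theorem. -/
lemma ae_enorm_le_shiftMax {g : ℝ → ℂ} (hg : LocallyIntegrable g) :
    ∀ᵐ x, ‖g x‖ₑ ≤ shiftMax 0 (fun y => ‖g y‖ₑ) x := by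
  have hgn : LocallyIntegrable (fun y => ‖g y‖) := fun x => by
    obtain ⟨s, hs, h⟩ := hg x
    exact ⟨s, hs, h.norm⟩
  filter_upwards [IsUnifLocDoublingMeasure.ae_tendsto_average volume hgn 1] with x hx
  by_cases htop : shiftMax 0 (fun y => ‖g y‖ₑ) x = ⊤
  · rw [htop]; exact le_top
  let I : ℕ → DyadicInterval := fun j => ⟨-j, ⌊x / (2 : ℝ) ^ (-j : ℤ)⌋⟩
  have hxI : ∀ j, x ∈ (I j).ico := fun j => (mem_ico_iff _ _).2 rfl
  have hlen : ∀ j, (I j).length = (1 / 2) ^ j := by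
    intro j; simp [I, length]
  have hlim : Filter.Tendsto (fun j => (I j).length / 2) Filter.atTop (nhdsWithin 0 (Set.Ioi 0)) := by
    refine tendsto_nhdsWithin_iff.2 ⟨?_, Filter.Eventually.of_forall fun j => ?_⟩
    · have := (tendsto_pow_atTop_nhds_zero_of_lt_one (r := (1 / 2 : ℝ)) (by norm_num)
        (by norm_num)).div_const 2
      simpa [hlen] using this
    · exact half_pos (I j).length_pos
  have hmem : ∀ᶠ j in Filter.atTop,
      x ∈ Metric.closedBall ((I j).left + (I j).length / 2) (1 * ((I j).length / 2)) := by
    refine Filter.Eventually.of_forall fun j => ?_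
    rw [one_mul, closedBall_center_eq_Icc]
    exact Set.Ico_subset_Icc_self (hxI j)
  have key := hx _ _ hlim hmem
  have hle : ∀ j, ⨍ y in Metric.closedBall ((I j).left + (I j).length / 2) ((I j).length / 2),
      ‖g y‖ ≤ (shiftMax 0 (fun y => ‖g y‖ₑ) x).toReal := by
    intro j
    have hl := (I j).length_pos
    rw [closedBall_center_eq_Icc, setAverage_eq, integral_Icc_eq_integral_Ico]
    have e1 : ∫ y in Set.Ico (I j).left ((I j).left + (I j).length), ‖g y‖ =
        (∫⁻ y in (I j).ico, ‖g y‖ₑ).toReal :=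
      integral_norm_eq_lintegral_enorm hg.aestronglyMeasurable.restrict
    have e2 : volume.real (Set.Icc (I j).left ((I j).left + (I j).length)) = (I j).length := by
      rw [Real.volume_real_Icc_of_le (by linarith)]; ring
    rw [e1, e2, smul_eq_mul, ← div_eq_inv_mul]
    have e3 : (∫⁻ y in (I j).ico, ‖g y‖ₑ).toReal / (I j).length =
        (avg (I j) fun y => ‖g y‖ₑ).toReal := by
      rw [avg, ENNReal.toReal_div, elen, ENNReal.toReal_ofReal hl.le]
    rw [e3]
    exact ENNReal.toReal_mono htop (avg_le_shiftMax_zero _ (hxI j))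
  have h2 := le_of_tendsto key (Filter.Eventually.of_forall hle)
  rw [← ofReal_norm]
  exact (ENNReal.ofReal_le_ofReal h2).trans ENNReal.ofReal_toReal_le

open Classical in
/-- The good part of `g`: on a maximal interval with the property `P`, the mean of `g`. -/
noncomputable def goodPart (P : DyadicInterval → Prop) (g : ℝ → ℂ) (x : ℝ) : ℂ :=
  if h : ∃ J, IsMaximal P J ∧ x ∈ J.ico then ⨍ y in h.choose.ico, g y else g x

lemma goodPart_of_mem {P : DyadicInterval → Prop} {J : DyadicInterval} (hJ : IsMaximal P J)
    (g : ℝ → ℂ) {x : ℝ} (hx : x ∈ J.ico) : goodPart P g x = ⨍ y in J.ico, g y := by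
  have h : ∃ J, IsMaximal P J ∧ x ∈ J.ico := ⟨J, hJ, hx⟩
  rw [goodPart, dif_pos h, h.choose_spec.1.eq_of_mem hJ h.choose_spec.2 hx]

lemma goodPart_of_notMem {P : DyadicInterval → Prop} (g : ℝ → ℂ) {x : ℝ}
    (hx : x ∉ ⋃ J : {J // IsMaximal P J}, J.1.ico) : goodPart P g x = g x := by
  rw [goodPart, dif_neg]
  rintro ⟨J, hJ, hxJ⟩
  exact hx (Set.mem_iUnion.2 ⟨⟨J, hJ⟩, hxJ⟩)

lemma measurableSet_iUnion_isMaximal (P : DyadicInterval → Prop) :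
    MeasurableSet (⋃ J : {J // IsMaximal P J}, J.1.ico) :=
  MeasurableSet.iUnion fun J => J.1.measurableSet_ico

/-- The definition chooses an interval, so measurability is glued along the countable partition into
maximal intervals and their complement. -/
lemma aestronglyMeasurable_goodPart (P : DyadicInterval → Prop) {g : ℝ → ℂ}
    (hg : StronglyMeasurable g) : AEStronglyMeasurable (goodPart P g) := by
  rw [← Measure.restrict_univ (μ := (volume : Measure ℝ)),
    ← Set.union_compl_self (⋃ J : {J // IsMaximal P J}, J.1.ico), aestronglyMeasurable_union_iff,
    aestronglyMeasurable_iUnion_iff]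
  refine ⟨fun J => ?_, ?_⟩
  · refine (aestronglyMeasurable_const (b := ⨍ y in J.1.ico, g y)).congr ?_
    filter_upwards [self_mem_ae_restrict J.1.measurableSet_ico] with x hx
    exact (goodPart_of_mem J.2 g hx).symm
  · refine hg.aestronglyMeasurable.congr ?_
    filter_upwards [self_mem_ae_restrict (measurableSet_iUnion_isMaximal P).compl] with x hx
    exact (goodPart_of_notMem g hx).symm

lemma enorm_setAverage_le (J : DyadicInterval) (g : ℝ → ℂ) :
    ‖⨍ y in J.ico, g y‖ₑ ≤ avg J fun y => ‖g y‖ₑ := by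
  have hl := J.length_pos
  have e : volume.real J.ico = J.length := by
    rw [Measure.real, volume_ico, elen, ENNReal.toReal_ofReal hl.le]
  rw [setAverage_eq, e, enorm_smul, avg, ENNReal.div_eq_inv_mul]
  refine mul_le_mul' (le_of_eq ?_) (enorm_integral_le_lintegral_enorm _)
  rw [Real.enorm_eq_ofReal (by positivity), ENNReal.ofReal_inv_of_pos hl, elen]

/-! ### Stopping intervals at height a -/

section Stopping

variable {f : ℝ → ℝ≥0∞} {a : ℝ≥0∞}

/-- An interval with average above a lies in the superlevel set, whose finite measure bounds its
length. -/
lemma exists_scale_le_of_volume_ne_top (h : volume {x | a < shiftMax 0 f x} ≠ ⊤) :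
    ∃ s, ∀ K, a < avg K f → K.scale ≤ s := by
  obtain ⟨s, hs⟩ := exists_scale_le_of_length_lt ((volume {x | a < shiftMax 0 f x}).toReal + 1)
  refine ⟨s, fun K hK => hs K ?_⟩
  have h1 : K.elen ≤ volume {x | a < shiftMax 0 f x} := by
    rw [← volume_ico]
    exact measure_mono fun x hx => hK.trans_le (avg_le_shiftMax_zero f hx)
  have h2 := ENNReal.toReal_mono h h1
  rw [elen, ENNReal.toReal_ofReal K.length_pos.le] at h2
  linarith

lemma iUnion_isMaximal_eq (h : volume {x | a < shiftMax 0 f x} ≠ ⊤) :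
    ⋃ J : {J // IsMaximal (fun K => a < avg K f) J}, J.1.ico = {x | a < shiftMax 0 f x} := by
  refine Set.Subset.antisymm (Set.iUnion_subset fun J x hx => ?_) fun x hx => ?_
  · exact J.2.1.trans_le (avg_le_shiftMax_zero f hx)
  · obtain ⟨I, hxI, hI⟩ := exists_of_lt_shiftMax hx
    rw [shift_zero] at hI
    obtain ⟨J, hJ, hIJ⟩ := exists_isMaximal (P := fun K => a < avg K f)
      (exists_scale_le_of_volume_ne_top h) hI
    exact Set.mem_iUnion.2 ⟨⟨J, hJ⟩, hIJ hxI⟩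

lemma tsum_elen_isMaximal (h : volume {x | a < shiftMax 0 f x} ≠ ⊤) :
    ∑' J : {J // IsMaximal (fun K => a < avg K f) J}, J.1.elen =
      volume {x | a < shiftMax 0 f x} := by
  rw [← iUnion_isMaximal_eq h, measure_iUnion (IsMaximal.pairwise_disjoint _)
    fun J => J.1.measurableSet_ico]
  simp_rw [volume_ico]

/-- By maximality the parent has average at most a, and it is only twice as long. -/
lemma avg_le_of_isMaximal {J : DyadicInterval} (hJ : IsMaximal (fun K => a < avg K f) J) :
    avg J f ≤ 2 * a := by
  have h1 : avg J.parent f ≤ a := by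
    by_contra hcon
    exact J.parent_ne (hJ.2 _ (not_le.1 hcon) J.subset_parent)
  have h2 : J.parent.elen = 2 * J.elen := by
    rw [elen, parent_length, ENNReal.ofReal_mul (by norm_num), elen]; norm_num
  rw [avg, ENNReal.div_le_iff J.parent.elen_ne_zero J.parent.elen_ne_top, h2] at h1
  rw [avg, ENNReal.div_le_iff J.elen_ne_zero J.elen_ne_top]
  calc ∫⁻ y in J.ico, f y ≤ ∫⁻ y in J.parent.ico, f y := lintegral_mono_set J.subset_parent
    _ ≤ a * (2 * J.elen) := h1
    _ = _ := by ring

end Stopping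

/-! ### Atoms -/

/-- Outside the shadow of `J`, the coefficients of a function of mean zero on `J` are summable. -/
lemma IsWavelet.tsum_atom_le {D : ℝ≥0} {φ : DyadicInterval → ℝ → ℂ} (h : IsWavelet D φ) (n : ℤ)
    (J : DyadicInterval) {b : ℝ → ℂ} (hb : IntegrableOn b J.ico) (hb0 : ∫ y in J.ico, b y = 0) :
    ∑' I : DyadicInterval, ({I : DyadicInterval | ¬ I.ico ⊆ shadow n J}.indicator
      (fun I => ‖∫ y in J.ico, b y * starRingEnd ℂ (φ (I.shift n) y)‖ₑ) I) ≤
      40 * D * rhoSum * ∫⁻ y in J.ico, ‖b y‖ₑ := by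
  have hJ := J.length_pos
  set X := ∫⁻ y in J.ico, ‖b y‖ₑ with hX
  set G : DyadicInterval → ℝ≥0∞ := {I : DyadicInterval | ¬ I.ico ⊆ shadow n J}.indicator
    (fun I => ‖∫ y in J.ico, b y * starRingEnd ℂ (φ (I.shift n) y)‖ₑ) with hG
  have hbm : AEMeasurable (fun y => ‖b y‖ₑ) (volume.restrict J.ico) :=
    hb.aestronglyMeasurable.enorm
  have hlen1 : ∀ (d : ℕ) (m : ℤ),
      (⟨J.scale + d, m⟩ : DyadicInterval).length = 2 ^ d * J.length := by
    intro d m; simp only [length]; rw [zpow_add₀ two_ne_zero, zpow_natCast, mul_comm]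
  have hlen2 : ∀ (d : ℕ) (m : ℤ),
      (⟨J.scale - d, m⟩ : DyadicInterval).length = J.length / 2 ^ d := by
    intro d m; simp only [length]; rw [zpow_sub₀ two_ne_zero, zpow_natCast]
  have hpow : ∀ d : ℕ, ENNReal.ofReal ((2 ^ d)⁻¹) = (2 ^ d)⁻¹ := by
    intro d
    rw [ENNReal.ofReal_inv_of_pos (by positivity), ENNReal.ofReal_pow (by norm_num)]; norm_num
  have hsum : ∀ (k : ℤ) (c : ℝ≥0∞), c ≠ ⊤ → ∑' m : ℤ, ∫⁻ y in J.ico,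
      c * (‖b y‖ₑ * ((⟨k, m⟩ : DyadicInterval).shift n).decay y ^ 2) ≤
      c * (X * (4 * rhoSum)) := by
    intro k c hc
    rw [← lintegral_tsum fun m => by fun_prop]
    simp_rw [ENNReal.tsum_mul_left]
    rw [lintegral_const_mul' _ _ hc, hX]
    refine mul_le_mul_right ?_ _
    rw [← lintegral_mul_const' _ _ (ENNReal.mul_ne_top (by norm_num) rhoSum_ne_top)]
    refine lintegral_mono fun y => mul_le_mul_right ?_ _
    refine le_trans (le_of_eq ?_) (tsum_decay_sq_le k y)
    exact (Equiv.subRight n).tsum_eq fun m => (⟨k, m⟩ : DyadicInterval).decay y ^ 2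
  -- Long intervals: b has mean zero on J, so φ may be replaced by its oscillation on J, which is
  -- O(2^(-d)). Being outside the shadow is not needed.
  have A : ∀ d : ℕ, ∑' m : ℤ, G ⟨J.scale + d, m⟩ ≤
      (4 * D * (X * (4 * rhoSum))) * (2 ^ d)⁻¹ := by
    intro d
    refine le_trans (ENNReal.tsum_le_tsum fun m => ?_)
      ((hsum (J.scale + d) (4 * D * (2 ^ d)⁻¹)
        (ENNReal.mul_ne_top (ENNReal.mul_ne_top (by norm_num) (by simp)) (by simp))).trans
        (le_of_eq (by ring)))
    refine (Set.indicator_le_self _ _ _).trans ?_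
    set I' := (⟨J.scale + d, m⟩ : DyadicInterval).shift n with hI'
    have hI'l : I'.length = 2 ^ d * J.length := hlen1 d m
    have hI'p := I'.length_pos
    have e : ∫ y in J.ico, b y * starRingEnd ℂ (φ I' y) =
        ∫ y in J.ico, b y * starRingEnd ℂ (φ I' y - φ I' J.left) := by
      simp_rw [map_sub, mul_sub]
      rw [integral_sub, integral_mul_const, hb0, zero_mul, sub_zero]
      · have := (h.memLp_conj I' (r := ⊤) le_top).restrict J.ico
        exact (memLp_one_iff_integrable.2 hb).integrable_mul this
      · exact hb.mul_const _
    rw [e]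
    refine (enorm_integral_le_lintegral_enorm _).trans ?_
    refine setLIntegral_mono' J.measurableSet_ico fun y hy => ?_
    rw [enorm_mul, RCLike.enorm_conj, ← enorm_neg (φ I' y - _), neg_sub]
    have h1 : |J.left - y| / I'.length ≤ (2 ^ d)⁻¹ := by
      rw [hI'l, div_le_iff₀ (by positivity), inv_mul_cancel_left₀ (by positivity), abs_le]
      constructor <;> linarith [hy.1, hy.2]
    have h2 : (1 : ℝ) + |J.left - y| / I'.length ≤ 2 := by
      have : ((2 : ℝ) ^ d)⁻¹ ≤ 1 := inv_le_one_of_one_le₀ (one_le_pow₀ (by norm_num))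
      linarith
    have h3 : ENNReal.ofReal (|J.left - y| / I'.length) ≤ (2 ^ d)⁻¹ := by
      rw [← hpow]; exact ENNReal.ofReal_le_ofReal h1
    have h4 : ENNReal.ofReal (1 + |J.left - y| / I'.length) ≤ 2 := by
      rw [show (2 : ℝ≥0∞) = ENNReal.ofReal 2 by norm_num]; exact ENNReal.ofReal_le_ofReal h2
    calc ‖b y‖ₑ * ‖φ I' J.left - φ I' y‖ₑ
        ≤ ‖b y‖ₑ * (D * ((2 ^ d)⁻¹ * 2 ^ 2) * I'.decay y ^ 2) := by
          gcongr
          refine (h.enorm_sub_le I' J.left y).trans ?_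
          gcongr
      _ = _ := by ring
  -- Short intervals: an I that leaves the shadow has its shift I_n at distance at least |J| = 2^d
  -- |I| from J, measured from the left endpoint of I_n, so one power of the decay gives 2^(-d)
  -- without cancellation.
  have B : ∀ d : ℕ, ∑' m : ℤ, G ⟨J.scale - d, m⟩ ≤
      (D * (X * (4 * rhoSum))) * (2 ^ d)⁻¹ := by
    intro d
    refine le_trans (ENNReal.tsum_le_tsum fun m => ?_)
      ((hsum (J.scale - d) (D * (2 ^ d)⁻¹) (ENNReal.mul_ne_top (by simp) (by simp))).trans
        (le_of_eq (by ring)))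
    set I : DyadicInterval := ⟨J.scale - d, m⟩ with hI
    by_cases hsub : I.ico ⊆ shadow n J
    · rw [hG, Set.indicator_of_notMem (by simpa using hsub)]; exact zero_le
    rw [hG, Set.indicator_of_mem (by exact hsub)]
    have hIl : I.length = J.length / 2 ^ d := hlen2 d m
    have hIp := I.length_pos
    have hIJ : I.length ≤ J.length := by
      rw [hIl]; exact div_le_self hJ.le (one_le_pow₀ (by norm_num))
    obtain ⟨x, hxI, hx⟩ := Set.not_subset.1 hsub
    have hx' : 4 * J.length < |x - (J.left + n / 2 ^ d * J.length)| := by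
      by_contra hcon
      refine hx (Set.mem_iUnion.2 ⟨d, ?_⟩)
      rw [Metric.mem_closedBall, Real.dist_eq]; exact not_lt.1 hcon
    have hdec : ∀ y ∈ J.ico, (I.shift n).decay y ≤ (2 ^ d)⁻¹ := by
      intro y hy
      have e : (2 : ℝ≥0∞) ^ d = ENNReal.ofReal (2 ^ d) := by
        rw [ENNReal.ofReal_pow (by norm_num)]; norm_num
      rw [e]
      refine decay_le_of_le (by positivity) ?_
      rw [shift_left, shift_length]
      have h1 : J.length ≤ |y - (I.left - n * I.length)| := by
        have e : x - (J.left + n / 2 ^ d * J.length) =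
            ((x - I.left) + (y - J.left)) + -(y - (I.left - n * I.length)) := by
          rw [hIl]; ring
        have h2 : |x - (J.left + n / 2 ^ d * J.length)| ≤
            (J.length + J.length) + |y - (I.left - n * I.length)| := by
          rw [e]
          refine (abs_add_le _ _).trans ?_
          rw [abs_neg]
          gcongr
          refine (abs_add_le _ _).trans ?_
          gcongr
          · rw [abs_le]; constructor <;> linarith [hxI.1, hxI.2]
          · rw [abs_le]; constructor <;> linarith [hy.1, hy.2]
        linarith
      have h3 : (2 : ℝ) ^ d ≤ |y - (I.left - n * I.length)| / I.length := by
        have h4 : (2 : ℝ) ^ d * I.length = J.length := by rw [hIl]; field_simp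
        rw [le_div_iff₀ hIp, h4]
        exact h1
      linarith
    refine (enorm_integral_le_lintegral_enorm _).trans ?_
    refine setLIntegral_mono' J.measurableSet_ico fun y hy => ?_
    rw [enorm_mul, RCLike.enorm_conj]
    calc ‖b y‖ₑ * ‖φ (I.shift n) y‖ₑ
        ≤ ‖b y‖ₑ * (D * ((I.shift n).decay y * (I.shift n).decay y ^ 2)) := by
          gcongr
          refine (h.enorm_le_of_le _ y (e := 3) (by norm_num)).trans (le_of_eq ?_)
          ring
      _ ≤ ‖b y‖ₑ * (D * ((2 ^ d)⁻¹ * (I.shift n).decay y ^ 2)) := by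
          gcongr; exact hdec y hy
      _ = _ := by ring
  refine (tsum_le_tsum_scales _ J.scale).trans ?_
  refine (add_le_add (ENNReal.tsum_le_tsum A) (ENNReal.tsum_le_tsum B)).trans (le_of_eq ?_)
  rw [ENNReal.tsum_mul_left, ENNReal.tsum_mul_left, tsum_inv_two_pow]
  ring

/-! ### Exponents below two -/

lemma tsum_sq_le_sq_tsum {ι : Type*} (x : ι → ℝ≥0∞) : ∑' i, x i ^ 2 ≤ (∑' i, x i) ^ 2 := by
  calc ∑' i, x i ^ 2 ≤ ∑' i, x i * ∑' j, x j := by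
        refine ENNReal.tsum_le_tsum fun i => ?_
        rw [sq]
        exact mul_le_mul_right (ENNReal.le_tsum i) _
    _ = _ := by rw [ENNReal.tsum_mul_right, sq]

/-- Each term on the left is the square of the one on the right, and an ℓ¹ norm dominates the ℓ²
norm. The bad part can thus be summed absolutely. -/
lemma dyadicSum_coeff_le_sq (φ : DyadicInterval → ℝ → ℂ) (n : ℤ) (b : ℝ → ℂ) (x : ℝ) :
    dyadicSum (coeff φ n b) x ≤ dyadicSum (fun I => ‖pairing b (φ (I.shift n))‖ₑ) x ^ 2 := by
  refine le_trans (le_of_eq (tsum_congr fun I => ?_)) (tsum_sq_le_sq_tsum _)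
  by_cases hx : x ∈ I.ico
  · simp only [Set.indicator_of_mem hx, coeff, div_eq_mul_inv]; ring
  · simp [Set.indicator_of_notMem hx]

lemma dyadicSum_coeff_add_le {D : ℝ≥0} {φ : DyadicInterval → ℝ → ℂ} (h : IsWavelet D φ) (n : ℤ)
    {p₁ p₂ : ℝ≥0∞} (hp₁ : 1 ≤ p₁) (hp₂ : 1 ≤ p₂) {g₁ g₂ : ℝ → ℂ} (hg₁ : MemLp g₁ p₁)
    (hg₂ : MemLp g₂ p₂) (x : ℝ) :
    dyadicSum (coeff φ n fun x => g₁ x + g₂ x) x ≤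
      2 * dyadicSum (coeff φ n g₁) x + 2 * dyadicSum (coeff φ n g₂) x := by
  unfold dyadicSum
  rw [← ENNReal.tsum_mul_left, ← ENNReal.tsum_mul_left, ← ENNReal.tsum_add]
  refine ENNReal.tsum_le_tsum fun I => ?_
  by_cases hx : x ∈ I.ico
  · simp only [Set.indicator_of_mem hx]
    rw [← mul_div_assoc, ← mul_div_assoc, ← ENNReal.add_div]
    exact ENNReal.div_le_div_right (coeff_add_le h n hp₁ hp₂ hg₁ hg₂ I) _
  · simp [Set.indicator_of_notMem hx]

/-- The contribution of a sum of atoms, away from the shadows of their supports. -/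
lemma IsWavelet.setLIntegral_dyadicSum_atoms_le {D : ℝ≥0} {φ : DyadicInterval → ℝ → ℂ}
    (h : IsWavelet D φ) (n : ℤ) {P : DyadicInterval → Prop} {b : ℝ → ℂ} (hb : Integrable b)
    (hb0 : ∀ J, IsMaximal P J → ∫ y in J.ico, b y = 0)
    (hsupp : ∀ x, x ∉ ⋃ J : {J // IsMaximal P J}, J.1.ico → b x = 0) :
    ∫⁻ x in (⋃ J : {J // IsMaximal P J}, shadow n J.1)ᶜ,
      dyadicSum (fun I => ‖pairing b (φ (I.shift n))‖ₑ) x ≤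
      40 * D * rhoSum * ∫⁻ x, ‖b x‖ₑ := by
  set E := ⋃ J : {J // IsMaximal P J}, shadow n J.1 with hE
  set β : {J // IsMaximal P J} → DyadicInterval → ℝ≥0∞ := fun J I =>
    ‖∫ y in J.1.ico, b y * starRingEnd ℂ (φ (I.shift n) y)‖ₑ with hβ
  have hpair : ∀ I : DyadicInterval, ‖pairing b (φ (I.shift n))‖ₑ ≤ ∑' J, β J I := by
    intro I
    have hint : Integrable fun y => b y * starRingEnd ℂ (φ (I.shift n) y) :=
      h.integrable_mul _ le_rfl (memLp_one_iff_integrable.2 hb)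
    have e : pairing b (φ (I.shift n)) = ∑' J : {J // IsMaximal P J},
        ∫ y in J.1.ico, b y * starRingEnd ℂ (φ (I.shift n) y) := by
      rw [← integral_iUnion (fun J => J.1.measurableSet_ico) (IsMaximal.pairwise_disjoint P)
        hint.integrableOn, setIntegral_eq_integral_of_forall_compl_eq_zero]
      · rfl
      · intro x hx; rw [hsupp x hx, zero_mul]
    rw [e]
    exact enorm_tsum_le_tsum_enorm
  have hvol : ∀ I : DyadicInterval, ∀ J : {J // IsMaximal P J},
      β J I / I.elen * volume (Eᶜ ∩ I.ico) ≤
        ({I : DyadicInterval | ¬ I.ico ⊆ shadow n J.1}.indicator (β J) I) := by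
    intro I J
    by_cases hsub : I.ico ⊆ shadow n J.1
    · have : Eᶜ ∩ I.ico = ∅ := by
        rw [← Set.disjoint_iff_inter_eq_empty, Set.disjoint_compl_left_iff_subset]
        exact hsub.trans (Set.subset_iUnion (fun J : {J // IsMaximal P J} => shadow n J.1) J)
      rw [this, measure_empty, mul_zero]; exact zero_le
    · rw [Set.indicator_of_mem (by exact hsub)]
      calc β J I / I.elen * volume (Eᶜ ∩ I.ico) ≤ β J I / I.elen * I.elen := by
            gcongr
            rw [← volume_ico]
            exact measure_mono Set.inter_subset_right
        _ = _ := ENNReal.div_mul_cancel I.elen_ne_zero I.elen_ne_top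
  calc ∫⁻ x in Eᶜ, dyadicSum (fun I => ‖pairing b (φ (I.shift n))‖ₑ) x
      = ∑' I : DyadicInterval, ‖pairing b (φ (I.shift n))‖ₑ / I.elen * volume (Eᶜ ∩ I.ico) := by
        unfold dyadicSum
        rw [lintegral_tsum fun I =>
          (measurable_const.indicator I.measurableSet_ico).aemeasurable]
        refine tsum_congr fun I => ?_
        rw [lintegral_indicator_const I.measurableSet_ico,
          Measure.restrict_apply I.measurableSet_ico, Set.inter_comm]
    _ ≤ ∑' I : DyadicInterval, ∑' J : {J // IsMaximal P J},
          ({I : DyadicInterval | ¬ I.ico ⊆ shadow n J.1}.indicator (β J) I) := by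
        refine ENNReal.tsum_le_tsum fun I => ?_
        refine le_trans ?_ (ENNReal.tsum_le_tsum fun J => hvol I J)
        simp_rw [div_eq_mul_inv, mul_assoc]
        rw [ENNReal.tsum_mul_right]
        gcongr
        exact hpair I
    _ = ∑' J : {J // IsMaximal P J}, ∑' I : DyadicInterval,
          ({I : DyadicInterval | ¬ I.ico ⊆ shadow n J.1}.indicator (β J) I) := ENNReal.tsum_comm
    _ ≤ ∑' J : {J // IsMaximal P J}, 40 * D * rhoSum * ∫⁻ y in J.1.ico, ‖b y‖ₑ :=
        ENNReal.tsum_le_tsum fun J => h.tsum_atom_le n J.1 hb.integrableOn (hb0 J.1 J.2)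
    _ = 40 * D * rhoSum * ∫⁻ y in ⋃ J : {J // IsMaximal P J}, J.1.ico, ‖b y‖ₑ := by
        rw [ENNReal.tsum_mul_left, lintegral_iUnion (fun J => J.1.measurableSet_ico)
          (IsMaximal.pairwise_disjoint P)]
    _ ≤ _ := mul_le_mul_right (setLIntegral_le_lintegral _ _) _

/-- The distributional estimate behind the bounds for exponents below two. -/
lemma exists_mul_volume_dyadicSum_le (D : ℝ≥0) :
    ∃ K : ℝ≥0∞, K ≠ ⊤ ∧ ∀ φ, IsWavelet D φ → ∀ g : ℝ → ℂ,
      StronglyMeasurable g → ∀ (n : ℤ) (a : ℝ≥0∞), a ≠ 0 → a ≠ ⊤ →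
        a ^ 2 * volume {x | 4 * a ^ 2 < dyadicSum (coeff φ n g) x} ≤ K *
          (ell n * a ^ 2 * volume {x | a < shiftMax 0 (fun y => ‖g y‖ₑ) x} +
            ∫⁻ x in {x | shiftMax 0 (fun y => ‖g y‖ₑ) x ≤ a}, ‖g x‖ₑ ^ 2) := by
  obtain ⟨B, hB1, hB⟩ := exists_tsum_pairing_le D
  set K₀ : ℝ≥0∞ := 72 + (8 * B + 2 * (160 * D * rhoSum)) with hK₀
  have hK₀t : K₀ ≠ ⊤ := by
    refine ENNReal.add_ne_top.2 ⟨by norm_num, ENNReal.add_ne_top.2 ⟨?_, ?_⟩⟩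
    · exact ENNReal.mul_ne_top (by norm_num) (by simp)
    · exact ENNReal.mul_ne_top (by norm_num) (ENNReal.mul_ne_top
        (ENNReal.mul_ne_top (by norm_num) (by simp)) rhoSum_ne_top)
  have hB1' : (1 : ℝ≥0∞) ≤ B := by exact_mod_cast hB1
  have hK₀B : (B : ℝ≥0∞) ≤ K₀ := by
    calc (B : ℝ≥0∞) ≤ 8 * B := le_mul_of_one_le_left' (by norm_num)
      _ ≤ _ := le_self_add
      _ ≤ _ := le_add_self
  have hK₀0 : K₀ ≠ 0 := (lt_of_lt_of_le one_pos (hB1'.trans hK₀B)).ne'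
  refine ⟨K₀, hK₀t, fun φ h g hg n a ha0 hat => ?_⟩
  set f : ℝ → ℝ≥0∞ := fun y => ‖g y‖ₑ with hf
  set Ω : Set ℝ := {x | a < shiftMax 0 f x} with hΩ
  have hΩc : {x | shiftMax 0 f x ≤ a} = Ωᶜ := by
    ext x; simp [hΩ]
  rw [hΩc]
  have ha2 : a ^ 2 ≠ 0 := pow_ne_zero 2 ha0
  by_cases hvol : volume Ω = ⊤
  · rw [hvol, ENNReal.mul_top (mul_ne_zero (ell_ne_zero n) ha2), top_add,
      ENNReal.mul_top hK₀0]
    exact le_top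
  by_cases hint : ∫⁻ x in Ωᶜ, f x ^ 2 = ⊤
  · rw [hint, add_top, ENNReal.mul_top hK₀0]; exact le_top
  have hΩm : MeasurableSet Ω := measurableSet_lt measurable_const (measurable_shiftMax 0 f)
  set P : DyadicInterval → Prop := fun K => a < avg K f with hP
  have hΩU : ⋃ J : {J // IsMaximal P J}, J.1.ico = Ω := iUnion_isMaximal_eq hvol
  have hsum : ∑' J : {J // IsMaximal P J}, J.1.elen = volume Ω := tsum_elen_isMaximal hvol
  set u := goodPart P g with hu
  have hum : AEStronglyMeasurable u := aestronglyMeasurable_goodPart P hg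
  have hu_in : ∀ x ∈ Ω, ‖u x‖ₑ ≤ 2 * a := by
    intro x hx
    rw [← hΩU] at hx
    obtain ⟨J, hxJ⟩ := Set.mem_iUnion.1 hx
    rw [hu, goodPart_of_mem J.2 g hxJ]
    exact (enorm_setAverage_le J.1 g).trans (avg_le_of_isMaximal J.2)
  have hu_out : ∀ x ∉ Ω, u x = g x := fun x hx => goodPart_of_notMem g (by rwa [hΩU])
  have hu2 : ∫⁻ x, ‖u x‖ₑ ^ 2 ≤ 4 * a ^ 2 * volume Ω + ∫⁻ x in Ωᶜ, f x ^ 2 := by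
    rw [← lintegral_add_compl _ hΩm]
    refine add_le_add ?_ (le_of_eq (setLIntegral_congr_fun hΩm.compl fun x hx => ?_))
    · calc ∫⁻ x in Ω, ‖u x‖ₑ ^ 2 ≤ ∫⁻ _ in Ω, (2 * a) ^ 2 :=
            setLIntegral_mono' hΩm fun x hx => pow_le_pow_left' (hu_in x hx) 2
        _ = _ := by rw [setLIntegral_const]; ring
    · simp only [hu_out x hx, hf]
  have humem : MemLp u 2 := by
    refine ⟨hum, ?_⟩
    rw [eLpNorm_lt_top_iff_lintegral_rpow_enorm_lt_top (by norm_num) (by norm_num)]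
    have : ∫⁻ x, ‖u x‖ₑ ^ 2 < ⊤ := lt_of_le_of_lt hu2 (ENNReal.add_lt_top.2
      ⟨ENNReal.mul_lt_top (ENNReal.mul_lt_top (by norm_num) (ENNReal.pow_lt_top hat.lt_top))
        (lt_top_iff_ne_top.2 hvol), lt_top_iff_ne_top.2 hint⟩)
    simpa using this
  set b : ℝ → ℂ := fun x => g x - u x with hb
  have hbm : AEStronglyMeasurable b := hg.aestronglyMeasurable.sub hum
  have hb_out : ∀ x ∉ Ω, b x = 0 := by
    intro x hx; simp only [hb, hu_out x hx, sub_self]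
  have hf1 : ∀ J, IsMaximal P J → ∫⁻ y in J.ico, f y ≤ 2 * a * J.elen := by
    intro J hJ
    have := avg_le_of_isMaximal hJ
    rwa [avg, ENNReal.div_le_iff J.elen_ne_zero J.elen_ne_top] at this
  have hb1 : ∫⁻ x, ‖b x‖ₑ ≤ 4 * a * volume Ω := by
    have e : ∫⁻ x, ‖b x‖ₑ = ∫⁻ x in Ω, ‖b x‖ₑ := by
      rw [← lintegral_add_compl _ hΩm, setLIntegral_congr_fun (g := fun _ => 0) hΩm.compl
        fun x hx => by simp [hb_out x hx]]
      simp
    rw [e, ← hΩU, lintegral_iUnion (fun J => J.1.measurableSet_ico)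
      (IsMaximal.pairwise_disjoint P), hΩU, ← hsum, ← ENNReal.tsum_mul_left]
    refine ENNReal.tsum_le_tsum fun J => ?_
    calc ∫⁻ x in J.1.ico, ‖b x‖ₑ ≤ ∫⁻ x in J.1.ico, (f x + 2 * a) := by
          refine setLIntegral_mono' J.1.measurableSet_ico fun x hx => ?_
          refine (enorm_sub_le).trans ?_
          gcongr
          exact hu_in x (by rw [← hΩU]; exact Set.mem_iUnion.2 ⟨J, hx⟩)
      _ = (∫⁻ x in J.1.ico, f x) + 2 * a * J.1.elen := by
          rw [lintegral_add_right _ measurable_const, setLIntegral_const, volume_ico]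
      _ ≤ 2 * a * J.1.elen + 2 * a * J.1.elen := by gcongr; exact hf1 J.1 J.2
      _ = _ := by ring
  have hbint : Integrable b := ⟨hbm, lt_of_le_of_lt hb1
    (ENNReal.mul_lt_top (ENNReal.mul_lt_top (by norm_num) hat.lt_top) (lt_top_iff_ne_top.2 hvol))⟩
  -- On a stopping interval b is g minus its mean there.
  have hb0 : ∀ J, IsMaximal P J → ∫ y in J.ico, b y = 0 := by
    intro J hJ
    rw [setIntegral_congr_fun (g := fun y => g y - ⨍ z in J.ico, g z) J.measurableSet_ico
      fun y hy => by simp only [hb, hu, goodPart_of_mem hJ g hy]]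
    have : IsFiniteMeasure (volume.restrict J.ico) := ⟨by
      rw [Measure.restrict_apply_univ, volume_ico]; exact J.elen_ne_top.lt_top⟩
    exact integral_sub_average _ _
  set s : ℝ → ℝ≥0∞ := dyadicSum fun I => ‖pairing b (φ (I.shift n))‖ₑ with hs
  have hsm : Measurable s := measurable_dyadicSum _
  set E := ⋃ J : {J // IsMaximal P J}, shadow n J.1 with hE
  -- The logarithm originates here alone; in the other terms it appears only through 1 ≤ 2 `ell n`.
  have hEvol : volume E ≤ 72 * ell n * volume Ω := by
    rw [← hsum, ← ENNReal.tsum_mul_left]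
    exact (measure_iUnion_le _).trans (ENNReal.tsum_le_tsum fun J => volume_shadow_le n J.1)
  have hs1 : a * volume ({x | a < s x} \ E) ≤ 160 * D * rhoSum * (a * volume Ω) := by
    calc a * volume ({x | a < s x} \ E)
        ≤ a * (volume.restrict Eᶜ) {x | a ≤ s x} := by
          refine mul_le_mul_right ?_ _
          rw [Measure.restrict_apply (measurableSet_le measurable_const hsm)]
          exact measure_mono fun x hx => ⟨le_of_lt (show a < s x from hx.1), hx.2⟩
      _ ≤ ∫⁻ x in Eᶜ, s x := mul_meas_ge_le_lintegral hsm _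
      _ ≤ 40 * D * rhoSum * ∫⁻ x, ‖b x‖ₑ :=
          h.setLIntegral_dyadicSum_atoms_le n hbint hb0 fun x hx => hb_out x (by rwa [hΩU] at hx)
      _ ≤ 40 * D * rhoSum * (4 * a * volume Ω) := by gcongr
      _ = _ := by ring
  have hs2 : volume {x | a < s x} ≤ 72 * ell n * volume Ω + 160 * D * rhoSum * volume Ω := by
    have h1 : volume ({x | a < s x} \ E) ≤ 160 * D * rhoSum * volume Ω := by
      rw [mul_left_comm] at hs1
      exact (ENNReal.mul_le_mul_iff_right ha0 hat).1 hs1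
    calc volume {x | a < s x} ≤ volume (E ∪ ({x | a < s x} \ E)) :=
          measure_mono (by rw [Set.union_sdiff_self]; exact Set.subset_union_right)
      _ ≤ _ := (measure_union_le _ _).trans (add_le_add hEvol h1)
  have hF1 : a ^ 2 * volume {x | a ^ 2 < dyadicSum (coeff φ n u) x} ≤
      B * (4 * a ^ 2 * volume Ω + ∫⁻ x in Ωᶜ, f x ^ 2) := by
    calc a ^ 2 * volume {x | a ^ 2 < dyadicSum (coeff φ n u) x}
        ≤ a ^ 2 * volume {x | a ^ 2 ≤ dyadicSum (coeff φ n u) x} := by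
          gcongr with x; exact fun hx => le_of_lt hx
      _ ≤ ∫⁻ x, dyadicSum (coeff φ n u) x := mul_meas_ge_le_lintegral (measurable_dyadicSum _) _
      _ ≤ B * ∫⁻ x, ‖u x‖ₑ ^ 2 := by
          rw [lintegral_dyadicSum, tsum_coeff]; exact hB φ h u hum
      _ ≤ _ := by gcongr
  -- The height 4a² is 2a² + 2a²: for a sum of two functions the quadratic expression at most
  -- doubles each contribution.
  have hcover : {x | 4 * a ^ 2 < dyadicSum (coeff φ n g) x} ⊆
      {x | a ^ 2 < dyadicSum (coeff φ n u) x} ∪ {x | a < s x} := by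
    intro x (hx : 4 * a ^ 2 < dyadicSum (coeff φ n g) x)
    by_contra hcon
    rw [Set.mem_union, not_or] at hcon
    have h1 : dyadicSum (coeff φ n u) x ≤ a ^ 2 := not_lt.1 hcon.1
    have h2 : s x ≤ a := not_lt.1 hcon.2
    have e : g = fun x => u x + b x := by ext x; simp [hb]
    have h3 := dyadicSum_coeff_add_le h n (by norm_num) le_rfl humem
      (memLp_one_iff_integrable.2 hbint) x
    rw [← e] at h3
    refine absurd hx (not_lt.2 (h3.trans ?_))
    calc _ ≤ 2 * a ^ 2 + 2 * a ^ 2 := by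
          gcongr
          exact (dyadicSum_coeff_le_sq φ n b x).trans (pow_le_pow_left' h2 2)
      _ = _ := by ring
  have hell := one_le_two_mul_ell n
  calc a ^ 2 * volume {x | 4 * a ^ 2 < dyadicSum (coeff φ n g) x}
      ≤ a ^ 2 * volume {x | a ^ 2 < dyadicSum (coeff φ n u) x} + a ^ 2 * volume {x | a < s x} := by
        rw [← mul_add]
        gcongr
        exact (measure_mono hcover).trans (measure_union_le _ _)
    _ ≤ B * (4 * a ^ 2 * volume Ω + ∫⁻ x in Ωᶜ, f x ^ 2) +
          a ^ 2 * (72 * ell n * volume Ω + 160 * D * rhoSum * volume Ω) := by gcongr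
    _ = (72 * ell n + (4 * B + 160 * D * rhoSum) * 1) * (a ^ 2 * volume Ω) +
          B * ∫⁻ x in Ωᶜ, f x ^ 2 := by ring
    _ ≤ (72 * ell n + (4 * B + 160 * D * rhoSum) * (2 * ell n)) * (a ^ 2 * volume Ω) +
          K₀ * ∫⁻ x in Ωᶜ, f x ^ 2 := by gcongr
    _ = _ := by rw [hK₀]; ring

/-- The integral over t ≥ M of t^(q-3) is M^(q-2)/(2-q), convergent because q < 2, and u² ≤ M². When
M = 0 the integral diverges, but then u = 0. -/
lemma sq_mul_lintegral_Ioi_le {q : ℝ} (hq2 : q < 2) {u M : ℝ≥0∞} (huM : u ≤ M) :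
    u ^ 2 * ∫⁻ t in Set.Ioi (0 : ℝ), (if M ≤ ENNReal.ofReal t then
      ENNReal.ofReal (t ^ (-(2 - q) - 1)) else 0) ≤ M ^ q / ENNReal.ofReal (2 - q) := by
  rcases eq_or_ne M 0 with hM0 | hM0
  · have : u = 0 := le_antisymm (huM.trans hM0.le) zero_le
    simp [this]
  rcases eq_or_ne M ⊤ with hMt | hMt
  · simp [hMt]
  refine (mul_le_mul' (pow_le_pow_left' huM 2)
    (lintegral_Ioi_rpow_ge (by linarith) hM0)).trans (le_of_eq ?_)
  rw [← mul_div_assoc, ← ENNReal.rpow_natCast, ← ENNReal.rpow_add _ _ hM0 hMt]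
  congr 2
  push_cast; ring

/-- The square function estimate for exponents between one and two. -/
lemma exists_lintegral_dyadicSum_rpow_half_le (D : ℝ≥0) {q : ℝ} (hq : 1 < q) (hq2 : q < 2) :
    ∃ K : ℝ≥0∞, K ≠ ⊤ ∧ ∀ φ, IsWavelet D φ → ∀ g : ℝ → ℂ, StronglyMeasurable g →
      LocallyIntegrable g → ∀ n : ℤ,
        ∫⁻ x, dyadicSum (coeff φ n g) x ^ (q / 2) ≤ K * ell n * ∫⁻ x, ‖g x‖ₑ ^ q := by
  obtain ⟨K₀, hK₀, hK⟩ := exists_mul_volume_dyadicSum_le D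
  obtain ⟨C, hC⟩ := exists_lintegral_shiftMax_rpow_le hq
  have hq0 : 0 < q := by linarith
  have h2q : (2 : ℝ≥0∞) ^ q ≠ ⊤ := ENNReal.rpow_ne_top_of_nonneg hq0.le (by norm_num)
  set c₁ : ℝ≥0∞ := (ENNReal.ofReal q)⁻¹ + 2 * (ENNReal.ofReal (2 - q))⁻¹ with hc₁
  have hc₁t : c₁ ≠ ⊤ := ENNReal.add_ne_top.2 ⟨by simpa using hq0,
    ENNReal.mul_ne_top (by norm_num) (by simpa using hq2)⟩
  refine ⟨2 ^ q * ENNReal.ofReal q * K₀ * c₁ * (C * ell 0), ?_, fun φ h g hg hgl n => ?_⟩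
  · exact ENNReal.mul_ne_top (ENNReal.mul_ne_top (ENNReal.mul_ne_top
      (ENNReal.mul_ne_top h2q ENNReal.ofReal_ne_top) hK₀) hc₁t)
      (ENNReal.mul_ne_top (by simp) (ell_ne_top 0))
  set f : ℝ → ℝ≥0∞ := fun x => ‖g x‖ₑ with hf
  have hfm : Measurable f := hg.enorm
  set M := shiftMax 0 f with hM
  have hMm : Measurable M := measurable_shiftMax 0 f
  set F := dyadicSum (coeff φ n g) with hF
  have hFm : Measurable F := measurable_dyadicSum _
  -- The halved square function exceeds t exactly where F exceeds 4t², the height in the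
  -- distributional estimate.
  set u : ℝ → ℝ≥0∞ := fun x => F x ^ (1 / 2 : ℝ) / 2 with hu
  have hum : Measurable u := (hFm.pow_const _).div_const 2
  have e1 : ∀ x, F x ^ (q / 2) = 2 ^ q * u x ^ q := by
    intro x
    rw [← ENNReal.mul_rpow_of_nonneg _ _ hq0.le, hu,
      ENNReal.mul_div_cancel (by norm_num) (by norm_num), ← ENNReal.rpow_mul]
    congr 1; ring
  have e2 : ∀ (t : ℝ) (x : ℝ), ENNReal.ofReal t < u x ↔ 4 * ENNReal.ofReal t ^ 2 < F x := by
    intro t x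
    have h1 : F x = (F x ^ (1 / 2 : ℝ)) ^ 2 := by
      rw [← ENNReal.rpow_natCast, ← ENNReal.rpow_mul]; norm_num
    have h2 : 4 * ENNReal.ofReal t ^ 2 = (ENNReal.ofReal t * 2) ^ 2 := by
      rw [mul_pow, mul_comm]; norm_num
    rw [hu, ENNReal.lt_div_iff_mul_lt (by simp) (by simp), h2]
    conv_rhs => rw [h1]
    exact (ENNReal.pow_right_strictMono two_ne_zero).lt_iff_lt.symm
  have hpt : ∀ t : ℝ, 0 < t → ENNReal.ofReal (t ^ (q - 1)) * volume {x | ENNReal.ofReal t < u x} ≤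
      K₀ * (ell n * (ENNReal.ofReal (t ^ (q - 1)) * volume {x | ENNReal.ofReal t < M x}) +
        ∫⁻ x, f x ^ 2 * (if M x ≤ ENNReal.ofReal t then
          ENNReal.ofReal (t ^ (-(2 - q) - 1)) else 0)) := by
    intro t ht
    have e3 : ENNReal.ofReal (t ^ (q - 1)) =
        ENNReal.ofReal (t ^ (-(2 - q) - 1)) * ENNReal.ofReal t ^ 2 := by
      rw [← ENNReal.ofReal_pow ht.le, ← ENNReal.ofReal_mul (by positivity)]
      congr 1
      rw [← Real.rpow_natCast, ← Real.rpow_add ht]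
      congr 1; push_cast; ring
    have key := hK φ h g hg n (ENNReal.ofReal t) (by simpa using ht) ENNReal.ofReal_ne_top
    simp_rw [e2]
    rw [e3, mul_assoc]
    refine (mul_le_mul_right key _).trans (le_of_eq ?_)
    have e4 : ∫⁻ x, f x ^ 2 * (if M x ≤ ENNReal.ofReal t then
        ENNReal.ofReal (t ^ (-(2 - q) - 1)) else 0) =
        ENNReal.ofReal (t ^ (-(2 - q) - 1)) *
          ∫⁻ x in {x | M x ≤ ENNReal.ofReal t}, f x ^ 2 := by
      rw [← lintegral_indicator (measurableSet_le hMm measurable_const),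
        ← lintegral_const_mul' _ _ ENNReal.ofReal_ne_top]
      refine lintegral_congr fun x => ?_
      simp only [Set.indicator_apply, Set.mem_ofPred_eq]
      split_ifs <;> ring
    rw [e4]
    ring
  have hm : Measurable fun z : ℝ × ℝ => f z.2 ^ 2 * (if M z.2 ≤ ENNReal.ofReal z.1 then
      ENNReal.ofReal (z.1 ^ (-(2 - q) - 1)) else 0) :=
    Measurable.mul (by fun_prop)
      (Measurable.ite (measurableSet_le (by fun_prop) (by fun_prop)) (by fun_prop)
        measurable_const)
  have hm1 : Measurable fun t : ℝ =>
      ENNReal.ofReal (t ^ (q - 1)) * volume {x | ENNReal.ofReal t < M x} := by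
    refine Measurable.mul (by fun_prop) ?_
    have : Antitone fun t : ℝ => volume {x | ENNReal.ofReal t < M x} := fun s t hst =>
      measure_mono fun x hx => lt_of_le_of_lt (ENNReal.ofReal_le_ofReal hst) hx
    exact this.measurable
  have hlayer : ∫⁻ t in Set.Ioi (0 : ℝ), ENNReal.ofReal (t ^ (q - 1)) *
      volume {x | ENNReal.ofReal t < M x} = (ENNReal.ofReal q)⁻¹ * ∫⁻ x, M x ^ q := by
    rw [lintegral_rpow_eq_layer hMm hq0, ← mul_assoc,
      ENNReal.inv_mul_cancel (by simpa using hq0) ENNReal.ofReal_ne_top, one_mul]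
  have hlow : ∫⁻ t in Set.Ioi (0 : ℝ), ∫⁻ x, f x ^ 2 * (if M x ≤ ENNReal.ofReal t then
      ENNReal.ofReal (t ^ (-(2 - q) - 1)) else 0) ≤
      (ENNReal.ofReal (2 - q))⁻¹ * ∫⁻ x, M x ^ q := by
    rw [lintegral_lintegral_swap hm.aemeasurable, ← lintegral_const_mul _ (hMm.pow_const q)]
    refine lintegral_mono_ae ?_
    -- Lebesgue differentiation gives |g| ≤ M almost everywhere, so the integral over the heights t
    -- ≥ M(x) is at most M(x)^q/(2-q).
    filter_upwards [ae_enorm_le_shiftMax hgl] with x hx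
    rw [lintegral_const_mul _ (Measurable.ite (measurableSet_le (by fun_prop) (by fun_prop))
      (by fun_prop) measurable_const), ← ENNReal.div_eq_inv_mul]
    exact sq_mul_lintegral_Ioi_le hq2 hx
  have hell := one_le_two_mul_ell n
  calc ∫⁻ x, F x ^ (q / 2) = 2 ^ q * ∫⁻ x, u x ^ q := by
        simp_rw [e1]; rw [lintegral_const_mul' _ _ h2q]
    _ = 2 ^ q * (ENNReal.ofReal q * ∫⁻ t in Set.Ioi (0 : ℝ), ENNReal.ofReal (t ^ (q - 1)) *
          volume {x | ENNReal.ofReal t < u x}) := by rw [lintegral_rpow_eq_layer hum hq0]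
    _ ≤ 2 ^ q * (ENNReal.ofReal q * ∫⁻ t in Set.Ioi (0 : ℝ), K₀ *
          (ell n * (ENNReal.ofReal (t ^ (q - 1)) * volume {x | ENNReal.ofReal t < M x}) +
            ∫⁻ x, f x ^ 2 * (if M x ≤ ENNReal.ofReal t then
              ENNReal.ofReal (t ^ (-(2 - q) - 1)) else 0))) := by
        refine mul_le_mul_right (mul_le_mul_right ?_ _) _
        exact setLIntegral_mono' measurableSet_Ioi fun t ht => hpt t ht
    _ ≤ 2 ^ q * (ENNReal.ofReal q * (K₀ * (ell n * ((ENNReal.ofReal q)⁻¹ * ∫⁻ x, M x ^ q) +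
          (ENNReal.ofReal (2 - q))⁻¹ * ∫⁻ x, M x ^ q))) := by
        rw [lintegral_const_mul' _ _ hK₀, lintegral_add_left (hm1.const_mul _),
          lintegral_const_mul _ hm1, hlayer]
        gcongr
    _ = 2 ^ q * (ENNReal.ofReal q * (K₀ * ((ell n * (ENNReal.ofReal q)⁻¹ +
          1 * (ENNReal.ofReal (2 - q))⁻¹) * ∫⁻ x, M x ^ q))) := by ring
    _ ≤ 2 ^ q * (ENNReal.ofReal q * (K₀ * ((ell n * (ENNReal.ofReal q)⁻¹ +
          2 * ell n * (ENNReal.ofReal (2 - q))⁻¹) * (C * ell 0 * ∫⁻ x, f x ^ q)))) := by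
        gcongr
        exact hC 0 f hfm
    _ = _ := by rw [hc₁]; ring

/-! ### All exponents -/

/-- The square function estimate for all exponents `1 < p < ∞`. -/
lemma exists_lintegral_dyadicSum_rpow_le_of_memLp (D : ℝ≥0) {p : ℝ≥0∞} (hp : 1 < p) (hpt : p ≠ ⊤) :
    ∃ K : ℝ≥0∞, K ≠ ⊤ ∧ ∀ φ, IsWavelet D φ → ∀ g : ℝ → ℂ, StronglyMeasurable g → MemLp g p →
      ∀ n : ℤ, ∫⁻ x, dyadicSum (coeff φ n g) x ^ (p.toReal / 2) ≤
        (K * ell n) ^ p.toReal * ∫⁻ x, ‖g x‖ₑ ^ p.toReal := by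
  set q := p.toReal with hq
  have hq1 : 1 < q := by
    rw [hq, ← ENNReal.toReal_one]
    exact (ENNReal.toReal_lt_toReal ENNReal.one_ne_top hpt).2 hp
  have hq0 : 0 < q := by linarith
  -- For q ≤ 2 the constant bounds a q-th power integral directly. The factor 2(K+1) makes the base
  -- at least 1, so raising it to the power q only weakens the bound.
  have hroot : ∀ (K : ℝ≥0∞) (n : ℤ), K * ell n ≤ ((2 * (K + 1)) * ell n) ^ q := by
    intro K n
    have h1 : 1 ≤ 2 * (K + 1) * ell n := by
      calc 1 ≤ 2 * ell n := one_le_two_mul_ell n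
        _ ≤ 2 * (K + 1) * ell n := by
          gcongr; exact le_mul_of_one_le_right' le_add_self
    calc K * ell n ≤ 2 * (K + 1) * ell n := by
          gcongr
          exact le_self_add.trans (le_mul_of_one_le_left' (by norm_num))
      _ = (2 * (K + 1) * ell n) ^ (1 : ℝ) := (ENNReal.rpow_one _).symm
      _ ≤ _ := ENNReal.rpow_le_rpow_of_exponent_le h1 hq1.le
  rcases lt_trichotomy q 2 with hq2 | hq2 | hq2
  · obtain ⟨K, hK, h⟩ := exists_lintegral_dyadicSum_rpow_half_le D hq1 hq2
    refine ⟨2 * (K + 1), ENNReal.mul_ne_top (by norm_num) (by simp [hK]),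
      fun φ hφ g hg hgp n => ?_⟩
    refine (h φ hφ g hg (hgp.locallyIntegrable hp.le) n).trans ?_
    gcongr
    exact hroot K n
  · obtain ⟨B, -, h⟩ := exists_tsum_pairing_le D
    refine ⟨2 * (2 * B + 1), ENNReal.mul_ne_top (by norm_num)
      (ENNReal.add_ne_top.2 ⟨ENNReal.mul_ne_top (by norm_num) (by simp), by norm_num⟩),
      fun φ hφ g hg hgp n => ?_⟩
    have h1 : ∫⁻ x, dyadicSum (coeff φ n g) x ^ (q / 2) ≤ B * ∫⁻ x, ‖g x‖ₑ ^ q := by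
      rw [hq2, div_self two_ne_zero]
      simp only [ENNReal.rpow_one, ENNReal.rpow_ofNat]
      rw [lintegral_dyadicSum, tsum_coeff]
      exact h φ hφ g hg.aestronglyMeasurable
    refine h1.trans ?_
    gcongr
    refine le_trans ?_ (hroot (2 * B) n)
    calc (B : ℝ≥0∞) ≤ B * (2 * ell n) := le_mul_of_one_le_right' (one_le_two_mul_ell n)
      _ = _ := by ring
  · obtain ⟨K, hK, h⟩ := exists_lintegral_dyadicSum_rpow_le D (q := q / 2) (by linarith)
    refine ⟨K + 1, by simp [hK], fun φ hφ g hg hgp n => ?_⟩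
    refine (h φ hφ p hp.le g hg hgp n).trans ?_
    have e1 : ∀ x, (‖g x‖ₑ ^ 2) ^ (q / 2) = ‖g x‖ₑ ^ q := by
      intro x
      rw [← ENNReal.rpow_natCast, ← ENNReal.rpow_mul]
      congr 1; push_cast; ring
    simp_rw [e1]
    gcongr
    have e2 : ((K + 1) * ell n) ^ q = (((K + 1) * ell n) ^ 2) ^ (q / 2) := by
      rw [← ENNReal.rpow_natCast, ← ENNReal.rpow_mul]
      congr 1; push_cast; ring
    rw [e2]
    refine ENNReal.rpow_le_rpow ?_ (by positivity)
    rw [mul_pow]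
    gcongr
    calc K ≤ (K + 1) * 1 := by rw [mul_one]; exact le_self_add
      _ ≤ (K + 1) * (K + 1) := by gcongr; exact le_add_self
      _ = _ := by ring

/-! ### Return to the original square function -/

lemma toSet_eq_Icc (I : DyadicInterval) : I.toSet = Set.Icc I.left (I.left + I.length) := by
  simp only [toSet, left, length]; congr 1; ring

/-- The square function is almost everywhere the square root of the sum over half-open dyadic
intervals. -/
lemma shiftedSquare_ae_eq {Φ φ : DyadicInterval → ℝ → ℂ}
    (hΦ : ∀ I x, Φ I x = ((Real.sqrt I.length)⁻¹ : ℝ) * φ I x) (n : ℤ) (g : ℝ → ℂ) :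
    shiftedSquare Φ n g =ᵐ[volume] fun x => dyadicSum (coeff φ n g) x ^ (1 / 2 : ℝ) := by
  have hpair : ∀ I : DyadicInterval, ‖pairing g (Φ (I.shift n))‖ₑ ^ 2 = coeff φ n g I := by
    intro I
    have hl := I.length_pos
    have e : pairing g (Φ (I.shift n)) =
        ((Real.sqrt I.length)⁻¹ : ℝ) * pairing g (φ (I.shift n)) := by
      unfold pairing
      rw [← integral_const_mul]
      refine integral_congr_ae (ae_of_all _ fun y => ?_)
      simp only [hΦ, shift_length, map_mul, Complex.conj_ofReal]
      ring
    have h1 : ‖(((Real.sqrt I.length)⁻¹ : ℝ) : ℂ)‖ₑ ^ 2 = (I.elen)⁻¹ := by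
      rw [← ofReal_norm, Complex.norm_real, Real.norm_of_nonneg (by positivity),
        ← ENNReal.ofReal_pow (by positivity), inv_pow, Real.sq_sqrt hl.le,
        ENNReal.ofReal_inv_of_pos hl, elen]
    rw [e, enorm_mul, mul_pow, h1, coeff, ENNReal.div_eq_inv_mul]
  have hnull : ∀ᵐ x : ℝ, ∀ I : DyadicInterval, x ≠ I.left + I.length := by
    rw [ae_all_iff]
    intro I
    exact Measure.ae_ne volume _
  filter_upwards [hnull] with x hx
  unfold shiftedSquare dyadicSum
  congr 1
  refine tsum_congr fun I => ?_
  have hmem : x ∈ I.toSet ↔ x ∈ I.ico := by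
    rw [toSet_eq_Icc, ico]
    exact ⟨fun h => ⟨h.1, lt_of_le_of_ne h.2 (hx I)⟩, fun h => ⟨h.1, h.2.le⟩⟩
  by_cases h : x ∈ I.ico
  · rw [Set.indicator_of_mem (hmem.2 h), Set.indicator_of_mem h, hpair]; rfl
  · rw [Set.indicator_of_notMem (fun h' => h (hmem.1 h')), Set.indicator_of_notMem h]

lemma shiftedSquare_congr_ae (Φ : DyadicInterval → ℝ → ℂ) (n : ℤ) {g g' : ℝ → ℂ}
    (h : g =ᵐ[volume] g') : shiftedSquare Φ n g = shiftedSquare Φ n g' := by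
  have e : ∀ ψ : ℝ → ℂ, pairing g ψ = pairing g' ψ := fun ψ =>
    integral_congr_ae (by filter_upwards [h] with y hy; rw [hy])
  ext x
  simp only [shiftedSquare, e]

end ShiftedSquare

open ShiftedSquare in
theorem theorem5p1 :
    ∃ A : ℕ, ∀ p : ℝ≥0∞, 1 < p → p < ⊤ → ∀ C : ℕ → ℕ → ℝ, ∀ c : ℝ, 0 < c →
      ∃ K : ℝ, 0 ≤ K ∧
        ∀ Φ : DyadicInterval → ℝ → ℂ, IsPsiType A C c Φ →
          ∀ n : ℤ, ∀ g : ℝ → ℂ, MemLp g p volume →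
            MemLp (shiftedSquare Φ n g) p volume ∧
              eLpNorm (shiftedSquare Φ n g) p volume ≤
                ENNReal.ofReal (K * Real.log (2 + |(n : ℝ)|)) * eLpNorm g p volume := by
  -- One derivative suffices, since the bumps enter only through decay, a Lipschitz bound and mean
  -- zero.
  refine ⟨1, fun p hp hpt C c hc => ?_⟩
  obtain ⟨D, hD⟩ := exists_isWavelet C hc
  obtain ⟨K, hK, hbound⟩ := exists_lintegral_dyadicSum_rpow_le_of_memLp D hp hpt.ne
  refine ⟨K.toReal, ENNReal.toReal_nonneg, fun Φ hΦ n g hg => ?_⟩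
  obtain ⟨φ, hφ, hΦφ⟩ := hD Φ hΦ
  -- The pairings see g only up to null sets, so it may be replaced by a strongly measurable
  -- representative.
  set g' := hg.1.mk g with hg'
  have hgg' : g =ᵐ[volume] g' := hg.1.ae_eq_mk
  have hg'm : StronglyMeasurable g' := hg.1.stronglyMeasurable_mk
  have hg'p : MemLp g' p := (memLp_congr_ae hgg').1 hg
  have hp0 : p ≠ 0 := (zero_lt_one.trans hp).ne'
  have hq0 : 0 < p.toReal := ENNReal.toReal_pos hp0 hpt.ne
  rw [shiftedSquare_congr_ae Φ n hgg', eLpNorm_congr_ae hgg']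
  have hae := shiftedSquare_ae_eq hΦφ n g'
  have hSm : Measurable fun x => dyadicSum (coeff φ n g') x ^ (1 / 2 : ℝ) :=
    (measurable_dyadicSum _).pow_const _
  have hlog : ENNReal.ofReal (K.toReal * Real.log (2 + |(n : ℝ)|)) = K * ell n := by
    rw [ENNReal.ofReal_mul ENNReal.toReal_nonneg, ENNReal.ofReal_toReal hK, ell]
  have hle : eLpNorm (shiftedSquare Φ n g') p volume ≤ K * ell n * eLpNorm g' p volume := by
    rw [eLpNorm_congr_ae hae, eLpNorm_eq_lintegral_rpow_enorm_toReal hp0 hpt.ne,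
      eLpNorm_eq_lintegral_rpow_enorm_toReal hp0 hpt.ne]
    have e : ∀ x, ‖dyadicSum (coeff φ n g') x ^ (1 / 2 : ℝ)‖ₑ ^ p.toReal =
        dyadicSum (coeff φ n g') x ^ (p.toReal / 2) := by
      intro x
      rw [enorm_eq_self, ← ENNReal.rpow_mul]
      congr 1; ring
    simp_rw [e]
    refine (ENNReal.rpow_le_rpow (hbound φ hφ g' hg'm hg'p n) (by positivity)).trans
      (le_of_eq ?_)
    rw [ENNReal.mul_rpow_of_nonneg _ _ (by positivity), ← ENNReal.rpow_mul,
      mul_one_div_cancel hq0.ne', ENNReal.rpow_one]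
  refine ⟨⟨hSm.aestronglyMeasurable.congr hae.symm, ?_⟩, by rw [hlog]; exact hle⟩
  exact lt_of_le_of_lt hle (ENNReal.mul_lt_top
    (ENNReal.mul_lt_top hK.lt_top (ell_ne_top n).lt_top) hg'p.2)
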